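/- Let $\mathscr G$ be the square lattice $\mathbb Z^2$, the triangular lattice $\mathscr T$ or the hexagonal lattice $\mathscr H$, with its standard drawing in the plane, vertex set $V$ and degree $\deg(\mathscr G)=4,6,3$ respectively. Let $\nu(\mathscr G)=2,1,3$ and $\widehat\lambda(\mathscr G)=2+\sqrt3,\;3+2\sqrt2,\;\frac{3+\sqrt5}{2}$ respectively, and $c_\ddagger=\log_{\widehat\lambda(\mathscr G)}\frac{\deg(\mathscr G)^2}{\deg(\mathscr G)^2-1}$. Write $N(x)$ for the set of neighbours of $x$. Two distinct vertices are *$*$-adjacent* if they surround a common face. For finite $A\subset V$, let $A_\infty^c$ be the infinite connected component of $A^c=V\setminus A$; the *exterior outer $*$-boundary* $\partial_{\infty,*}^{\mathrm o}A$ is the set of vertices of $A_\infty^c$ that are $*$-adjacent to a vertex of $A$; the *$*$-clusters* of $A$ are its connected components with respect to $*$-adjacency. Two finite sets $D_1,D_2\subset V$ that are not $*$-adjacent to each other are *interlocked* if (1) there is $x\in(D_1\cup D_2)_\infty^c$ with $|N(x)\setminus(D_1\cup D_2)|=2$ and $N(x)\cap D_1\ne\emptyset\ne N(x)\cap D_2$,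 or (2) there are adjacent $x_1,x_2\in(D_1\cup D_2)_\infty^c$ such that $|N(x_i)\setminus D_i|=2$ and $N(x_i)\cap D_{3-i}=\emptyset$ for $i=1,2$. An *interlocked cluster* of $A$ is the union of all $*$-clusters of $A$ that can be reached from a given one through a sequence of $*$-clusters of $A$ in which consecutive ones are interlocked. An interlocked cluster $D$ of $A$ is *exposed* if $\partial_{\infty,*}^{\mathrm o}D\cap A_\infty^c\neq\emptyset$, i.e. if $D$ is not enclosed by the rest of $A$. A vertex $z\in A^c$ is *free* in $A$ if $|N(z)\setminus A|\ge3$. For a finite set $\mathcal E$ of oriented edges of $\mathscr G$ with endpoints in $A^c$ let $$\mathbf X_A(\mathcal E)=|\mathcal E|-c_\ddagger\cdot\bigl|\{\vec e_{x,y}\in\mathcal E: x\text{ is free in }A\}\bigr|.$$ For a path $\eta$ let $\mathbf R^{\mathrm e}(\eta)$ be the set of oriented edges that it traverses. **Proposition.** There is a constant $c=c(\mathscr G)>0$ such that for every finite $A\subset V$, every interlocked cluster $D$ of $A$ and all $x,y\in\partial_{\infty,*}^{\mathrm o}D$ there is a path $\eta$ in $\mathscr G$ from $x$ to $y$, all of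 whose vertices lie in $A^c$, such that $$\mathbf X_A(\mathbf R^{\mathrm e}(\eta))\le\nu(\mathscr G)|D|+4,$$ and, if $D$ is exposed, moreover $$\mathbf X_A(\mathbf R^{\mathrm e}(\eta))\le\nu(\mathscr G)|D|-c\sqrt{|D|}+4.$$ -/

import Mathlib

/-- A graph drawn in the plane, recorded through its edges and, for every face of the drawing,
the set of vertices surrounding that face. -/
structure PlaneGraph (V : Type) where
  /-- the underlying simple graph -/
  graph : SimpleGraph V
  /-- the vertex sets of the faces -/
  faces : Set (Set V)

/-- The square lattice, `(a, b)` being drawn at the point `(a, b)`. The faces are unit squares. -/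
def squareLattice : PlaneGraph (ℤ × ℤ) where
  graph :=
    { Adj := fun p q => q - p ∈ ({(1, 0), (-1, 0), (0, 1), (0, -1)} : Set (ℤ × ℤ))
      symm := ⟨by
        rintro ⟨a, b⟩ ⟨c, d⟩ h
        simp only [Prod.mk_sub_mk, Set.mem_insert_iff, Set.mem_singleton_iff, Prod.mk.injEq] at h ⊢
        omega⟩
      loopless := ⟨by
        rintro ⟨a, b⟩ h
        simp [Prod.ext_iff] at h⟩ }
  faces := {f | ∃ a b : ℤ, f = {(a, b), (a + 1, b), (a + 1, b + 1), (a, b + 1)}}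

/-- The triangular lattice, `(a, b)` being drawn at the point `a • (1, 0) + b • (1/2, √3/2)`.
The faces are the upward and the downward unit triangles. -/
def triangularLattice : PlaneGraph (ℤ × ℤ) where
  graph :=
    { Adj := fun p q =>
        q - p ∈ ({(1, 0), (-1, 0), (0, 1), (0, -1), (1, -1), (-1, 1)} : Set (ℤ × ℤ))
      symm := ⟨by
        rintro ⟨a, b⟩ ⟨c, d⟩ h
        simp only [Prod.mk_sub_mk, Set.mem_insert_iff, Set.mem_singleton_iff, Prod.mk.injEq] at h ⊢
        omega⟩
      loopless := ⟨by
        rintro ⟨a, b⟩ h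
        simp [Prod.ext_iff] at h⟩ }
  faces :=
    {f | ∃ a b : ℤ, f = {(a, b), (a + 1, b), (a, b + 1)} ∨
      f = {(a + 1, b), (a + 1, b + 1), (a, b + 1)}}

/-- The three edges of the hexagonal lattice at the vertex `(a, b, false)`. -/
def HexStep (p q : ℤ × ℤ × Bool) : Prop :=
  p.2.2 = false ∧ q.2.2 = true ∧
    (q.1 - p.1, q.2.1 - p.2.1) ∈ ({(0, 0), (-1, 0), (0, -1)} : Set (ℤ × ℤ))

/-- The hexagonal lattice, as the dual of a triangular lattice: `(a, b, false)` is drawn at the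
centre of the upward triangle `(a, b), (a + 1, b), (a, b + 1)`, and `(a, b, true)` at the centre of
the downward triangle `(a + 1, b), (a + 1, b + 1), (a, b + 1)`. Vertices are adjacent when their
triangles share a side. The face with index `(a, b)` is the hexagon of the six triangles around the
triangular lattice point `(a, b)`, listed in cyclic order. -/
def hexagonalLattice : PlaneGraph (ℤ × ℤ × Bool) where
  graph :=
    { Adj := fun p q => HexStep p q ∨ HexStep q p
      symm := ⟨fun _ _ h => h.symm⟩
      loopless := ⟨by
        rintro ⟨a, b, s⟩ h
        cases s <;> simp [HexStep] at h⟩ }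
  faces :=
    {f | ∃ a b : ℤ, f = {(a, b, false), (a - 1, b, true), (a - 1, b, false),
      (a - 1, b - 1, true), (a, b - 1, false), (a, b - 1, true)}}

/-- The names of the three regular lattices of the plane. -/
inductive PlanarLattice
  | square
  | triangular
  | hexagonal

namespace PlanarLattice

/-- The vertex set. -/
def Vertex : PlanarLattice → Type
  | square => ℤ × ℤ
  | triangular => ℤ × ℤ
  | hexagonal => ℤ × ℤ × Bool

/-- The lattice as a graph drawn in the plane. -/
def plane : (L : PlanarLattice) → PlaneGraph L.Vertex
  | square => squareLattice
  | triangular => triangularLattice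
  | hexagonal => hexagonalLattice

/-- The degree `deg` of every vertex. -/
def deg : PlanarLattice → ℝ
  | square => 4
  | triangular => 6
  | hexagonal => 3

/-- The constant `ν`. -/
def nu : PlanarLattice → ℝ
  | square => 2
  | triangular => 1
  | hexagonal => 3

/-- The constant `λ̂`. -/
noncomputable def lambdaHat : PlanarLattice → ℝ
  | square => 2 + Real.sqrt 3
  | triangular => 3 + 2 * Real.sqrt 2
  | hexagonal => (3 + Real.sqrt 5) / 2

/-- The constant `c‡ = log_λ̂ (deg² / (deg² - 1))`. -/
noncomputable def cDagger (L : PlanarLattice) : ℝ :=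
  Real.logb L.lambdaHat (L.deg ^ 2 / (L.deg ^ 2 - 1))

end PlanarLattice

/-- `u` and `v` are joined by a path of `G` all of whose vertices lie in `S`. -/
def JoinedWithin {V : Type} (G : SimpleGraph V) (S : Set V) (u v : V) : Prop :=
  ∃ p : G.Walk u v, ∀ w ∈ p.support, w ∈ S

namespace PlaneGraph

variable {V : Type} (P : PlaneGraph V)

/-- `*`-adjacency: distinct vertices that surround a common face. -/
def starGraph : SimpleGraph V where
  Adj x y := x ≠ y ∧ ∃ f ∈ P.faces, x ∈ f ∧ y ∈ f
  symm := ⟨fun _ _ h => ⟨h.1.symm, h.2.imp fun _ hf => ⟨hf.1, hf.2.2, hf.2.1⟩⟩⟩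
  loopless := ⟨fun _ h => h.1 rfl⟩

/-- The infinite connected component `A_∞ᶜ` of the complement of a finite set `A`. -/
def infComp (A : Set V) : Set V :=
  {v | {w | JoinedWithin P.graph Aᶜ v w}.Infinite}

/-- The exterior outer `*`-boundary of `A`: the vertices of `A_∞ᶜ` that are `*`-adjacent to a
vertex of `A`. -/
def extStarBoundary (A : Set V) : Set V :=
  {v | v ∈ P.infComp A ∧ ∃ x ∈ A, P.starGraph.Adj x v}

/-- `C` is a `*`-cluster of `A`, that is, a `*`-connected component of `A`. -/
def IsStarCluster (A C : Set V) : Prop :=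
  ∃ x ∈ A, C = {y | JoinedWithin P.starGraph A x y}

/-- Two sets that are not `*`-adjacent are interlocked when one of two local configurations
occurs. -/
def Interlocked (D₁ D₂ : Set V) : Prop :=
  (∀ a ∈ D₁, ∀ b ∈ D₂, ¬ P.starGraph.Adj a b) ∧
  ((∃ x ∈ P.infComp (D₁ ∪ D₂),
      (P.graph.neighborSet x \ (D₁ ∪ D₂)).ncard = 2 ∧
      (P.graph.neighborSet x ∩ D₁).Nonempty ∧ (P.graph.neighborSet x ∩ D₂).Nonempty) ∨
   (∃ x₁ ∈ P.infComp (D₁ ∪ D₂), ∃ x₂ ∈ P.infComp (D₁ ∪ D₂), P.graph.Adj x₁ x₂ ∧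
      ((P.graph.neighborSet x₁ \ D₁).ncard = 2 ∧ P.graph.neighborSet x₁ ∩ D₂ = ∅) ∧
      ((P.graph.neighborSet x₂ \ D₂).ncard = 2 ∧ P.graph.neighborSet x₂ ∩ D₁ = ∅)))

/-- One step between interlocked `*`-clusters of `A`. -/
def InterlockStep (A C C' : Set V) : Prop :=
  P.IsStarCluster A C ∧ P.IsStarCluster A C' ∧ P.Interlocked C C'

/-- `D` is an interlocked cluster of `A`: the union of all `*`-clusters of `A` that can be reached
from a given one through successively interlocked `*`-clusters of `A`. -/
def IsInterlockedCluster (A D : Set V) : Prop :=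
  ∃ C₀, P.IsStarCluster A C₀ ∧ D = ⋃₀ {C | Relation.ReflTransGen (P.InterlockStep A) C₀ C}

/-- The interlocked cluster `D` of `A` is exposed to infinity: its exterior outer `*`-boundary
meets the infinite component of the complement of `A`. -/
def IsExposed (A D : Set V) : Prop :=
  (P.extStarBoundary D ∩ P.infComp A).Nonempty

/-- A vertex `z` outside `A` is free in `A` when it has at least three neighbours outside `A`. -/
def IsFree (A : Set V) (z : V) : Prop :=
  z ∉ A ∧ 3 ≤ (P.graph.neighborSet z \ A).ncard

/-- The set of oriented edges traversed by a path. -/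
def edgeRange {x y : V} (η : P.graph.Walk x y) : Set P.graph.Dart :=
  {e | e ∈ η.darts}

end PlaneGraph

/-- The weighted number `X_A` of oriented edges in a set `E`. -/
noncomputable def PlanarLattice.weight (L : PlanarLattice) (A : Set L.Vertex) (E : Set L.plane.graph.Dart) :
    ℝ :=
  (E.ncard : ℝ) - L.cDagger * ({e ∈ E | L.plane.IsFree A e.fst}.ncard : ℝ)

/-! The proof walks around the clusters. The contour of a finite set E consists of the oriented
edges with both ends outside E whose left face has a vertex in E. At every vertex as many contour
edges enter as leave. Hence two vertices in one component of the contour are joined by arc-disjoint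
trails in both directions, and one of these, reversed if necessary, carries at most half of the
total weight, up to a correction at the end points (`BalancedArcs.exists_walk`). So it suffices to
find a contour that avoids A, connects x to y and has length at most 2ν|D| + κ. Here κ is given by
gd = 2ν + κ + 2d, for degree d and faces with g edges; it equals 4, 4, 6 for the three lattices.

For a single *-cluster the length bound follows by adding its vertices one at a time: one vertex has
a contour of length gd - 2d = 2ν + κ, and each further vertex costs at most 2ν (`card_contour_le`).
Planarity enters in `mem_of_closedUnder`: a union R of components of the contour of C defines a mod
2 cocycle whose potential is constant on C and on the infinite component of the complement, so R
contains all of the exterior boundary of C or none of it.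

For a chain of interlocked clusters, adding the one or two vertices at which two clusters interlock
splices their contours and deletes at least κ arcs. This absorbs the additive constant of the new
contour (`IsMerger.cons`). Halving gives ν|D| + κ/2 + c with κ/2 ≤ 3 and c ≤ 1, which is the first
estimate.

The gain of order √|D| comes from free vertices, each of which discounts the contour. Beside the
leftmost point of a row of an exposed cluster there is a free boundary vertex, unless the next row
reaches further to the left; otherwise the cluster would interlock with, or be *-adjacent to, a part
of A outside it. Thus of any two neighbouring occupied rows at least one is good
(`exists_free_of_rows`), and the same holds for columns, while |D| is at most a constant times the
number of rows times the number of columns. Vertices of D outside the chosen chain cost nothing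
along the path; the ν saved on each of them pays for the free vertices that are adjacent only to
them (`exists_walk_of_free`). -/

set_option linter.unusedSectionVars false
open PlaneGraph

/-! ### Balanced sets of arcs and disjoint trails -/

section Trails

variable {V Δ : Type*} (src tgt : Δ → V)

/-- A finite set of arcs is balanced when every vertex has as many outgoing as incoming arcs. -/
def BalancedArcs (S : Finset Δ) : Prop :=
  ∀ φ : V → ℤ, ∑ e ∈ S, φ (src e) = ∑ e ∈ S, φ (tgt e)

/-- `R` is a union of connected components of the arcs in `S`. -/
def ClosedUnder (S : Finset Δ) (R : Set V) : Prop :=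
  ∀ e ∈ S, (src e ∈ R ↔ tgt e ∈ R)

/-- `S` is the set of arcs of a trail from `x` to the last argument. -/
inductive IsTrail [DecidableEq Δ] (x : V) : Finset Δ → V → Prop
  | nil : IsTrail x ∅ x
  | snoc {S : Finset Δ} {e : Δ} : IsTrail x S (src e) → e ∉ S → IsTrail x (insert e S) (tgt e)

variable {src tgt}

/-- A set with no arc of a balanced set leaving it has none entering it. -/
theorem BalancedArcs.closedUnder {S : Finset Δ} (hS : BalancedArcs src tgt S) {R : Set V}
    (hR : ∀ e ∈ S, src e ∈ R → tgt e ∈ R) : ClosedUnder src tgt S R := by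
  classical
  have h := hS (fun v => if v ∈ R then 1 else 0)
  have hle : ∀ e ∈ S, (if src e ∈ R then (1 : ℤ) else 0) ≤ if tgt e ∈ R then 1 else 0 := by
    intro e he
    have := hR e he
    split_ifs <;> simp_all
  have := (Finset.sum_eq_sum_iff_of_le hle).1 h
  intro e he
  have := this e he
  split_ifs at this <;> simp_all

variable [DecidableEq Δ]

theorem IsTrail.sum_sub {x y : V} {S : Finset Δ} (h : IsTrail src tgt x S y) (φ : V → ℤ) :
    ∑ e ∈ S, φ (src e) - ∑ e ∈ S, φ (tgt e) = φ x - φ y := by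
  induction h with
  | nil => simp
  | snoc _ he ih => rw [Finset.sum_insert he, Finset.sum_insert he]; linarith

theorem IsTrail.exists_prefix {x y : V} {S : Finset Δ} (h : IsTrail src tgt x S y) {e : Δ}
    (he : e ∈ S) : ∃ S' ⊆ S, IsTrail src tgt x S' (tgt e) := by
  induction h with
  | nil => simp at he
  | @snoc S e' h he' ih =>
    rcases Finset.mem_insert.1 he with rfl | he
    · exact ⟨_, subset_rfl, h.snoc he'⟩
    · obtain ⟨S', hS', ht⟩ := ih he
      exact ⟨S', hS'.trans (Finset.subset_insert _ _), ht⟩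

/-- The set of end points of trails from `x` is closed under following arcs: an arc already used is
the last arc of some initial piece of the trail. By balance, a set that no arc leaves is a union of
components. -/
theorem BalancedArcs.exists_trail {S : Finset Δ} (hS : BalancedArcs src tgt S) {x y : V}
    (hxy : ∀ R : Set V, ClosedUnder src tgt S R → x ∈ R → y ∈ R) :
    ∃ S' ⊆ S, IsTrail src tgt x S' y := by
  refine hxy {v | ∃ S' ⊆ S, IsTrail src tgt x S' v} (hS.closedUnder ?_)
    ⟨∅, Finset.empty_subset _, .nil⟩
  rintro e he ⟨S', hS', ht⟩
  by_cases hmem : e ∈ S'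
  · obtain ⟨S'', h1, h2⟩ := ht.exists_prefix hmem
    exact ⟨S'', h1.trans hS', h2⟩
  · exact ⟨insert e S', Finset.insert_subset he hS', ht.snoc hmem⟩

/-- A longest trail from `x` must end at `y`: if it ended elsewhere, testing the excess with the
indicator of its end point would produce an unused arc leaving that point. -/
theorem exists_trail_of_excess {S : Finset Δ} {x y : V}
    (hS : ∀ φ : V → ℤ, ∑ e ∈ S, φ (src e) - ∑ e ∈ S, φ (tgt e) = φ x - φ y) :
    ∃ S' ⊆ S, IsTrail src tgt x S' y := by
  classical
  obtain ⟨S', hS', hmax⟩ := (S.powerset.filter fun T => ∃ u, IsTrail src tgt x T u).exists_max_image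
    Finset.card ⟨∅, by simpa using ⟨x, .nil⟩⟩
  simp only [Finset.mem_filter, Finset.mem_powerset, and_imp, forall_exists_index] at hS' hmax
  obtain ⟨hsub, u, hu⟩ := hS'
  by_cases huy : u = y
  · exact ⟨S', hsub, huy ▸ hu⟩
  exfalso
  set φ : V → ℤ := fun v => if v = u then 1 else 0 with hφ
  have h1 := hS φ
  have h2 := hu.sum_sub φ
  rw [← Finset.sum_sdiff hsub, ← Finset.sum_sdiff (f := fun e => φ (tgt e)) hsub] at h1
  have h3 : ∑ e ∈ S \ S', φ (src e) = 1 + ∑ e ∈ S \ S', φ (tgt e) := by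
    have : φ u = 1 := by simp [hφ]
    have : φ y = 0 := by simp [hφ, Ne.symm huy]
    linarith
  have h4 : 0 ≤ ∑ e ∈ S \ S', φ (tgt e) :=
    Finset.sum_nonneg fun e _ => by simp only [hφ]; split_ifs <;> simp
  obtain ⟨e, he, hne⟩ := Finset.exists_ne_zero_of_sum_ne_zero (s := S \ S') (f := fun e => φ (src e))
    (by omega)
  have hsrc : src e = u := by
    by_contra h
    exact hne (by simp [hφ, h])
  rw [Finset.mem_sdiff] at he
  have := hmax (insert e S') (Finset.insert_subset he.1 hsub) _ ((hsrc ▸ hu).snoc he.2)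
  rw [Finset.card_insert_of_notMem he.2] at this
  omega

/-- Once a trail from `x` to `y` is removed, what remains has the excess of a trail from `y` to `x`.
-/
theorem BalancedArcs.exists_disjoint_trails {S : Finset Δ} (hS : BalancedArcs src tgt S) {x y : V}
    (hxy : ∀ R : Set V, ClosedUnder src tgt S R → x ∈ R → y ∈ R) :
    ∃ S₁ S₂, S₁ ⊆ S ∧ S₂ ⊆ S ∧ Disjoint S₁ S₂ ∧
      IsTrail src tgt x S₁ y ∧ IsTrail src tgt y S₂ x := by
  obtain ⟨S₁, h1, ht1⟩ := hS.exists_trail hxy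
  obtain ⟨S₂, h2, ht2⟩ := exists_trail_of_excess (S := S \ S₁) (src := src) (tgt := tgt) (x := y)
    (y := x) (fun φ => by
      have a := hS φ
      have b := ht1.sum_sub φ
      rw [← Finset.sum_sdiff h1, ← Finset.sum_sdiff (f := fun e => φ (tgt e)) h1] at a
      linarith)
  exact ⟨S₁, S₂, h1, h2.trans Finset.sdiff_subset,
    (Finset.disjoint_of_subset_left h2 Finset.sdiff_disjoint).symm, ht1, ht2⟩

theorem IsTrail.exists_walk {G : SimpleGraph V} {x y : V} {S : Finset Δ}
    (h : IsTrail src tgt x S y) (hadj : ∀ e ∈ S, G.Adj (src e) (tgt e)) :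
    ∃ p : G.Walk x y, (∀ u ∈ p.support, u = x ∨ ∃ e ∈ S, u = tgt e) ∧
      ∀ w : V → ℝ, (p.darts.map fun e => w e.fst).sum = ∑ e ∈ S, w (src e) := by
  induction h with
  | nil => exact ⟨.nil, by simp, by simp⟩
  | @snoc S e h he ih =>
    obtain ⟨p, hp, hw⟩ := ih fun e' he' => hadj e' (Finset.mem_insert_of_mem he')
    refine ⟨p.concat (hadj e (Finset.mem_insert_self _ _)), ?_, ?_⟩
    · intro u hu
      rw [SimpleGraph.Walk.support_concat, List.mem_append, List.mem_singleton] at hu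
      rcases hu with hu | rfl
      · rcases hp u hu with h | ⟨e', he', h⟩
        · exact .inl h
        · exact .inr ⟨e', Finset.mem_insert_of_mem he', h⟩
      · exact .inr ⟨e, Finset.mem_insert_self _ _, rfl⟩
    · intro w
      rw [Finset.sum_insert he, ← hw w, SimpleGraph.Walk.darts_concat]
      simp [add_comm]

end Trails

/-- Weights sit at the sources of edges, so reversing a walk changes its weight by a boundary term
only. This is the price for using the return trail backwards. -/
theorem SimpleGraph.Walk.sum_darts_fst_add {V : Type*} {G : SimpleGraph V} {x y : V}
    (p : G.Walk x y) (w : V → ℝ) :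
    (p.darts.map fun e => w e.fst).sum + w y = (p.darts.map fun e => w e.snd).sum + w x := by
  induction p with
  | nil => simp
  | cons h p ih => simp only [darts_cons, List.map_cons, List.sum_cons]; linarith

theorem SimpleGraph.Walk.sum_darts_reverse {V : Type*} {G : SimpleGraph V} {x y : V}
    (p : G.Walk x y) (w : V → ℝ) :
    (p.reverse.darts.map fun e => w e.fst).sum = (p.darts.map fun e => w e.snd).sum := by
  simp [SimpleGraph.Walk.darts_reverse, List.sum_reverse, Function.comp_def]

/-- Two points connected by a balanced set of arcs are joined by a walk of at most about half of
the total weight. -/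
theorem BalancedArcs.exists_walk {V Δ : Type*} {src tgt : Δ → V} {S : Finset Δ}
    (hS : BalancedArcs src tgt S) {G : SimpleGraph V} (hadj : ∀ e ∈ S, G.Adj (src e) (tgt e)) {x y : V}
    (hxy : ∀ R : Set V, ClosedUnder src tgt S R → x ∈ R → y ∈ R)
    {w : V → ℝ} (hw : ∀ v, 0 ≤ w v) :
    ∃ p : G.Walk x y, (∀ u ∈ p.support, u = x ∨ u = y ∨ ∃ e ∈ S, u = tgt e) ∧
      2 * (p.darts.map fun e => w e.fst).sum ≤ ∑ e ∈ S, w (src e) + w x - w y := by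
  classical
  obtain ⟨S₁, S₂, h1, h2, hd, ht1, ht2⟩ := hS.exists_disjoint_trails hxy
  obtain ⟨p, hp, hpw⟩ := ht1.exists_walk (G := G) fun e he => hadj e (h1 he)
  obtain ⟨q, hq, hqw⟩ := ht2.exists_walk (G := G) fun e he => hadj e (h2 he)
  have hsum : ∑ e ∈ S₁, w (src e) + ∑ e ∈ S₂, w (src e) ≤ ∑ e ∈ S, w (src e) := by
    rw [← Finset.sum_union hd]
    exact Finset.sum_le_sum_of_subset_of_nonneg (Finset.union_subset h1 h2) fun e _ _ => hw _
  have e1 := hpw w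
  have e2 := hqw w
  have e3 := q.sum_darts_fst_add w
  have e4 := q.sum_darts_reverse w
  -- Both trails together weigh at most the whole of `S`, so if the outward one is too heavy then
  -- the reversed return trail is light enough.
  by_cases hle : 2 * (p.darts.map fun e => w e.fst).sum ≤ ∑ e ∈ S, w (src e) + w x - w y
  · refine ⟨p, fun u hu => ?_, hle⟩
    rcases hp u hu with h | ⟨e, he, h⟩
    · exact .inl h
    · exact .inr (.inr ⟨e, h1 he, h⟩)
  · refine ⟨q.reverse, fun u hu => ?_, by linarith⟩
    rw [SimpleGraph.Walk.support_reverse, List.mem_reverse] at hu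
    rcases hq u hu with h | ⟨e, he, h⟩
    · exact .inr (.inl h)
    · exact .inr (.inr ⟨e, h2 he, h⟩)

/-! ### Rotation systems and contours -/

/-- A combinatorial description of a plane graph that is regular of degree `d` and all of whose
faces have `g` edges: the neighbours of each vertex are listed in cyclic order, and `left v k` is
the face between the neighbours `k` and `k + 1` of `v`, on the left of the edge from `v` to its
neighbour `k`. -/
structure RotationSystem {V : Type} (P : PlaneGraph V) (d g : ℕ) [NeZero d] (F : Type) where
  nbr : V → Fin d → V
  rev : V → Fin d → Fin d
  left : V → Fin d → F
  faceDarts : F → Finset (V × Fin d)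
  adj_iff : ∀ v w, P.graph.Adj v w ↔ ∃ k, nbr v k = w
  nbr_injective : ∀ v, Function.Injective (nbr v)
  left_injective : ∀ v, Function.Injective (left v)
  nbr_rev : ∀ v k, nbr (nbr v k) (rev v k) = v
  left_rev : ∀ v k, left (nbr v (k + 1)) (rev v (k + 1)) = left v k
  cofacial_iff : ∀ x y, (∃ f ∈ P.faces, x ∈ f ∧ y ∈ f) ↔ ∃ k l, left x k = left y l
  mem_faceDarts : ∀ f e, e ∈ faceDarts f ↔ left e.1 e.2 = f
  card_faceDarts : ∀ f, (faceDarts f).card = g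
  face_connected : ∀ (f : F) (Q : V → Prop),
    (∀ v k, left v k = f → (Q v ↔ Q (nbr v k))) →
      ∀ v k w l, left v k = f → left w l = f → Q v → Q w
  /-- every cocycle of the graph subdivided by its faces is a coboundary -/
  exact : ∀ o : V → F → ZMod 2,
    (∀ v k, o v (left v (k + 1)) + o (nbr v (k + 1)) (left v (k + 1)) =
      o v (left v k) + o (nbr v (k + 1)) (left v k)) →
    ∃ h : V → ZMod 2, ∀ v k, h v + h (nbr v k) = o v (left v k) + o (nbr v k) (left v k)

namespace RotationSystem

variable {V F : Type} [DecidableEq V] [DecidableEq F] {P : PlaneGraph V} {d g : ℕ} [NeZero d]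
  (T : RotationSystem P d g F)

theorem rev_rev (v : V) (k : Fin d) : T.rev (T.nbr v k) (T.rev v k) = k := by
  have h := T.nbr_rev (T.nbr v k) (T.rev v k)
  rw [T.nbr_rev v k] at h
  exact T.nbr_injective v h

theorem adj_nbr (v : V) (k : Fin d) : P.graph.Adj v (T.nbr v k) :=
  (T.adj_iff _ _).2 ⟨k, rfl⟩

theorem nbr_ne (v : V) (k : Fin d) : T.nbr v k ≠ v :=
  (T.adj_nbr v k).ne'

theorem left_nbr_succ (v : V) (k : Fin d) : ∃ l, T.left (T.nbr v (k + 1)) l = T.left v k :=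
  ⟨_, T.left_rev v k⟩

theorem left_nbr (v : V) (k : Fin d) : ∃ l, T.left (T.nbr v k) l = T.left v k := by
  have h := T.left_rev (T.nbr v k) (T.rev v k - 1)
  rw [sub_add_cancel, T.nbr_rev] at h
  rw [T.rev_rev] at h
  exact ⟨_, h.symm⟩

/-- The end of an oriented edge. -/
def tgt (e : V × Fin d) : V := T.nbr e.1 e.2

/-- The faces with a vertex in `E`. -/
def touched (E : Finset V) : Finset F := E.biUnion fun v => Finset.univ.image (T.left v)

theorem mem_touched {E : Finset V} {f : F} : f ∈ T.touched E ↔ ∃ u ∈ E, ∃ k, T.left u k = f := by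
  simp [touched]

theorem left_mem_touched {E : Finset V} {v : V} (hv : v ∈ E) (k : Fin d) :
    T.left v k ∈ T.touched E := T.mem_touched.2 ⟨v, hv, k, rfl⟩

theorem touched_union (E E' : Finset V) : T.touched (E ∪ E') = T.touched E ∪ T.touched E' := by
  simp only [touched, Finset.union_biUnion]

theorem left_mem_touched_of_nbr {E : Finset V} {v : V} {k : Fin d} (h : T.nbr v k ∈ E) :
    T.left v k ∈ T.touched E := by
  obtain ⟨l, hl⟩ := T.left_nbr v k
  exact T.mem_touched.2 ⟨_, h, l, hl⟩

theorem left_mem_touched_of_nbr_succ {E : Finset V} {v : V} {k : Fin d} (h : T.nbr v (k + 1) ∈ E) :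
    T.left v k ∈ T.touched E := by
  obtain ⟨l, hl⟩ := T.left_nbr_succ v k
  exact T.mem_touched.2 ⟨_, h, l, hl⟩

/-- The oriented edges outside `E` that have a face touching `E` on their left. -/
def contour (E : Finset V) : Finset (V × Fin d) :=
  ((T.touched E).biUnion T.faceDarts).filter fun e => e.1 ∉ E ∧ T.tgt e ∉ E

theorem mem_contour {E : Finset V} {e : V × Fin d} :
    e ∈ T.contour E ↔ T.left e.1 e.2 ∈ T.touched E ∧ e.1 ∉ E ∧ T.tgt e ∉ E := by
  simp [contour, T.mem_faceDarts]

/-- A neighbour in `E` makes the faces on both sides of its edge touched. Both counts are therefore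
the number of touched faces around `v` minus the number of neighbours in `E`, the faces being
indexed with a shift by one. -/
theorem card_out_eq_card_in (E : Finset V) (v : V) :
    (Finset.univ.filter fun k => T.left v k ∈ T.touched E ∧ T.nbr v k ∉ E).card =
      (Finset.univ.filter fun k => T.left v (k - 1) ∈ T.touched E ∧ T.nbr v k ∉ E).card := by
  have h1 : (Finset.univ.filter fun k => T.left v k ∈ T.touched E ∧ T.nbr v k ∉ E).card +
      (Finset.univ.filter fun k => T.nbr v k ∈ E).card =
      (Finset.univ.filter fun k => T.left v k ∈ T.touched E).card := by
    rw [← Finset.card_union_of_disjoint]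
    · congr 1
      ext k
      have := T.left_mem_touched_of_nbr (E := E) (v := v) (k := k)
      simp only [Finset.mem_union, Finset.mem_filter, Finset.mem_univ, true_and]
      tauto
    · rw [Finset.disjoint_filter]
      tauto
  have h2 : (Finset.univ.filter fun k => T.left v (k - 1) ∈ T.touched E ∧ T.nbr v k ∉ E).card +
      (Finset.univ.filter fun k => T.nbr v k ∈ E).card =
      (Finset.univ.filter fun k => T.left v (k - 1) ∈ T.touched E).card := by
    rw [← Finset.card_union_of_disjoint]
    · congr 1
      ext k
      have := T.left_mem_touched_of_nbr_succ (E := E) (v := v) (k := k - 1)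
      rw [sub_add_cancel] at this
      simp only [Finset.mem_union, Finset.mem_filter, Finset.mem_univ, true_and]
      tauto
    · rw [Finset.disjoint_filter]
      tauto
  have h3 : (Finset.univ.filter fun k => T.left v (k - 1) ∈ T.touched E).card =
      (Finset.univ.filter fun k => T.left v k ∈ T.touched E).card := by
    refine Finset.card_bij (fun k _ => k - 1) (by simp) (fun _ _ _ _ h => by simpa using h)
      fun k hk => ⟨k + 1, ?_, by simp⟩
    simpa using hk
  omega

theorem balanced_contour (E : Finset V) : BalancedArcs Prod.fst T.tgt (T.contour E) := by
  intro φ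
  set S := T.contour E with hS
  -- The reversed arcs. An arc entering `v` thereby becomes an index `k` at `v` for which the face
  -- on the right, `left v (k - 1)`, is touched.
  set S' : Finset (V × Fin d) := S.image fun e => (T.tgt e, T.rev e.1 e.2) with hS'
  have hinj : Function.Injective fun e : V × Fin d => (T.tgt e, T.rev e.1 e.2) := by
    rintro ⟨v, k⟩ ⟨w, l⟩ h
    simp only [tgt, Prod.mk.injEq] at h
    have h1 := T.nbr_rev v k
    have h2 := T.nbr_rev w l
    have h3 := T.rev_rev v k
    have h4 := T.rev_rev w l
    rw [h.1, h.2] at h1 h3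
    rw [← h1, ← h3, h2, h4]
  have hmem : ∀ e, e ∈ S' ↔ T.left e.1 (e.2 - 1) ∈ T.touched E ∧ e.1 ∉ E ∧ T.tgt e ∉ E := by
    rintro ⟨v, k⟩
    have hl := T.left_rev v (k - 1)
    rw [sub_add_cancel] at hl
    simp only [hS', Finset.mem_image, hS, T.mem_contour]
    constructor
    · rintro ⟨⟨w, l⟩, ⟨h1, h2, h3⟩, h⟩
      simp only [tgt, Prod.mk.injEq] at *
      obtain ⟨rfl, rfl⟩ := h
      rw [T.nbr_rev, T.rev_rev] at hl
      rw [T.nbr_rev, ← hl]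
      exact ⟨h1, h3, h2⟩
    · rintro ⟨h1, h2, h3⟩
      refine ⟨(T.nbr v k, T.rev v k), ⟨?_, h3, ?_⟩, ?_⟩
      · rw [hl]; exact h1
      · simpa [tgt, T.nbr_rev] using h2
      · simp [tgt, T.nbr_rev, T.rev_rev]
  have hr : ∑ e ∈ S, φ (T.tgt e) = ∑ e ∈ S', φ e.1 := by
    rw [hS', Finset.sum_image (fun _ _ _ _ h => hinj h)]
  rw [hr]
  set W : Finset V := S.image Prod.fst ∪ S'.image Prod.fst
  rw [← Finset.sum_fiberwise_of_maps_to (s := S) (t := W) (g := Prod.fst)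
      (fun e he => Finset.mem_union_left _ (Finset.mem_image_of_mem _ he)),
    ← Finset.sum_fiberwise_of_maps_to (s := S') (t := W) (g := Prod.fst)
      (fun e he => Finset.mem_union_right _ (Finset.mem_image_of_mem _ he))]
  refine Finset.sum_congr rfl fun v _ => ?_
  have aux : ∀ (U : Finset (V × Fin d)),
      ∑ e ∈ U.filter (fun e => e.1 = v), φ e.1 =
        (Finset.univ.filter fun k => (v, k) ∈ U).card * φ v := by
    intro U
    rw [Finset.sum_congr rfl (g := fun _ => φ v)
      (fun e he => by rw [(Finset.mem_filter.1 he).2]), Finset.sum_const, nsmul_eq_mul]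
    congr 2
    refine Finset.card_bij (fun e _ => e.2) ?_ ?_ ?_
    · rintro ⟨w, k⟩ he
      obtain ⟨h1, rfl⟩ := Finset.mem_filter.1 he
      simpa using h1
    · rintro ⟨w, k⟩ he ⟨w', k'⟩ he' h
      have h1 := (Finset.mem_filter.1 he).2
      have h2 := (Finset.mem_filter.1 he').2
      simp_all
    · intro k hk
      exact ⟨(v, k), by simpa using hk, rfl⟩
  rw [aux, aux]
  congr 2
  by_cases hv : v ∈ E
  · simp [hmem, hS, T.mem_contour, hv]
  · simpa [hmem, hS, T.mem_contour, hv, tgt] using T.card_out_eq_card_in E v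

/-- Inclusion and exclusion over the `g` arcs of every touched face. All `d` arcs out of each vertex
of `E`, and all `d` arcs into it, lie on touched faces and are discarded; arcs inside `E` are
discarded twice. -/
theorem card_contour_add (E : Finset V) :
    (T.contour E).card + 2 * d * E.card =
      g * (T.touched E).card + ∑ u ∈ E, (Finset.univ.filter fun k => T.nbr u k ∈ E).card := by
  set U := (T.touched E).biUnion T.faceDarts with hU
  have hUmem : ∀ e, e ∈ U ↔ T.left e.1 e.2 ∈ T.touched E := by
    intro e; simp [hU, T.mem_faceDarts]
  have hcard : U.card = g * (T.touched E).card := by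
    rw [hU, Finset.card_biUnion]
    · simp [T.card_faceDarts, mul_comm]
    · intro f _ f' _ hne
      rw [Function.onFun, Finset.disjoint_left]
      intro e he he'
      rw [T.mem_faceDarts] at he he'
      exact hne (he.symm.trans he')
  have hA : E ×ˢ Finset.univ = U.filter fun e => e.1 ∈ E := by
    ext ⟨v, k⟩
    simp only [Finset.mem_product, Finset.mem_univ, and_true, Finset.mem_filter, hUmem]
    exact ⟨fun h => ⟨T.left_mem_touched h k, h⟩, And.right⟩
  have hB : (U.filter fun e => T.tgt e ∈ E).card = (E ×ˢ (Finset.univ : Finset (Fin d))).card := by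
    refine Finset.card_bij (fun e _ => (T.tgt e, T.rev e.1 e.2)) ?_ ?_ ?_
    · rintro e he; simpa using (Finset.mem_filter.1 he).2
    · rintro ⟨v, k⟩ _ ⟨w, l⟩ _ h
      simp only [tgt, Prod.mk.injEq] at h
      have h1 := T.nbr_rev v k
      have h2 := T.nbr_rev w l
      have h3 := T.rev_rev v k
      have h4 := T.rev_rev w l
      rw [h.1, h.2] at h1 h3
      rw [← h1, ← h3, h2, h4]
    · rintro ⟨v, k⟩ hv
      have hv : v ∈ E := by simpa using hv
      refine ⟨(T.nbr v k, T.rev v k), ?_, ?_⟩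
      · rw [Finset.mem_filter, hUmem]
        refine ⟨T.left_mem_touched_of_nbr ?_, ?_⟩ <;> simpa [tgt, T.nbr_rev] using hv
      · simp [tgt, T.nbr_rev, T.rev_rev]
  have hC : (U.filter fun e => e.1 ∈ E ∧ T.tgt e ∈ E).card =
      ∑ u ∈ E, (Finset.univ.filter fun k => T.nbr u k ∈ E).card := by
    rw [← Finset.card_sigma]
    refine Finset.card_bij (fun e _ => ⟨e.1, e.2⟩) ?_ ?_ ?_
    · rintro e he
      simpa [tgt] using (Finset.mem_filter.1 he).2
    · rintro ⟨v, k⟩ _ ⟨w, l⟩ _ h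
      simp only [Sigma.mk.injEq, heq_eq_eq] at h
      simp [h.1, h.2]
    · rintro ⟨v, k⟩ h
      simp only [Finset.mem_sigma, Finset.mem_filter, Finset.mem_univ, true_and] at h
      exact ⟨(v, k), Finset.mem_filter.2 ⟨(hUmem _).2 (T.left_mem_touched h.1 k), h⟩, rfl⟩
  have h1 : (U.filter fun e => e.1 ∈ E).card + (U.filter fun e => e.1 ∉ E).card = U.card :=
    Finset.card_filter_add_card_filter_not _
  have h2 := Finset.card_filter_add_card_filter_not (s := U.filter fun e => e.1 ∉ E)
    (fun e => T.tgt e ∈ E)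
  have h3 := Finset.card_filter_add_card_filter_not (s := U.filter fun e => T.tgt e ∈ E)
    (fun e => e.1 ∈ E)
  simp only [Finset.filter_filter] at h2 h3
  have h4 : (U.filter fun e => e.1 ∉ E ∧ T.tgt e ∈ E) = U.filter fun e => T.tgt e ∈ E ∧ e.1 ∉ E := by
    simp only [and_comm]
  have h5 : (U.filter fun e => T.tgt e ∈ E ∧ e.1 ∈ E) = U.filter fun e => e.1 ∈ E ∧ T.tgt e ∈ E := by
    simp only [and_comm]
  have h6 : T.contour E = U.filter fun e => e.1 ∉ E ∧ T.tgt e ∉ E := rfl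
  have h7 : (E ×ˢ (Finset.univ : Finset (Fin d))).card = E.card * d := by simp
  rw [h4] at h2
  rw [h5, hC] at h3
  rw [hB] at h3
  rw [← hA] at h1
  rw [h6, ← hcard]
  have : 2 * d * E.card = 2 * (E.card * d) := by ring
  omega

/-- The difference of two instances of `card_contour_add`. An edge from `v` into `E` enters the sum
of inner degrees twice, once from each end. -/
theorem card_contour_insert (E : Finset V) {v : V} (hv : v ∉ E) :
    (T.contour (insert v E)).card + 2 * d = (T.contour E).card +
      g * (Finset.univ.filter fun k => T.left v k ∉ T.touched E).card +
      2 * (Finset.univ.filter fun k => T.nbr v k ∈ E).card := by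
  have h1 := T.card_contour_add E
  have h2 := T.card_contour_add (insert v E)
  have h3 : (T.touched (insert v E)).card = (T.touched E).card +
      (Finset.univ.filter fun k => T.left v k ∉ T.touched E).card := by
    have : T.touched (insert v E) = T.touched E ∪
        (Finset.univ.filter fun k => T.left v k ∉ T.touched E).image (T.left v) := by
      ext f
      simp only [T.mem_touched, Finset.mem_insert, Finset.mem_union, Finset.mem_image,
        Finset.mem_filter, Finset.mem_univ, true_and]
      constructor
      · rintro ⟨u, rfl | hu, k, rfl⟩
        · by_cases h : T.left u k ∈ T.touched E
          · exact .inl (T.mem_touched.1 h)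
          · exact .inr ⟨k, fun h' => h (T.mem_touched.2 h'), rfl⟩
        · exact .inl ⟨u, hu, k, rfl⟩
      · rintro (⟨u, hu, k, rfl⟩ | ⟨k, _, rfl⟩)
        · exact ⟨u, .inr hu, k, rfl⟩
        · exact ⟨v, .inl rfl, k, rfl⟩
    rw [this, Finset.card_union_of_disjoint, Finset.card_image_of_injective _ (T.left_injective v)]
    rw [Finset.disjoint_left]
    intro f hf hf'
    obtain ⟨k, hk, rfl⟩ := Finset.mem_image.1 hf'
    exact (Finset.mem_filter.1 hk).2 hf
  have h4 : ∀ u, (Finset.univ.filter fun k => T.nbr u k ∈ insert v E).card =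
      (Finset.univ.filter fun k => T.nbr u k ∈ E).card +
        (Finset.univ.filter fun k => T.nbr u k = v).card := by
    intro u
    rw [← Finset.card_union_of_disjoint]
    · congr 1; ext k; simp [or_comm]
    · rw [Finset.disjoint_filter]
      rintro k _ h rfl
      exact hv h
  have h5 : ∑ u ∈ E, (Finset.univ.filter fun k => T.nbr u k = v).card =
      (Finset.univ.filter fun k => T.nbr v k ∈ E).card := by
    rw [← Finset.card_sigma]
    refine Finset.card_bij (fun e _ => T.rev e.1 e.2) ?_ ?_ ?_
    · rintro ⟨u, k⟩ h
      simp only [Finset.mem_sigma, Finset.mem_filter, Finset.mem_univ, true_and] at h ⊢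
      rw [← h.2, T.nbr_rev]; exact h.1
    · rintro ⟨u, k⟩ h ⟨w, l⟩ h' e
      simp only [Finset.mem_sigma, Finset.mem_filter, Finset.mem_univ, true_and] at h h' e
      have h1 := T.nbr_rev u k
      have h2 := T.nbr_rev w l
      have h3 := T.rev_rev u k
      have h4 := T.rev_rev w l
      rw [h.2, e] at h1 h3
      rw [h'.2] at h2 h4
      obtain rfl := h1.symm.trans h2
      simp [← h3, h4]
    · intro k hk
      have hk : T.nbr v k ∈ E := by simpa using hk
      exact ⟨⟨T.nbr v k, T.rev v k⟩, by simp [hk, T.nbr_rev], T.rev_rev v k⟩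
  have h6 : (Finset.univ.filter fun k => T.nbr v k = v).card = 0 := by
    simp [T.nbr_ne]
  rw [Finset.sum_insert hv, h4 v, h6, Finset.sum_congr rfl fun u _ => h4 u,
    Finset.sum_add_distrib, h5, h3, Finset.card_insert_of_notMem hv] at h2
  have e1 : 2 * d * (E.card + 1) = 2 * d * E.card + 2 * d := by ring
  rw [e1, Nat.mul_add] at h2
  omega

end RotationSystem

/-! ### Connection inside a set and infinite components -/

section Joined

variable {V : Type} {G : SimpleGraph V} {S : Set V} {u v w : V}

theorem JoinedWithin.refl (h : u ∈ S) : JoinedWithin G S u u :=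
  ⟨.nil, by simpa using h⟩

theorem JoinedWithin.symm (h : JoinedWithin G S u v) : JoinedWithin G S v u := by
  obtain ⟨p, hp⟩ := h
  exact ⟨p.reverse, by simpa using hp⟩

theorem JoinedWithin.trans (h : JoinedWithin G S u v) (h' : JoinedWithin G S v w) :
    JoinedWithin G S u w := by
  obtain ⟨p, hp⟩ := h
  obtain ⟨q, hq⟩ := h'
  refine ⟨p.append q, fun z hz => ?_⟩
  rcases SimpleGraph.Walk.mem_support_append_iff _ _ |>.1 hz with h | h
  exacts [hp z h, hq z h]

theorem JoinedWithin.of_adj (h : G.Adj u v) (hu : u ∈ S) (hv : v ∈ S) : JoinedWithin G S u v :=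
  ⟨.cons h .nil, by simp [hu, hv]⟩

theorem JoinedWithin.mono {S' : Set V} (h : JoinedWithin G S u v) (hS : S ⊆ S') :
    JoinedWithin G S' u v := by
  obtain ⟨p, hp⟩ := h
  exact ⟨p, fun w hw => hS (hp w hw)⟩

theorem JoinedWithin.left_mem (h : JoinedWithin G S u v) : u ∈ S := by
  obtain ⟨p, hp⟩ := h
  exact hp _ p.start_mem_support

theorem JoinedWithin.right_mem (h : JoinedWithin G S u v) : v ∈ S := h.symm.left_mem

theorem JoinedWithin.induction {Q : V → Prop} (h : JoinedWithin G S u v)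
    (hQ : ∀ a ∈ S, ∀ b ∈ S, G.Adj a b → Q a → Q b) (hu : Q u) : Q v := by
  obtain ⟨p, hp⟩ := h
  induction p with
  | nil => exact hu
  | @cons a b c hab p ih =>
    have hb : b ∈ S := hp b (by simp)
    exact ih (hQ a (hp a (by simp)) b hb hab hu) (fun w hw => hp w (by simp [hw]))

theorem JoinedWithin.map {V' : Type} {G' : SimpleGraph V'} {S' : Set V'} (f : V → V')
    (hf : ∀ a b, G.Adj a b → G'.Adj (f a) (f b)) (hS : ∀ a ∈ S, f a ∈ S')
    (h : JoinedWithin G S u v) : JoinedWithin G' S' (f u) (f v) :=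
  h.induction (Q := fun w => JoinedWithin G' S' (f u) (f w))
    (fun a ha b hb hab hq => hq.trans (.of_adj (hf a b hab) (hS a ha) (hS b hb)))
    (.refl (hS u h.left_mem))

end Joined

namespace PlaneGraph

variable {V : Type} {P : PlaneGraph V}

theorem infComp_notMem {A : Set V} {v : V} (h : v ∈ P.infComp A) : v ∉ A := by
  obtain ⟨w, hw⟩ := h.nonempty
  exact hw.left_mem

theorem infComp_anti {A B : Set V} (h : A ⊆ B) : P.infComp B ⊆ P.infComp A := fun _ hv =>
  hv.mono fun _ hw => hw.mono (Set.compl_subset_compl.2 h)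

theorem infComp_of_joined {A : Set V} {v w : V} (h : JoinedWithin P.graph Aᶜ v w)
    (hv : v ∈ P.infComp A) : w ∈ P.infComp A :=
  hv.mono fun _ hz => h.symm.trans hz

end PlaneGraph

/-- The complement of any finite set of vertices has a single infinite component. -/
def PlaneGraph.OneEnded {V : Type} (P : PlaneGraph V) : Prop :=
  ∀ E : Set V, E.Finite → ∃ B : Set V, B.Finite ∧
    ∀ u ∉ B, ∀ w ∉ B, JoinedWithin P.graph Eᶜ u w

theorem PlaneGraph.OneEnded.joined {V : Type} {P : PlaneGraph V} (h : P.OneEnded) {E : Set V}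
    (hE : E.Finite) {u w : V} (hu : u ∈ P.infComp E) (hw : w ∈ P.infComp E) :
    JoinedWithin P.graph Eᶜ u w := by
  obtain ⟨B, hB, hj⟩ := h E hE
  obtain ⟨u', hu', hu''⟩ := hu.exists_notMem_finite hB
  obtain ⟨w', hw', hw''⟩ := hw.exists_notMem_finite hB
  exact hu'.trans ((hj u' hu'' w' hw'').trans hw'.symm)

/-! ### Length and connectedness of the contour of a *-connected set -/

namespace RotationSystem

variable {V F : Type} [DecidableEq V] [DecidableEq F] {P : PlaneGraph V} {d g : ℕ} [NeZero d]
  (T : RotationSystem P d g F)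

theorem starAdj_iff (u w : V) : P.starGraph.Adj u w ↔ u ≠ w ∧ ∃ k l, T.left u k = T.left w l := by
  simp only [PlaneGraph.starGraph, ← T.cofacial_iff]

/-- The growth of the contour when a vertex is added is at most `2 * ν`. -/
def GrowthBound (ν : ℕ) : Prop :=
  ∀ (E : Finset V) (v : V), v ∉ E → (∃ k, T.left v k ∈ T.touched E) →
    g * (Finset.univ.filter fun k => T.left v k ∉ T.touched E).card +
      2 * (Finset.univ.filter fun k => T.nbr v k ∈ E).card ≤ 2 * ν + 2 * d

/-- Any two vertices of `C` are joined by a `*`-path in `C`. -/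
def _root_.PlaneGraph.StarConnected (P : PlaneGraph V) (C : Set V) : Prop :=
  ∀ u ∈ C, ∀ w ∈ C, JoinedWithin P.starGraph C u w

/-- `C` is exhausted by *-adjacent additions, starting from one vertex with a contour of length gd -
2d = 2ν + κ; each addition costs at most 2ν. A subset of maximal size satisfying the bound must be
all of `C`. -/
theorem card_contour_le {ν κ : ℕ} (hν : T.GrowthBound ν) (hκ : g * d = 2 * ν + κ + 2 * d)
    {C : Finset V} (hC : P.StarConnected C) (hne : C.Nonempty) :
    (T.contour C).card ≤ 2 * ν * C.card + κ := by
  obtain ⟨x, hx⟩ := hne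
  have h0 : (T.contour {x}).card = 2 * ν + κ := by
    have h := T.card_contour_insert ∅ (Finset.notMem_empty x)
    simp [contour, touched] at h ⊢
    omega
  obtain ⟨B, hB, hmax⟩ := (C.powerset.filter fun B => x ∈ B ∧
    (T.contour B).card ≤ 2 * ν * B.card + κ).exists_max_image Finset.card
    ⟨{x}, by simp [hx, h0]⟩
  simp only [Finset.mem_filter, Finset.mem_powerset, and_imp] at hB hmax
  obtain ⟨hBC, hxB, hcard⟩ := hB
  suffices h : B = C by rw [← h]; exact hcard
  refine hBC.antisymm fun y hy => ?_
  refine (hC x hx y hy).induction (Q := fun z => z ∈ B) ?_ hxB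
  intro a ha b hb hab haB
  by_contra hbB
  obtain ⟨hne, k, l, hkl⟩ := (T.starAdj_iff _ _).1 hab
  have h1 := T.card_contour_insert B hbB
  have h2 := hν B b hbB ⟨l, hkl ▸ T.left_mem_touched haB k⟩
  have h3 := hmax (insert b B) (Finset.insert_subset hb hBC) (Finset.mem_insert_of_mem hxB) (by
    rw [Finset.card_insert_of_notMem hbB]
    have : 2 * ν * (B.card + 1) = 2 * ν * B.card + 2 * ν := by ring
    omega)
  rw [Finset.card_insert_of_notMem hbB] at h3
  omega

open scoped Classical in
/-- The exterior boundary of a `*`-connected set is contained in one component of its contour. -/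
theorem mem_of_closedUnder (hP : P.OneEnded) {C : Finset V} (hC : P.StarConnected C) {R : Set V}
    (hR : ClosedUnder Prod.fst T.tgt (T.contour C) R) {v w : V}
    (hv : v ∈ P.extStarBoundary C) (hw : w ∈ P.extStarBoundary C) (hvR : v ∈ R) : w ∈ R := by
  have two : ∀ a : ZMod 2, a + a = 0 := by decide
  -- The indicator of `R` outside `C`, read on the incidences of vertices with touched faces. Along
  -- an edge outside `C` its two values at a common face cancel, since `R` is closed under the
  -- contour. An edge meeting `C` has touched faces on both sides, which give the same values.
  set o : V → F → ZMod 2 := fun u f => if f ∈ T.touched C ∧ u ∈ R ∧ u ∉ C then 1 else 0 with ho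
  have hzero : ∀ u k, u ∉ C → T.nbr u k ∉ C →
      o u (T.left u k) + o (T.nbr u k) (T.left u k) = 0 := by
    intro u k hu hn
    by_cases ht : T.left u k ∈ T.touched C
    · have := hR (u, k) (T.mem_contour.2 ⟨ht, hu, hn⟩)
      simp only [tgt] at this
      by_cases huR : u ∈ R <;> simp [ho, ht, hu, hn, this.symm, huR, two]
    · simp [ho, ht]
  have htwo : ∀ u k, u ∉ C → T.nbr u (k + 1) ∉ C →
      o u (T.left u k) + o (T.nbr u (k + 1)) (T.left u k) = 0 := by
    intro u k hu hn
    have := hzero (T.nbr u (k + 1)) (T.rev u (k + 1)) hn (by rwa [T.nbr_rev])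
    rwa [T.nbr_rev, T.left_rev, add_comm] at this
  -- So `o` is a cocycle, and its potential `h` changes across any face by the two values of `o`
  -- there.
  obtain ⟨h, hh⟩ := T.exact o (by
    intro u k
    by_cases hu : u ∈ C
    · simp [ho, hu, T.left_mem_touched hu]
    by_cases hn : T.nbr u (k + 1) ∈ C
    · simp [ho, hn, T.left_mem_touched_of_nbr hn, T.left_mem_touched_of_nbr_succ hn]
    rw [hzero u (k + 1) hu hn, htwo u k hu hn])
  have hface : ∀ u k u' l, T.left u k = T.left u' l →
      h u + h u' = o u (T.left u k) + o u' (T.left u k) := by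
    intro u k u' l hkl
    refine T.face_connected (T.left u k)
      (fun z => h u + h z = o u (T.left u k) + o z (T.left u k)) ?_ u k u' l rfl hkl.symm
      (by simp [two])
    intro z m hm
    have e := hh z m
    rw [hm] at e
    have e2 : h (T.nbr z m) = h z + o z (T.left u k) + o (T.nbr z m) (T.left u k) := by
      linear_combination e - two (h z)
    rw [e2]
    constructor
    · intro e1; linear_combination e1 + two (o z (T.left u k))
    · intro e1; linear_combination e1 - two (o z (T.left u k))
  have hstar : ∀ u u', P.starGraph.Adj u u' → u ∈ C → 
      h u + h u' = if u' ∈ R ∧ u' ∉ C then 1 else 0 := by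
    intro u u' huu hu
    obtain ⟨_, k, l, hkl⟩ := (T.starAdj_iff _ _).1 huu
    rw [hface u k u' l hkl]
    simp [ho, hu, T.left_mem_touched hu]
  have heq : ∀ a b : ZMod 2, a + b = 0 → a = b := by decide
  have hconst : ∀ u ∈ C, ∀ u' ∈ C, h u = h u' := by
    intro u hu u' hu'
    refine (hC u hu u' hu').induction (Q := fun z => h u = h z) ?_ rfl
    intro a ha b hb hab e
    rw [e]
    have := hstar a b hab ha
    rw [if_neg fun h => h.2 hb] at this
    exact heq _ _ this
  -- Edges outside `C` do not change `h`, so `h` is constant on the infinite component. It is also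
  -- constant on `C`, and the jump between the two is 1 at boundary vertices in `R` and 0 at the
  -- others.
  have hinf : h v = h w := by
    refine (hP.joined C.finite_toSet hv.1 hw.1).induction (Q := fun z => h v = h z) ?_ rfl
    intro a ha b hb hab e
    obtain ⟨k, rfl⟩ := (T.adj_iff _ _).1 hab
    rw [e]
    exact heq _ _ ((hh a k).trans (hzero a k ha hb))
  obtain ⟨hv1, x, hx, hxv⟩ := hv
  obtain ⟨hw1, y, hy, hyw⟩ := hw
  have e1 := hstar x v hxv hx
  have e2 := hstar y w hyw hy
  rw [hconst y hy x hx, ← hinf, e1, if_pos ⟨hvR, PlaneGraph.infComp_notMem hv1⟩] at e2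
  by_contra hwR
  rw [if_neg fun h => hwR h.1] at e2
  exact one_ne_zero e2

end RotationSystem

/-! ### *-clusters -/

namespace PlaneGraph

variable {V : Type} {P : PlaneGraph V} {A C C' : Set V}

theorem IsStarCluster.subset (h : P.IsStarCluster A C) : C ⊆ A := by
  obtain ⟨x, _, rfl⟩ := h
  exact fun y hy => hy.right_mem

theorem IsStarCluster.nonempty (h : P.IsStarCluster A C) : C.Nonempty := by
  obtain ⟨x, hx, rfl⟩ := h
  exact ⟨x, .refl hx⟩

theorem IsStarCluster.joined_iff (h : P.IsStarCluster A C) {u w : V} (hu : u ∈ C) :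
    w ∈ C ↔ JoinedWithin P.starGraph A u w := by
  obtain ⟨x, _, rfl⟩ := h
  exact ⟨fun hw => hu.symm.trans hw, fun hw => hu.trans hw⟩

theorem IsStarCluster.eq_of_mem (h : P.IsStarCluster A C) (h' : P.IsStarCluster A C') {u : V}
    (hu : u ∈ C) (hu' : u ∈ C') : C = C' := by
  ext w
  rw [h.joined_iff hu, h'.joined_iff hu']

theorem IsStarCluster.mem_of_adj (h : P.IsStarCluster A C) {u w : V} (hu : u ∈ C) (hw : w ∈ A)
    (huw : P.starGraph.Adj u w) : w ∈ C :=
  (h.joined_iff hu).2 (.of_adj huw (h.subset hu) hw)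

theorem IsStarCluster.starConnected (h : P.IsStarCluster A C) : P.StarConnected C := by
  intro u hu w hw
  refine (((h.joined_iff hu).1 hw).induction (Q := fun z => z ∈ C ∧ JoinedWithin P.starGraph C u z)
    ?_ ⟨hu, .refl hu⟩).2
  rintro a - b hb hab ⟨ha, hj⟩
  have := h.mem_of_adj ha hb hab
  exact ⟨this, hj.trans (.of_adj hab ha this)⟩

theorem isStarCluster_of_mem {u : V} (hu : u ∈ A) :
    P.IsStarCluster A {y | JoinedWithin P.starGraph A u y} := ⟨u, hu, rfl⟩

theorem Interlocked.symm (h : P.Interlocked C C') : P.Interlocked C' C := by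
  refine ⟨fun a ha b hb hab => h.1 b hb a ha hab.symm, ?_⟩
  rw [Set.union_comm]
  rcases h.2 with ⟨x, hx, h1, h2, h3⟩ | ⟨x, hx, y, hy, hxy, h1, h2⟩
  · exact .inl ⟨x, hx, h1, h3, h2⟩
  · exact .inr ⟨y, hy, x, hx, hxy.symm, h2, h1⟩

end PlaneGraph

/-! ### Splicing the contours of interlocked clusters -/

namespace RotationSystem

variable {V F : Type} [DecidableEq V] [DecidableEq F] {P : PlaneGraph V} {d g : ℕ} [NeZero d]
  (T : RotationSystem P d g F)

/-- Local structure of two interlocked sets: they can be joined by adding one vertex or two adjacent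
vertices, whose removal from the contours deletes at least `κ` oriented edges. -/
structure IsBridge (κ : ℕ) (C C' : Finset V) (i₁ : V) (k₁ : Fin d) (i₂ : V) (k₂ : Fin d) :
    Prop where
  inf₁ : i₁ ∈ P.infComp (C ∪ C')
  inf₂ : i₂ ∈ P.infComp (C ∪ C')
  card : (i₁ = i₂ ∧ k₁ ≠ k₂ ∧ κ = 4) ∨
    (P.graph.Adj i₁ i₂ ∧ T.nbr i₁ k₁ ≠ i₂ ∧ T.nbr i₂ k₂ ≠ i₁ ∧ κ = 6)
  notMem₁ : T.nbr i₁ k₁ ∉ C ∪ C'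
  notMem₂ : T.nbr i₂ k₂ ∉ C ∪ C'
  left₁ : ∀ k, T.left i₁ k ∈ T.touched (C ∪ C')
  left₂ : ∀ k, T.left i₂ k ∈ T.touched (C ∪ C')
  nbr₁ : ∀ k, T.nbr i₁ k ∈ C ∪ C' ∨ k = k₁ ∨ T.nbr i₁ k = i₂ ∨ (i₁ = i₂ ∧ k = k₂)
  nbr₂ : ∀ k, T.nbr i₂ k ∈ C ∪ C' ∨ k = k₂ ∨ T.nbr i₂ k = i₁ ∨ (i₁ = i₂ ∧ k = k₁)
  fst₁ : T.left i₁ (k₁ - 1) ∈ T.touched C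
  snd₁ : T.left i₁ k₁ ∈ T.touched C'
  fst₂ : T.left i₂ k₂ ∈ T.touched C
  snd₂ : T.left i₂ (k₂ - 1) ∈ T.touched C'

/-- Interlocked sets can always be joined by a bridge. -/
def HasBridges (κ : ℕ) : Prop :=
  ∀ C C' : Finset V, Disjoint C C' → P.Interlocked C C' →
    ∃ i₁ k₁ i₂ k₂, T.IsBridge κ C C' i₁ k₁ i₂ k₂

/-- `E` arises from the sets in `𝒞` by adding interlocking vertices, so that all their exterior
boundaries lie on one contour of small length. -/
structure IsMerger (ν κ : ℕ) (𝒞 : List (Finset V)) (E : Finset V) : Prop where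
  subset : ∀ C ∈ 𝒞, C ⊆ E
  touched : ∀ f ∈ T.touched E, ∃ C ∈ 𝒞, f ∈ T.touched C
  mem : ∀ e ∈ E, (∃ C ∈ 𝒞, e ∈ C) ∨ ∃ C ∈ 𝒞, ∃ C' ∈ 𝒞, C ≠ C' ∧
    e ∈ P.extStarBoundary C ∧ e ∈ P.extStarBoundary C' ∧
    (P.graph.neighborSet e \ (C ∪ C')).ncard ≤ 2
  card : (T.contour E).card ≤ 2 * ν * (𝒞.map Finset.card).sum + κ
  conn : ∀ R : Set V, ClosedUnder Prod.fst T.tgt (T.contour E) R → ∀ C ∈ 𝒞, ∀ C' ∈ 𝒞,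
    ∀ u ∈ P.extStarBoundary C, ∀ v ∈ P.extStarBoundary C', u ∉ E → v ∉ E → u ∈ R → v ∈ R

theorem left_eq_left_tgt (e : V × Fin d) :
    T.left e.1 e.2 = T.left (T.tgt e) (T.rev e.1 e.2 - 1) := by
  have h := T.left_rev (T.tgt e) (T.rev e.1 e.2 - 1)
  rw [sub_add_cancel, tgt, T.nbr_rev, T.rev_rev] at h
  exact h

theorem tgt_rev (e : V × Fin d) : T.nbr (T.tgt e) (T.rev e.1 e.2) = e.1 := T.nbr_rev _ _

theorem mem_extStarBoundary {E : Finset V} {v : V} {k : Fin d} (hv : v ∈ P.infComp E)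
    (h : T.left v k ∈ T.touched E) : v ∈ P.extStarBoundary E := by
  obtain ⟨u, hu, l, hl⟩ := T.mem_touched.1 h
  refine ⟨hv, u, hu, (T.starAdj_iff _ _).2 ⟨?_, l, k, hl⟩⟩
  rintro rfl
  exact PlaneGraph.infComp_notMem hv hu

theorem finite_neighborSet (T : RotationSystem P d g F) (v : V) : (P.graph.neighborSet v).Finite :=
  (Set.finite_range (T.nbr v)).subset fun _ hw => (T.adj_iff _ _).1 hw

-- Consequently bridge vertices are never free, so a merger swallows no free vertex.
variable {T} in
theorem IsBridge.ncard_le {κ : ℕ} {C C' : Finset V} {i₁ i₂ : V} {k₁ k₂ : Fin d}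
    (h : T.IsBridge κ C C' i₁ k₁ i₂ k₂) :
    (P.graph.neighborSet i₁ \ (C ∪ C')).ncard ≤ 2 ∧
      (P.graph.neighborSet i₂ \ (C ∪ C')).ncard ≤ 2 := by
  have aux : ∀ i a b, (∀ k, T.nbr i k ∈ C ∪ C' ∨ T.nbr i k = a ∨ T.nbr i k = b) →
      (P.graph.neighborSet i \ (C ∪ C')).ncard ≤ 2 := by
    intro i a b hab
    refine (Set.ncard_le_ncard (t := {a, b}) ?_ (Set.toFinite _)).trans
      ((Set.ncard_insert_le a {b}).trans (by simp))
    rintro w ⟨hw, hwC⟩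
    obtain ⟨k, rfl⟩ := (T.adj_iff _ _).1 hw
    rcases hab k with h | h | h
    · exact absurd (by simpa using h) hwC
    · exact .inl h
    · exact .inr h
  rcases h.card with ⟨rfl, -⟩ | ⟨hadj, -⟩
  · have : ∀ k, T.nbr i₁ k ∈ C ∪ C' ∨ T.nbr i₁ k = T.nbr i₁ k₁ ∨ T.nbr i₁ k = T.nbr i₁ k₂ := by
      intro k
      rcases h.nbr₁ k with h | rfl | h | ⟨-, rfl⟩
      exacts [.inl h, .inr (.inl rfl), absurd h (T.nbr_ne _ _), .inr (.inr rfl)]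
    exact ⟨aux _ _ _ this, aux _ _ _ this⟩
  · refine ⟨aux _ (T.nbr i₁ k₁) i₂ fun k => ?_, aux _ (T.nbr i₂ k₂) i₁ fun k => ?_⟩
    · rcases h.nbr₁ k with h | rfl | h | ⟨h, -⟩
      exacts [.inl h, .inr (.inl rfl), .inr (.inr h), absurd h hadj.ne]
    · rcases h.nbr₂ k with h | rfl | h | ⟨h, -⟩
      exacts [.inl h, .inr (.inl rfl), .inr (.inr h), absurd h hadj.ne]

theorem touched_disjoint {A : Set V} {C C' : Finset V} (h : P.IsStarCluster A C)
    (h' : P.IsStarCluster A C') (hne : C ≠ C') {f : F} (hf : f ∈ T.touched C) :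
    f ∉ T.touched C' := by
  intro hf'
  obtain ⟨u, hu, k, rfl⟩ := T.mem_touched.1 hf
  obtain ⟨w, hw, l, hl⟩ := T.mem_touched.1 hf'
  apply hne
  have hwC : w ∈ (C : Set V) := by
    by_cases huw : u = w
    · exact huw ▸ hu
    · exact h.mem_of_adj hu (h'.subset hw) ((T.starAdj_iff _ _).2 ⟨huw, k, l, hl.symm⟩)
  exact_mod_cast h.eq_of_mem h' hwC hw

theorem IsMerger.singleton {ν κ : ℕ} (hP : P.OneEnded) (hν : T.GrowthBound ν)
    (hκ : g * d = 2 * ν + κ + 2 * d) {A : Set V} {C : Finset V} (h : P.IsStarCluster A C) :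
    T.IsMerger ν κ [C] C where
  subset := by simp
  touched := by simp
  mem := by simp
  card := by simpa using T.card_contour_le hν hκ h.starConnected (by exact_mod_cast h.nonempty)
  conn := by
    simp only [List.mem_singleton]
    rintro R hR _ rfl _ rfl u hu v hv - - huR
    exact T.mem_of_closedUnder hP h.starConnected hR hu hv huR

-- With `z₁`, `z₂` the outer neighbours of the bridge, the contour of `C` passes through the bridge
-- from `z₁` to `z₂`, and that of `C'` from `z₂` to `z₁`. Adding the bridge vertices to the set
-- removes both passages and touches no new face, so the two contours are reconnected at `z₁` and
-- `z₂`. At least κ arcs disappear, which compensates the κ in the length bound for `C`.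
set_option maxHeartbeats 1000000 in
theorem IsMerger.cons {ν κ : ℕ} (hP : P.OneEnded) (hν : T.GrowthBound ν)
    (hκ : g * d = 2 * ν + κ + 2 * d) (hbr : T.HasBridges κ) {A : Set V} {𝒞 : List (Finset V)}
    {E : Finset V} (hE : T.IsMerger ν κ 𝒞 E) (h𝒞 : ∀ C ∈ 𝒞, P.IsStarCluster A C)
    {C C' : Finset V} (hC : P.IsStarCluster A C) (hCn : C ∉ 𝒞) (hC' : C' ∈ 𝒞)
    (hint : P.Interlocked C C') : ∃ E', T.IsMerger ν κ (C :: 𝒞) E' := by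
  have hdisE : ∀ f ∈ T.touched C, f ∉ T.touched E := by
    intro f hf hfE
    obtain ⟨B, hB, hfB⟩ := hE.touched f hfE
    exact T.touched_disjoint hC (h𝒞 B hB) (fun h => hCn (h ▸ hB)) hf hfB
  have hsubE : T.touched C' ⊆ T.touched E := by
    intro f hf
    obtain ⟨u, hu, k, rfl⟩ := T.mem_touched.1 hf
    exact T.left_mem_touched (hE.subset C' hC' hu) k
  have hC'E := hE.subset C' hC'
  obtain ⟨i₁, k₁, i₂, k₂, hb⟩ := hbr C C' (by
    rw [Finset.disjoint_left]
    intro u hu hu'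
    exact hdisE _ (T.left_mem_touched hu 0) (T.left_mem_touched (hC'E hu') 0)) hint
  have hi₁C : i₁ ∉ C := fun h => PlaneGraph.infComp_notMem hb.inf₁ (.inl h)
  have hi₂C : i₂ ∉ C := fun h => PlaneGraph.infComp_notMem hb.inf₂ (.inl h)
  have hi₁E : i₁ ∉ E := fun h => hdisE _ hb.fst₁ (T.left_mem_touched h _)
  have hi₂E : i₂ ∉ E := fun h => hdisE _ hb.fst₂ (T.left_mem_touched h _)
  have hz₁C : T.nbr i₁ k₁ ∉ C := fun h => hb.notMem₁ (Finset.mem_union_left _ h)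
  have hz₂C : T.nbr i₂ k₂ ∉ C := fun h => hb.notMem₂ (Finset.mem_union_left _ h)
  have hz₁E : T.nbr i₁ k₁ ∉ E := fun h => hdisE _ hb.fst₁
    (T.left_mem_touched_of_nbr_succ (by rwa [sub_add_cancel]))
  have hz₂E : T.nbr i₂ k₂ ∉ E := fun h => hdisE _ hb.fst₂ (T.left_mem_touched_of_nbr h)
  have hi₁b : i₁ ∈ P.extStarBoundary C ∧ i₁ ∈ P.extStarBoundary C' :=
    ⟨T.mem_extStarBoundary (PlaneGraph.infComp_anti Set.subset_union_left hb.inf₁) hb.fst₁,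
      T.mem_extStarBoundary (PlaneGraph.infComp_anti Set.subset_union_right hb.inf₁) hb.snd₁⟩
  have hi₂b : i₂ ∈ P.extStarBoundary C ∧ i₂ ∈ P.extStarBoundary C' :=
    ⟨T.mem_extStarBoundary (PlaneGraph.infComp_anti Set.subset_union_left hb.inf₂) hb.fst₂,
      T.mem_extStarBoundary (PlaneGraph.infComp_anti Set.subset_union_right hb.inf₂) hb.snd₂⟩
  have hleft : ∀ i, i = i₁ ∨ i = i₂ → ∀ k, T.left i k ∈ T.touched E ∨ T.left i k ∈ T.touched C := by
    intro i hi k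
    have : T.left i k ∈ T.touched (C ∪ C') := by
      rcases hi with rfl | rfl
      exacts [hb.left₁ k, hb.left₂ k]
    rw [T.touched_union, Finset.mem_union] at this
    exact this.symm.imp (fun h => hsubE h) id
  set z₁ := T.nbr i₁ k₁ with hz₁
  set z₂ := T.nbr i₂ k₂ with hz₂
  have hz₁i : z₁ ≠ i₁ ∧ z₁ ≠ i₂ := by
    rcases hb.card with ⟨h, -⟩ | ⟨_, h, -⟩
    · rw [← h]; exact ⟨T.nbr_ne _ _, T.nbr_ne _ _⟩
    · exact ⟨T.nbr_ne _ _, h⟩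
  have hz₂i : z₂ ≠ i₁ ∧ z₂ ≠ i₂ := by
    rcases hb.card with ⟨h, -⟩ | ⟨_, _, h, -⟩
    · rw [h]; exact ⟨T.nbr_ne _ _, T.nbr_ne _ _⟩
    · exact ⟨h, T.nbr_ne _ _⟩
  set E' := E ∪ C ∪ {i₁, i₂} with hE'
  have hmemE' : ∀ v, v ∈ E' ↔ v ∈ E ∨ v ∈ C ∨ v = i₁ ∨ v = i₂ := by
    intro v
    simp only [hE', Finset.mem_union, Finset.mem_insert, Finset.mem_singleton, or_assoc]
  have htouch : ∀ f, f ∈ T.touched E' ↔ f ∈ T.touched E ∨ f ∈ T.touched C := by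
    intro f
    rw [hE', T.touched_union, T.touched_union, Finset.mem_union, Finset.mem_union]
    refine ⟨?_, Or.inl⟩
    rintro (h | h)
    · exact h
    · obtain ⟨u, hu, k, rfl⟩ := T.mem_touched.1 h
      exact hleft u (by simpa using hu) k
  -- the two old contours together
  have hold : ∀ e, e ∈ T.contour E ∪ T.contour C ↔
      (T.left e.1 e.2 ∈ T.touched E ∨ T.left e.1 e.2 ∈ T.touched C) ∧
      (e.1 ∉ E ∧ e.1 ∉ C) ∧ (T.tgt e ∉ E ∧ T.tgt e ∉ C) := by
    intro e
    rw [Finset.mem_union, T.mem_contour, T.mem_contour]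
    have h1 : e.1 ∈ E → T.left e.1 e.2 ∈ T.touched E := fun h => T.left_mem_touched h _
    have h2 : T.tgt e ∈ E → T.left e.1 e.2 ∈ T.touched E := fun h => T.left_mem_touched_of_nbr h
    have h3 : e.1 ∈ C → T.left e.1 e.2 ∈ T.touched C := fun h => T.left_mem_touched h _
    have h4 : T.tgt e ∈ C → T.left e.1 e.2 ∈ T.touched C := fun h => T.left_mem_touched_of_nbr h
    have h5 := hdisE (T.left e.1 e.2)
    tauto
  have hnew : ∀ e, e ∈ T.contour E' ↔ e ∈ T.contour E ∪ T.contour C ∧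
      (e.1 ≠ i₁ ∧ e.1 ≠ i₂) ∧ (T.tgt e ≠ i₁ ∧ T.tgt e ≠ i₂) := by
    intro e
    rw [hold, T.mem_contour, htouch, hmemE', hmemE']
    simp only [not_or, ne_eq]
    exact ⟨fun ⟨h, ⟨a, b, c⟩, a', b', c'⟩ => ⟨⟨h, ⟨a, b⟩, a', b'⟩, c, c'⟩,
      fun ⟨⟨h, ⟨a, b⟩, a', b'⟩, c, c'⟩ => ⟨h, ⟨a, b, c⟩, a', b', c'⟩⟩
  -- the neighbours of the interlocking vertices
  have hnbr : ∀ i, i = i₁ ∨ i = i₂ → ∀ k, T.nbr i k ∉ E → T.nbr i k ∉ C →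
      (T.nbr i k = i₁ ∨ T.nbr i k = i₂) ∨ (T.nbr i k = z₁ ∧ i = i₁ ∧ k = k₁) ∨
        (T.nbr i k = z₂ ∧ i = i₂ ∧ k = k₂) := by
    intro i hi k hkE hkC
    have hn : T.nbr i k ∉ C ∪ C' := by
      rw [Finset.mem_union]
      rintro (h | h)
      exacts [hkC h, hkE (hC'E h)]
    rcases hi with rfl | rfl
    · rcases hb.nbr₁ k with h | rfl | h | ⟨rfl, rfl⟩
      · exact absurd h hn
      · exact .inr (.inl ⟨rfl, rfl, rfl⟩)
      · exact .inl (.inr h)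
      · exact .inr (.inr ⟨rfl, rfl, rfl⟩)
    · rcases hb.nbr₂ k with h | rfl | h | ⟨rfl, rfl⟩
      · exact absurd h hn
      · exact .inr (.inr ⟨rfl, rfl, rfl⟩)
      · exact .inl (.inl h)
      · exact .inr (.inl ⟨rfl, rfl, rfl⟩)
  refine ⟨E', ?_, ?_, ?_, ?_, ?_⟩
  · intro B hB
    rcases List.mem_cons.1 hB with rfl | hB
    · exact fun u hu => (hmemE' u).2 (.inr (.inl hu))
    · exact fun u hu => (hmemE' u).2 (.inl (hE.subset B hB hu))
  · intro f hf
    rcases (htouch f).1 hf with h | h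
    · obtain ⟨B, hB, hfB⟩ := hE.touched f h
      exact ⟨B, List.mem_cons_of_mem _ hB, hfB⟩
    · exact ⟨C, List.mem_cons_self, h⟩
  · have hne : C ≠ C' := fun h => hCn (h ▸ hC')
    have hfree := hb.ncard_le
    intro e he
    rcases (hmemE' e).1 he with h | h | rfl | rfl
    · rcases hE.mem e h with ⟨B, hB, h⟩ | ⟨B, hB, B', hB', h⟩
      · exact .inl ⟨B, List.mem_cons_of_mem _ hB, h⟩
      · exact .inr ⟨B, List.mem_cons_of_mem _ hB, B', List.mem_cons_of_mem _ hB', h⟩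
    · exact .inl ⟨C, List.mem_cons_self, h⟩
    · exact .inr ⟨C, List.mem_cons_self, C', List.mem_cons_of_mem _ hC', hne, hi₁b.1, hi₁b.2, hfree.1⟩
    · exact .inr ⟨C, List.mem_cons_self, C', List.mem_cons_of_mem _ hC', hne, hi₂b.1, hi₂b.2, hfree.2⟩
  · -- the length of the contour
    obtain ⟨Z, hZ, hZκ⟩ : ∃ Z : Finset (V × Fin d), (∀ e ∈ Z, e ∈ T.contour E ∪ T.contour C ∧
        ((e.1 = i₁ ∨ e.1 = i₂) ∨ (T.tgt e = i₁ ∨ T.tgt e = i₂))) ∧ κ ≤ Z.card := by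
      have hd : ∀ i, i = i₁ ∨ i = i₂ → ∀ k, T.nbr i k ∉ E → T.nbr i k ∉ C →
          ((i, k) ∈ T.contour E ∪ T.contour C ∧ (((i, k) : V × Fin d).1 = i₁ ∨ (i, k).1 = i₂ ∨
            (T.tgt (i, k) = i₁ ∨ T.tgt (i, k) = i₂))) ∧
          ((T.nbr i k, T.rev i k) ∈ T.contour E ∪ T.contour C ∧
            (((T.nbr i k, T.rev i k) : V × Fin d).1 = i₁ ∨ (T.nbr i k, T.rev i k).1 = i₂ ∨
            (T.tgt (T.nbr i k, T.rev i k) = i₁ ∨ T.tgt (T.nbr i k, T.rev i k) = i₂))) := by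
        intro i hi k hkE hkC
        have hiE : i ∉ E ∧ i ∉ C := by rcases hi with rfl | rfl <;> exact ⟨‹_›, ‹_›⟩
        have hl := T.left_rev i (k - 1)
        rw [sub_add_cancel] at hl
        have htg : T.tgt (T.nbr i k, T.rev i k) = i := T.nbr_rev i k
        refine ⟨⟨(hold _).2 ⟨hleft i hi k, hiE, hkE, hkC⟩, ?_⟩,
          ⟨(hold _).2 ⟨?_, ⟨hkE, hkC⟩, by rwa [htg]⟩, ?_⟩⟩
        · exact or_assoc.1 (.inl hi)
        · simp only [hl]
          exact hleft i hi (k - 1)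
        · rw [htg]; exact .inr (.inr hi)
      have a₁ := hd i₁ (.inl rfl) k₁ hz₁E hz₁C
      have a₂ := hd i₂ (.inr rfl) k₂ hz₂E hz₂C
      rcases hb.card with ⟨h12, hk, rfl⟩ | ⟨hadj, hn1, hn2, rfl⟩
      -- A single bridge vertex loses both orientations of its two outer edges, four arcs in all.
      · refine ⟨{(i₁, k₁), (z₁, T.rev i₁ k₁), (i₂, k₂), (z₂, T.rev i₂ k₂)}, ?_, ?_⟩
        · intro e he
          simp only [Finset.mem_insert, Finset.mem_singleton] at he
          rcases he with rfl | rfl | rfl | rfl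
          exacts [⟨a₁.1.1, or_assoc.2 a₁.1.2⟩, ⟨a₁.2.1, or_assoc.2 a₁.2.2⟩,
            ⟨a₂.1.1, or_assoc.2 a₂.1.2⟩, ⟨a₂.2.1, or_assoc.2 a₂.2.2⟩]
        · have hzz : z₁ ≠ z₂ := by
            intro h
            rw [hz₁, hz₂, ← h12] at h
            exact hk (T.nbr_injective _ h)
          rw [Finset.card_insert_of_notMem, Finset.card_insert_of_notMem,
            Finset.card_insert_of_notMem, Finset.card_singleton]
          · simp [hz₂i.2.symm]
          · simp [hz₁i.2, hzz]
          · simp [hk, hz₁i.1.symm, hz₂i.1.symm]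
      · obtain ⟨k, hk⟩ := (T.adj_iff _ _).1 hadj
        have a₃ := hd i₁ (.inl rfl) k (hk ▸ hi₂E) (hk ▸ hi₂C)
        rw [hk] at a₃
        have hkk : k₁ ≠ k := by rintro rfl; exact hn1 hk
        have h12 : i₁ ≠ i₂ := hadj.ne
        have hr : T.rev i₁ k ≠ k₂ := by
          intro h
          apply hn2
          rw [← h, ← hk, T.nbr_rev]
        -- With two bridge vertices the edge between them is lost as well, in both orientations.
        refine ⟨{(i₁, k₁), (z₁, T.rev i₁ k₁), (i₂, k₂), (z₂, T.rev i₂ k₂), (i₁, k),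
          (i₂, T.rev i₁ k)}, ?_, ?_⟩
        · intro e he
          simp only [Finset.mem_insert, Finset.mem_singleton] at he
          rcases he with rfl | rfl | rfl | rfl | rfl | rfl
          exacts [⟨a₁.1.1, or_assoc.2 a₁.1.2⟩, ⟨a₁.2.1, or_assoc.2 a₁.2.2⟩,
            ⟨a₂.1.1, or_assoc.2 a₂.1.2⟩, ⟨a₂.2.1, or_assoc.2 a₂.2.2⟩,
            ⟨a₃.1.1, or_assoc.2 a₃.1.2⟩, ⟨a₃.2.1, or_assoc.2 a₃.2.2⟩]
        · have hzz : (z₁, T.rev i₁ k₁) ≠ (z₂, T.rev i₂ k₂) := by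
            intro h
            obtain ⟨h1, h2⟩ := Prod.mk.inj h
            have e1 := T.nbr_rev i₁ k₁
            have e2 := T.nbr_rev i₂ k₂
            rw [← hz₁, h1, h2] at e1
            exact h12 (e1.symm.trans e2)
          rw [Finset.card_insert_of_notMem, Finset.card_insert_of_notMem,
            Finset.card_insert_of_notMem, Finset.card_insert_of_notMem,
            Finset.card_insert_of_notMem, Finset.card_singleton]
          · simp [h12]
          · simp [hz₂i.1, hz₂i.2]
          · simp [hz₂i.2.symm, h12.symm, hr.symm]
          · simpa [hz₁i.1, hz₁i.2] using hzz
          · simp [hz₁i.1.symm, hz₂i.1.symm, h12, hkk]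
    have h1 : Disjoint (T.contour E') Z := by
      rw [Finset.disjoint_left]
      intro e he heZ
      have a := (hnew e).1 he
      have b := (hZ e heZ).2
      tauto
    have h2 : T.contour E' ∪ Z ⊆ T.contour E ∪ T.contour C :=
      Finset.union_subset (fun e he => ((hnew e).1 he).1) fun e he => (hZ e he).1
    have h3 := Finset.card_le_card h2
    rw [Finset.card_union_of_disjoint h1] at h3
    have h4 := Finset.card_union_le (T.contour E) (T.contour C)
    have h5 := T.card_contour_le hν hκ hC.starConnected (by exact_mod_cast hC.nonempty)
    have h6 := hE.card
    rw [List.map_cons, List.sum_cons, Nat.mul_add]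
    omega
  · -- connectedness
    intro R hR
    set I : Set V := {i₁, i₂} with hI
    have hmemI : ∀ v, v ∈ I ↔ v = i₁ ∨ v = i₂ := by intro v; simp [hI]
    have hz₁I : z₁ ∉ I := by rw [hmemI]; tauto
    have hz₂I : z₂ ∉ I := by rw [hmemI]; tauto
    set R₀ : Set V := R \ I with hR₀
    have hR₀c : ∀ e ∈ T.contour E ∪ T.contour C, e.1 ∉ I → T.tgt e ∉ I →
        (e.1 ∈ R₀ ↔ T.tgt e ∈ R₀) := by
      intro e he h1 h2
      have := hR e ((hnew e).2 ⟨he, by rw [hmemI] at h1; tauto, by rw [hmemI] at h2; tauto⟩)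
      simp [hR₀, h1, h2, this]
    -- If `z₁ ∉ X`, no arc of the contour of `C` leaves `X`: from outside it can enter the bridge
    -- only at `z₁`, because the arc from `z₂` to `i₂` has a face of `C'` on its left. By balance no
    -- arc enters `X` either, yet the arc from `i₂` to `z₂` would.
    have key : ∀ X : Set V, (∀ v ∈ X, v ∉ I) → (∀ e ∈ T.contour E ∪ T.contour C, e.1 ∉ I →
        T.tgt e ∉ I → (e.1 ∈ X ↔ T.tgt e ∈ X)) → z₂ ∈ X → z₁ ∈ X := by
      intro X hXI hX hz₂X
      by_contra hz₁X
      have hcl := (T.balanced_contour C).closedUnder (R := X) (by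
        intro e he heX
        have heu := Finset.mem_union_right (T.contour E) he
        by_cases ht : T.tgt e ∈ I
        · exfalso
          have ho := (hold e).1 heu
          have hc := T.mem_contour.1 he
          rcases hnbr (T.tgt e) ((hmemI _).1 ht) (T.rev e.1 e.2) (by rw [T.tgt_rev]; exact ho.2.1.1)
            (by rw [T.tgt_rev]; exact ho.2.1.2) with h | ⟨h, -, -⟩ | ⟨-, h, h'⟩
          · rw [T.tgt_rev] at h
            exact hXI _ heX ((hmemI _).2 h)
          · rw [T.tgt_rev] at h
            exact hz₁X (h ▸ heX)
          · have := hc.1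
            rw [T.left_eq_left_tgt, h, h'] at this
            exact hdisE _ this (hsubE hb.snd₂)
        · exact (hX e heu (hXI _ heX) ht).1 heX)
      have hmem : (i₂, k₂) ∈ T.contour C := T.mem_contour.2 ⟨hb.fst₂, hi₂C, hz₂C⟩
      exact hXI i₂ ((hcl _ hmem).2 hz₂X) ((hmemI _).2 (.inr rfl))
    -- The implication is applied to `R₀` and to the complement of `R₀ ∪ I`; together they give both
    -- directions.
    have hzz : z₁ ∈ R₀ ↔ z₂ ∈ R₀ := by
      constructor
      · intro h
        by_contra h'
        have := key (R₀ ∪ I)ᶜ (fun v hv hvI => hv (.inr hvI)) (fun e he h1 h2 => by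
          have := hR₀c e he h1 h2
          simp only [Set.mem_compl_iff, Set.mem_union]
          tauto) (by simp only [Set.mem_compl_iff, Set.mem_union]; tauto)
        exact this (.inl h)
      · exact key R₀ (fun v hv => hv.2) hR₀c
    -- As `R₀` treats `z₁` and `z₂` alike, it extends over the bridge with their common value. The
    -- result is closed under both old contours, and these share the boundary vertex `i₁`.
    set R₁ : Set V := {v | v ∈ R₀ ∨ (v ∈ I ∧ z₁ ∈ R₀)} with hR₁
    have hR₁I : ∀ v ∈ I, (v ∈ R₁ ↔ z₁ ∈ R₀) := by
      intro v hv
      have : v ∉ R₀ := fun h => h.2 hv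
      simp [hR₁, this, hv]
    have hR₁n : ∀ v ∉ I, (v ∈ R₁ ↔ v ∈ R₀) := by
      intro v hv
      simp [hR₁, hv]
    have hR₁c : ∀ e ∈ T.contour E ∪ T.contour C, (e.1 ∈ R₁ ↔ T.tgt e ∈ R₁) := by
      intro e he
      have ho := (hold e).1 he
      by_cases h1 : e.1 ∈ I <;> by_cases h2 : T.tgt e ∈ I
      · rw [hR₁I _ h1, hR₁I _ h2]
      · rw [hR₁I _ h1, hR₁n _ h2]
        rcases hnbr e.1 ((hmemI _).1 h1) e.2 ho.2.2.1 ho.2.2.2 with h | ⟨h, -⟩ | ⟨h, -⟩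
        · exact absurd ((hmemI _).2 h) h2
        · rw [tgt, h]
        · rw [tgt, h, hzz]
      · rw [hR₁n _ h1, hR₁I _ h2]
        rcases hnbr (T.tgt e) ((hmemI _).1 h2) (T.rev e.1 e.2) (by rw [T.tgt_rev]; exact ho.2.1.1)
          (by rw [T.tgt_rev]; exact ho.2.1.2) with h | ⟨h, -⟩ | ⟨h, -⟩ <;> rw [T.tgt_rev] at h
        · exact absurd ((hmemI _).2 h) h1
        · rw [h]
        · rw [h, hzz]
      · rw [hR₁n _ h1, hR₁n _ h2]
        exact hR₀c e he h1 h2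
    have hclE : ClosedUnder Prod.fst T.tgt (T.contour E) R₁ :=
      fun e he => hR₁c e (Finset.mem_union_left _ he)
    have hclC : ClosedUnder Prod.fst T.tgt (T.contour C) R₁ :=
      fun e he => hR₁c e (Finset.mem_union_right _ he)
    have hall : ∀ B ∈ C :: 𝒞, ∀ u ∈ P.extStarBoundary B, u ∉ E → (u ∈ R₁ ↔ i₁ ∈ R₁) := by
      intro B hB u hu huE
      rcases List.mem_cons.1 hB with rfl | hB
      · exact ⟨T.mem_of_closedUnder hP hC.starConnected hclC hu hi₁b.1,
          T.mem_of_closedUnder hP hC.starConnected hclC hi₁b.1 hu⟩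
      · exact ⟨hE.conn R₁ hclE B hB C' hC' u hu i₁ hi₁b.2 huE hi₁E,
          hE.conn R₁ hclE C' hC' B hB i₁ hi₁b.2 u hu hi₁E huE⟩
    intro B hB B' hB' u hu v hv huE' hvE' huR
    have huE : u ∉ E := fun h => huE' ((hmemE' u).2 (.inl h))
    have hvE : v ∉ E := fun h => hvE' ((hmemE' v).2 (.inl h))
    have huI : u ∉ I := fun h => huE' ((hmemE' u).2 (.inr (.inr ((hmemI _).1 h))))
    have hvI : v ∉ I := fun h => hvE' ((hmemE' v).2 (.inr (.inr ((hmemI _).1 h))))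
    have h1 := (hall B hB u hu huE).1 ((hR₁n u huI).2 ⟨huR, huI⟩)
    have h2 := (hall B' hB' v hv hvE).2 h1
    exact ((hR₁n v hvI).1 h2).1

end RotationSystem

/-! ### Interlocked clusters and the graph of their *-clusters -/

namespace PlaneGraph

variable {V : Type} {P : PlaneGraph V} {A D : Set V}

theorem IsInterlockedCluster.mem_iff (h : P.IsInterlockedCluster A D) {C : Set V}
    (hC : P.IsStarCluster A C) {u : V} (huC : u ∈ C) (huD : u ∈ D) {C' : Set V} :
    Relation.ReflTransGen (P.InterlockStep A) C C' → C' ⊆ D := by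
  obtain ⟨C₀, hC₀, rfl⟩ := h
  obtain ⟨B, hB, huB⟩ := huD
  intro hr
  have hBc : P.IsStarCluster A B := by
    rcases Relation.ReflTransGen.cases_tail hB with rfl | ⟨_, _, h⟩
    exacts [hC₀, h.2.1]
  obtain rfl := hBc.eq_of_mem hC huB huC
  exact Set.subset_sUnion_of_mem (hB.trans hr)

theorem IsInterlockedCluster.subset_of_mem (h : P.IsInterlockedCluster A D) {C : Set V}
    (hC : P.IsStarCluster A C) {u : V} (huC : u ∈ C) (huD : u ∈ D) : C ⊆ D :=
  h.mem_iff hC huC huD .refl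

theorem IsInterlockedCluster.subset_of_interlocked (h : P.IsInterlockedCluster A D) {C C' : Set V}
    (hC : P.IsStarCluster A C) (hC' : P.IsStarCluster A C') (hCD : C ⊆ D)
    (hi : P.Interlocked C C') : C' ⊆ D := by
  obtain ⟨u, hu⟩ := hC.nonempty
  exact h.mem_iff hC hu (hCD hu) (.single ⟨hC, hC', hi⟩)

theorem IsInterlockedCluster.subset (h : P.IsInterlockedCluster A D) : D ⊆ A := by
  obtain ⟨C₀, hC₀, rfl⟩ := h
  refine Set.sUnion_subset fun B hB => ?_
  rcases Relation.ReflTransGen.cases_tail hB with rfl | ⟨_, _, h⟩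
  exacts [hC₀.subset, h.2.1.subset]

theorem IsInterlockedCluster.mem_of_adj (h : P.IsInterlockedCluster A D) {u w : V} (hu : u ∈ D)
    (hw : w ∈ A) (huw : P.starGraph.Adj u w) : w ∈ D := by
  have hc := isStarCluster_of_mem (P := P) (h.subset hu)
  exact h.subset_of_mem hc (.refl (h.subset hu)) hu (.of_adj huw (h.subset hu) hw)

theorem IsInterlockedCluster.reflTransGen (h : P.IsInterlockedCluster A D) {C C' : Set V}
    (hC : P.IsStarCluster A C) (hC' : P.IsStarCluster A C') (hCD : C ⊆ D) (hCD' : C' ⊆ D) :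
    Relation.ReflTransGen (P.InterlockStep A) C C' := by
  obtain ⟨C₀, hC₀, rfl⟩ := h
  have key : ∀ B, P.IsStarCluster A B →
      B ⊆ ⋃₀ {C | Relation.ReflTransGen (P.InterlockStep A) C₀ C} →
      Relation.ReflTransGen (P.InterlockStep A) C₀ B := by
    intro B hB hBD
    obtain ⟨u, hu⟩ := hB.nonempty
    obtain ⟨B', hB', hu'⟩ := hBD hu
    have hBc : P.IsStarCluster A B' := by
      rcases Relation.ReflTransGen.cases_tail hB' with rfl | ⟨_, _, h⟩
      exacts [hC₀, h.2.1]
    obtain rfl := hBc.eq_of_mem hB hu' hu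
    exact hB'
  have hs : Std.Symm (P.InterlockStep A) := ⟨fun _ _ h => ⟨h.2.1, h.1, h.2.2.symm⟩⟩
  exact (Relation.ReflTransGen.stdSymm.symm _ _ (key C hC hCD)).trans (key C' hC' hCD')

theorem IsInterlockedCluster.extStarBoundary_disjoint (h : P.IsInterlockedCluster A D) {v : V}
    (hv : v ∈ P.extStarBoundary D) : v ∉ A := by
  obtain ⟨hv, u, hu, huv⟩ := hv
  exact fun hvA => infComp_notMem hv (h.mem_of_adj hu hvA huv)

/-- The interlocked pairs of distinct finite `*`-clusters. -/
def lockGraph (P : PlaneGraph V) (A : Set V) : SimpleGraph (Finset V) where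
  Adj C C' := C ≠ C' ∧ P.InterlockStep A C C'
  symm := ⟨fun _ _ h => ⟨h.1.symm, h.2.2.1, h.2.1, h.2.2.2.symm⟩⟩
  loopless := ⟨fun _ h => h.1 rfl⟩

theorem exists_reachable_lockGraph (hA : A.Finite) {C : Finset V} {S : Set V} (h : Relation.ReflTransGen (P.InterlockStep A) C S) :
    ∃ C' : Finset V, (C' : Set V) = S ∧ (P.lockGraph A).Reachable C C' := by
  induction h with
  | refl => exact ⟨C, rfl, .refl _⟩
  | @tail S S' _ hs ih =>
    obtain ⟨C', rfl, hr⟩ := ih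
    have hf := hA.subset hs.2.1.subset
    refine ⟨hf.toFinset, hf.coe_toFinset, ?_⟩
    by_cases heq : C' = hf.toFinset
    · exact heq ▸ hr
    · exact hr.trans (SimpleGraph.Adj.reachable ⟨heq, by rwa [hf.coe_toFinset]⟩)

end PlaneGraph

/-! ### Chains of clusters between two boundary points -/

namespace RotationSystem

variable {V F : Type} [DecidableEq V] [DecidableEq F] {P : PlaneGraph V} {d g : ℕ} [NeZero d]
  (T : RotationSystem P d g F)

theorem exists_merger_of_isPath {ν κ : ℕ} (hP : P.OneEnded) (hν : T.GrowthBound ν)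
    (hκ : g * d = 2 * ν + κ + 2 * d) (hbr : T.HasBridges κ) {A : Set V} {C C' : Finset V}
    (p : (P.lockGraph A).Walk C C') (hp : p.IsPath) (hC : P.IsStarCluster A C) :
    (∀ B ∈ p.support, P.IsStarCluster A B) ∧ ∃ E, T.IsMerger ν κ p.support E := by
  induction p with
  | nil => exact ⟨by simpa using hC, _, .singleton T hP hν hκ hC⟩
  | @cons C B C' hadj p ih =>
    rw [SimpleGraph.Walk.cons_isPath_iff] at hp
    obtain ⟨hcl, E, hE⟩ := ih hp.1 hadj.2.2.1
    refine ⟨?_, ?_⟩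
    · intro B' hB'
      rw [SimpleGraph.Walk.support_cons, List.mem_cons] at hB'
      rcases hB' with rfl | hB'
      exacts [hC, hcl B' hB']
    · rw [SimpleGraph.Walk.support_cons]
      exact hE.cons T hP hν hκ hbr hcl hC hp.2 p.start_mem_support hadj.2.2.2

/-- A shortest chain is taken from a cluster with `x` on its exterior boundary to one with `y` on
it. Every bridge vertex lies on the exterior boundaries of two different clusters of the chain, so
by minimality neither `x` nor `y` is one, and both remain outside the merger. -/
theorem exists_merger {ν κ : ℕ} (hP : P.OneEnded) (hν : T.GrowthBound ν)
    (hκ : g * d = 2 * ν + κ + 2 * d) (hbr : T.HasBridges κ) {A D : Set V} (hA : A.Finite)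
    (hD : P.IsInterlockedCluster A D) {x y : V} (hx : x ∈ P.extStarBoundary D)
    (hy : y ∈ P.extStarBoundary D) :
    ∃ 𝒞 E, T.IsMerger ν κ 𝒞 E ∧ 𝒞.Nodup ∧
      (∀ C ∈ 𝒞, P.IsStarCluster A C ∧ (C : Set V) ⊆ D) ∧ x ∉ E ∧ y ∉ E ∧
      (∃ C ∈ 𝒞, x ∈ P.extStarBoundary C) ∧ ∃ C ∈ 𝒞, y ∈ P.extStarBoundary C := by
  classical
  have start : ∀ v ∈ P.extStarBoundary D, ∃ C : Finset V, P.IsStarCluster A C ∧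
      (C : Set V) ⊆ D ∧ v ∈ P.extStarBoundary C := by
    rintro v ⟨hv, u, hu, huv⟩
    have hc := PlaneGraph.isStarCluster_of_mem (P := P) (hD.subset hu)
    have hsub := hD.subset_of_mem hc (.refl (hD.subset hu)) hu
    have hf := hA.subset hc.subset
    refine ⟨hf.toFinset, by rwa [hf.coe_toFinset], by rwa [hf.coe_toFinset], ?_⟩
    rw [hf.coe_toFinset]
    exact ⟨PlaneGraph.infComp_anti hsub hv, u, .refl (hD.subset hu), huv⟩
  obtain ⟨Cx, hCx, hCxD, hxC⟩ := start x hx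
  obtain ⟨Cy, hCy, hCyD, hyC⟩ := start y hy
  have hex : ∃ n, ∃ (C C' : Finset V) (p : (P.lockGraph A).Walk C C'), P.IsStarCluster A C ∧
      (C : Set V) ⊆ D ∧ x ∈ P.extStarBoundary C ∧ y ∈ P.extStarBoundary C' ∧ p.length = n := by
    obtain ⟨C', hC', ⟨p⟩⟩ := PlaneGraph.exists_reachable_lockGraph hA
      (hD.reflTransGen hCx hCy hCxD hCyD)
    obtain rfl := Finset.coe_injective hC'
    exact ⟨_, _, _, p, hCx, hCxD, hxC, hyC, rfl⟩
  obtain ⟨C, C', p, hC, hCD, hxC, hyC', hlen⟩ := Nat.find_spec hex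
  have hmin : ∀ (B B' : Finset V) (q : (P.lockGraph A).Walk B B'), P.IsStarCluster A B →
      (B : Set V) ⊆ D → x ∈ P.extStarBoundary B → y ∈ P.extStarBoundary B' →
      p.bypass.length ≤ q.length := fun B B' q h1 h2 h3 h4 =>
    p.length_bypass_le_length.trans (hlen ▸ Nat.find_min' hex ⟨B, B', q, h1, h2, h3, h4, rfl⟩)
  set q := p.bypass with hq
  have hqp : q.IsPath := p.bypass_isPath
  obtain ⟨hcl, E, hE⟩ := T.exists_merger_of_isPath hP hν hκ hbr q hqp hC
  have hsubD : ∀ B ∈ q.support, (B : Set V) ⊆ D := by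
    have : ∀ {B B' : Finset V} (r : (P.lockGraph A).Walk B B'), (B : Set V) ⊆ D →
        ∀ B'' ∈ r.support, (B'' : Set V) ⊆ D := by
      intro B B' r
      induction r with
      | nil => simp
      | cons h r ih =>
        intro hB B'' hB''
        rw [SimpleGraph.Walk.support_cons, List.mem_cons] at hB''
        rcases hB'' with rfl | hB''
        · exact hB
        · exact ih (hD.subset_of_interlocked h.2.1 h.2.2.1 hB h.2.2.2) _ hB''
    exact this q hCD
  -- If `x` also bordered a later cluster, the chain could start there and would be shorter.
  have hxu : ∀ B ∈ q.support, x ∈ P.extStarBoundary B → B = C := by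
    intro B hB hxB
    have h1 := hmin _ _ (q.dropUntil B hB) (hcl B hB) (hsubD B hB) hxB hyC'
    have h2 := congrArg SimpleGraph.Walk.length (q.take_spec hB)
    rw [SimpleGraph.Walk.length_append] at h2
    exact (SimpleGraph.Walk.eq_of_length_eq_zero (p := q.takeUntil B hB) (by omega)).symm
  have hyu : ∀ B ∈ q.support, y ∈ P.extStarBoundary B → B = C' := by
    intro B hB hyB
    have h1 := hmin _ _ (q.takeUntil B hB) hC hCD hxC hyB
    have h2 := congrArg SimpleGraph.Walk.length (q.take_spec hB)
    rw [SimpleGraph.Walk.length_append] at h2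
    exact SimpleGraph.Walk.eq_of_length_eq_zero (p := q.dropUntil B hB) (by omega)
  refine ⟨q.support, E, hE, hqp.support_nodup, fun B hB => ⟨hcl B hB, hsubD B hB⟩, ?_, ?_,
    ⟨C, q.start_mem_support, hxC⟩, ⟨C', q.end_mem_support, hyC'⟩⟩
  · intro hxE
    rcases hE.mem x hxE with ⟨B, hB, hxB⟩ | ⟨B, hB, B', hB', hne, h1, h2, -⟩
    · exact PlaneGraph.infComp_notMem hx.1 (hsubD B hB hxB)
    · exact hne ((hxu B hB h1).trans (hxu B' hB' h2).symm)
  · intro hyE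
    rcases hE.mem y hyE with ⟨B, hB, hyB⟩ | ⟨B, hB, B', hB', hne, h1, h2, -⟩
    · exact PlaneGraph.infComp_notMem hy.1 (hsubD B hB hyB)
    · exact hne ((hyu B hB h1).trans (hyu B' hB' h2).symm)

end RotationSystem

/-! ### The discounted weight and walks around an interlocked cluster -/

theorem List.sum_toFinset_le {α : Type*} [DecidableEq α] (l : List α) {f : α → ℝ}
    (hf : ∀ a, 0 ≤ f a) : ∑ a ∈ l.toFinset, f a ≤ (l.map f).sum := by
  induction l with
  | nil => simp
  | cons a l ih =>
    rw [List.toFinset_cons, List.map_cons, List.sum_cons]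
    by_cases h : a ∈ l.toFinset
    · rw [Finset.insert_eq_of_mem h]
      linarith [hf a]
    · rw [Finset.sum_insert h]
      linarith

-- An oriented edge traversed repeatedly counts once on the left and several times on the right,
-- where each term is nonnegative because `c ≤ 1`.
open scoped Classical in
theorem PlaneGraph.weight_edgeRange_le {V : Type} {P : PlaneGraph V} (A : Set V) {c : ℝ}
    (hc1 : c ≤ 1) {x y : V} (η : P.graph.Walk x y) :
    ((P.edgeRange η).ncard : ℝ) - c * ({e ∈ P.edgeRange η | P.IsFree A e.fst}.ncard : ℝ) ≤
      (η.darts.map fun e => if P.IsFree A e.fst then 1 - c else 1).sum := by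
  refine le_trans ?_ (List.sum_toFinset_le η.darts
    (f := fun e => if P.IsFree A e.fst then 1 - c else 1)
    fun e => by split_ifs <;> linarith)
  have h1 : P.edgeRange η = (η.darts.toFinset : Set P.graph.Dart) := by
    ext e; simp [edgeRange]
  have h2 : {e ∈ P.edgeRange η | P.IsFree A e.fst} =
      ((η.darts.toFinset.filter fun e => P.IsFree A e.fst : Finset _) : Set P.graph.Dart) := by
    ext e; simp [edgeRange]
  rw [h2, h1, Set.ncard_coe_finset, Set.ncard_coe_finset, Finset.sum_ite, Finset.sum_const,
    Finset.sum_const, ← Finset.card_filter_add_card_filter_not (s := η.darts.toFinset)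
      (fun e => P.IsFree A e.fst)]
  simp only [nsmul_eq_mul]
  push_cast
  apply le_of_eq
  ring

namespace RotationSystem

variable {V F : Type} [DecidableEq V] [DecidableEq F] {P : PlaneGraph V} {d g : ℕ} [NeZero d]
  (T : RotationSystem P d g F)

/-- The number of vertices sharing a face with a vertex of `S`. -/
theorem card_le_of_cofacial (T : RotationSystem P d g F) {B S : Finset V} (h : ∀ v ∈ B, ∃ u ∈ S, P.starGraph.Adj u v) :
    B.card ≤ S.card * (d * g) := by
  refine (Finset.card_le_card (t := S.biUnion fun u => Finset.univ.biUnion fun k =>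
    (T.faceDarts (T.left u k)).image Prod.fst) ?_).trans
    (Finset.card_biUnion_le_card_mul _ _ _ fun u _ => ?_)
  · intro v hv
    obtain ⟨u, hu, huv⟩ := h v hv
    obtain ⟨_, k, l, hkl⟩ := (T.starAdj_iff _ _).1 huv
    simp only [Finset.mem_biUnion, Finset.mem_univ, true_and, Finset.mem_image]
    exact ⟨u, hu, k, (v, l), (T.mem_faceDarts _ _).2 hkl.symm, rfl⟩
  · refine (Finset.card_biUnion_le_card_mul _ _ g fun k _ => ?_).trans (by simp)
    exact Finset.card_image_le.trans (T.card_faceDarts _).le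

open scoped Classical in
/-- Two points of the exterior boundary of an interlocked cluster are joined outside `A` by a walk
that gains from every free vertex of the exterior boundary. -/
theorem exists_walk_of_free {ν κ : ℕ} (hP : P.OneEnded) (hν : T.GrowthBound ν)
    (hκ : g * d = 2 * ν + κ + 2 * d) (hbr : T.HasBridges κ) {A D : Set V} (hA : A.Finite)
    (hD : P.IsInterlockedCluster A D) {x y : V} (hx : x ∈ P.extStarBoundary D)
    (hy : y ∈ P.extStarBoundary D) {c ε : ℝ} (hc0 : 0 ≤ c) (hc1 : c ≤ 1) (hε0 : 0 ≤ ε)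
    (hεc : 2 * ε ≤ c) (hεν : ε * (d * g) ≤ ν) {B : Finset V}
    (hB : ∀ v ∈ B, P.IsFree A v ∧ v ∈ P.extStarBoundary D) :
    ∃ η : P.graph.Walk x y, (∀ v ∈ η.support, v ∉ A) ∧
      ((P.edgeRange η).ncard : ℝ) - c * ({e ∈ P.edgeRange η | P.IsFree A e.fst}.ncard : ℝ) ≤
        ν * D.ncard + κ / 2 + c - ε * B.card := by
  obtain ⟨𝒞, E, hE, hnd, h𝒞, hxE, hyE, ⟨Cx, hCx, hxC⟩, Cy, hCy, hyC⟩ :=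
    T.exists_merger hP hν hκ hbr hA hD hx hy
  set w : V → ℝ := fun v => if P.IsFree A v then 1 - c else 1 with hw
  have hw0 : ∀ v, 0 ≤ w v := fun v => by simp only [hw]; split_ifs <;> linarith
  obtain ⟨η, hη, hηw⟩ := (T.balanced_contour E).exists_walk (G := P.graph)
    (fun e _ => T.adj_nbr e.1 e.2)
    (fun R hR hxR => hE.conn R hR Cx hCx Cy hCy x hxC y hyC hxE hyE hxR) hw0
  refine ⟨η, ?_, (PlaneGraph.weight_edgeRange_le A hc1 η).trans ?_⟩
  · intro v hv
    rcases hη v hv with rfl | rfl | ⟨e, he, rfl⟩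
    · exact hD.extStarBoundary_disjoint hx
    · exact hD.extStarBoundary_disjoint hy
    -- The end of a contour arc lies on a face touched by a cluster of the chain. Were it in `A`, it
    -- would be *-adjacent to or contained in that cluster, hence in `E`.
    · intro heA
      obtain ⟨hl, -, ht⟩ := T.mem_contour.1 he
      obtain ⟨C, hC, hlC⟩ := hE.touched _ hl
      obtain ⟨u, hu, k, hk⟩ := T.mem_touched.1 hlC
      obtain ⟨l, hl⟩ := T.left_nbr e.1 e.2
      refine ht (hE.subset C hC ((h𝒞 C hC).1.mem_of_adj hu heA ((T.starAdj_iff _ _).2 ⟨?_, k, l,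
        hk.trans hl.symm⟩)))
      rintro rfl
      exact ht (hE.subset C hC hu)
  · have hDf : D.Finite := hA.subset hD.subset
    set D' : Finset V := 𝒞.toFinset.biUnion id with hD'
    have hD'card : D'.card = (𝒞.map Finset.card).sum := by
      rw [hD', Finset.card_biUnion]
      · exact List.sum_toFinset _ hnd
      · intro C hC C' hC' hne
        rw [Function.onFun, Finset.disjoint_left]
        intro u hu hu'
        exact hne (Finset.coe_injective ((h𝒞 C (by simpa using hC)).1.eq_of_mem
          (h𝒞 C' (by simpa using hC')).1 hu hu'))
    have hD'D : D' ⊆ hDf.toFinset := by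
      intro u hu
      obtain ⟨C, hC, hu⟩ := Finset.mem_biUnion.1 hu
      exact hDf.mem_toFinset.2 ((h𝒞 C (by simpa using hC)).2 hu)
    have hDn : D.ncard = D'.card + (hDf.toFinset \ D').card := by
      rw [Set.ncard_eq_toFinset_card D hDf, ← Finset.card_sdiff_add_card_eq_card hD'D, add_comm]
    set S := T.contour E with hS
    set Fr := S.filter fun e => P.IsFree A e.1 with hFr
    set B' := B.filter fun v => ∃ u ∈ D', P.starGraph.Adj u v with hB'
    have hsum : ∑ e ∈ S, w e.1 = S.card - c * Fr.card := by
      rw [hw, Finset.sum_ite, Finset.sum_const, Finset.sum_const,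
        ← Finset.card_filter_add_card_filter_not (s := S) (fun e => P.IsFree A e.1)]
      simp only [nsmul_eq_mul]
      push_cast
      ring
    -- The end point correction `w x - w y` is thus at most `c`, and contributes `c / 2` after
    -- halving. The other `c / 2` comes from the vertex possibly missed in `hFrB`.
    have hwx : w x ≤ 1 := by simp only [hw]; split_ifs <;> linarith
    have hwy : 1 - c ≤ w y := by simp only [hw]; split_ifs <;> linarith
    have hScard : (S.card : ℝ) ≤ 2 * ν * D'.card + κ := by
      rw [hD'card]; exact_mod_cast hE.card
    -- A free boundary vertex `v` near the chain is not in `E`. If no contour arc started at `v`,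
    -- then by balance `{v}` would be closed under the contour, and connectedness would force `v =
    -- x`. So only `x` can be missed.
    have hFrB : (B'.card : ℝ) ≤ Fr.card + 1 := by
      have h1 : B'.erase x ⊆ Fr.image Prod.fst := by
        intro v hv
        obtain ⟨hvx, hv⟩ := Finset.mem_erase.1 hv
        obtain ⟨hvB, u, hu, huv⟩ := Finset.mem_filter.1 hv
        obtain ⟨hvf, hvD⟩ := hB v hvB
        obtain ⟨C, hC, hu⟩ := Finset.mem_biUnion.1 hu
        have hC : C ∈ 𝒞 := by simpa using hC
        have hvC : v ∈ P.extStarBoundary C :=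
          ⟨PlaneGraph.infComp_anti (h𝒞 C hC).2 hvD.1, u, hu, huv⟩
        have hvE : v ∉ E := by
          intro hvE
          rcases hE.mem v hvE with ⟨C, hC, hvC⟩ | ⟨C, hC, C', hC', -, -, -, h2⟩
          · exact hvf.1 (hD.subset ((h𝒞 C hC).2 hvC))
          · have h3 := Set.ncard_le_ncard (s := P.graph.neighborSet v \ A)
              (t := P.graph.neighborSet v \ (C ∪ C')) (Set.sdiff_subset_sdiff_right
                (Set.union_subset (h𝒞 C hC).1.subset (h𝒞 C' hC').1.subset))
              ((T.finite_neighborSet v).subset Set.sdiff_subset)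
            have := hvf.2
            omega
        by_contra hno
        have hsrc : ∀ e ∈ S, e.1 ≠ v := by
          rintro e he rfl
          exact hno (Finset.mem_image_of_mem _ (Finset.mem_filter.2 ⟨he, hvf⟩))
        have hcl := (T.balanced_contour E).closedUnder (R := {v}) fun e he h =>
          absurd h (hsrc e he)
        exact hvx (hE.conn {v} hcl C hC Cx hCx v hvC x hxC hvE hxE rfl).symm
      have h2 := (Finset.card_le_card h1).trans Finset.card_image_le
      have h3 := Finset.pred_card_le_card_erase (s := B') (a := x)
      have : B'.card ≤ Fr.card + 1 := by omega
      exact_mod_cast this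
    -- The remaining vertices of `B` share a face with some vertex of `D` outside the chain, and
    -- each such vertex accounts for at most `d * g` of them. It also saves ν, which outweighs the
    -- loss `ε * (d * g)`.
    have hBB' : (B.card : ℝ) ≤ B'.card + (hDf.toFinset \ D').card * (d * g) := by
      have h1 : B'.card + (B.filter fun v => ¬ ∃ u ∈ D', P.starGraph.Adj u v).card = B.card := by
        convert Finset.card_filter_add_card_filter_not (s := B)
          (fun v => ∃ u ∈ D', P.starGraph.Adj u v)
      have h2 := T.card_le_of_cofacial (B := B.filter fun v => ¬ ∃ u ∈ D', P.starGraph.Adj u v)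
        (S := hDf.toFinset \ D') (by
          intro v hv
          obtain ⟨hvB, hno⟩ := Finset.mem_filter.1 hv
          obtain ⟨-, u, hu, huv⟩ := (hB v hvB).2
          exact ⟨u, Finset.mem_sdiff.2 ⟨hDf.mem_toFinset.2 hu, fun h => hno ⟨u, h, huv⟩⟩, huv⟩)
      have : B.card ≤ B'.card + (hDf.toFinset \ D').card * (d * g) := by omega
      exact_mod_cast this
    rw [hDn]
    push_cast
    set s : ℝ := (((hDf.toFinset \ D').card : ℕ) : ℝ)
    have hs : 0 ≤ s := Nat.cast_nonneg _
    have e1 : ε * B.card ≤ ε * B'.card + s * ν := by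
      have := mul_le_mul_of_nonneg_left hBB' hε0
      have := mul_le_mul_of_nonneg_left hεν hs
      linarith
    have e2 : c * B'.card ≤ c * Fr.card + c := by
      have := mul_le_mul_of_nonneg_left hFrB hc0
      linarith
    have e3 : 2 * ε * B'.card ≤ c * B'.card :=
      mul_le_mul_of_nonneg_right hεc (Nat.cast_nonneg _)
    have e4 : 2 * (η.darts.map fun e => if P.IsFree A e.fst then 1 - c else 1).sum ≤
      S.card - c * Fr.card + c := by
      have := hηw
      rw [hsum] at this
      linarith
    linarith

end RotationSystem

/-! ### Free vertices next to an exposed cluster -/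

namespace PlaneGraph

variable {V : Type} {P : PlaneGraph V}

/-- The properties of an interlocked cluster `D` of `A` that is exposed to infinity which are used
to find free vertices next to it: `D` is a union of `*`-clusters of `A`, and no other `*`-cluster of
`A` is interlocked with one of those in `D` at the exterior boundary of `D`. -/
structure IsExposedCluster (P : PlaneGraph V) (A D : Set V) : Prop where
  mem_of_adj : ∀ u ∈ D, ∀ w ∈ A, P.starGraph.Adj u w → w ∈ D
  subset : D ⊆ A
  one : ∀ v ∈ P.extStarBoundary D, ∀ u ∈ D, ∀ u' ∈ A, P.graph.Adj v u → P.graph.Adj v u' →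
    ∀ a b, a ≠ b → P.graph.Adj v a → P.graph.Adj v b → a ∉ A → b ∉ A →
    (∀ w, P.graph.Adj v w → w = a ∨ w = b ∨ JoinedWithin P.starGraph A u w ∨
      JoinedWithin P.starGraph A u' w) → u' ∈ D
  two : ∀ v ∈ P.extStarBoundary D, ∀ v' ∈ P.extStarBoundary D, P.graph.Adj v v' →
    ∀ u ∈ D, ∀ u' ∈ A, ∀ b b', b ≠ v' → b' ≠ v → P.graph.Adj v b → P.graph.Adj v' b' →
    b ∉ A → b' ∉ A →
    (∀ w, P.graph.Adj v w → w = v' ∨ w = b ∨ JoinedWithin P.starGraph A u w) →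
    (∀ w, P.graph.Adj v' w → w = v ∨ w = b' ∨ JoinedWithin P.starGraph A u' w) → u' ∈ D

variable {A D : Set V}

/-- In each configuration, if `u'` were not in `D`, the *-clusters of `u` and `u'` would be distinct
and interlocked at the given vertices. The hypothesis on the boundary supplies the membership in the
infinite component that interlocking demands. -/
theorem IsInterlockedCluster.isExposedCluster (hD : P.IsInterlockedCluster A D)
    (hinf : P.extStarBoundary D ⊆ P.infComp A) : P.IsExposedCluster A D := by
  have key : ∀ u ∈ D, ∀ u' ∈ A, u' ∉ D →
      ((∀ a ∈ {y | JoinedWithin P.starGraph A u y}, ∀ b ∈ {y | JoinedWithin P.starGraph A u' y},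
        ¬ P.starGraph.Adj a b) ∧
      ¬ P.Interlocked {y | JoinedWithin P.starGraph A u y} {y | JoinedWithin P.starGraph A u' y}) ∧
      ∀ w, JoinedWithin P.starGraph A u w → ¬ JoinedWithin P.starGraph A u' w := by
    intro u hu u' hu' hn
    have hc := isStarCluster_of_mem (P := P) (hD.subset hu)
    have hc' := isStarCluster_of_mem (P := P) hu'
    have hcD := hD.subset_of_mem hc (.refl (hD.subset hu)) hu
    refine ⟨⟨fun a ha b hb hab => ?_, fun hi => ?_⟩, fun w hw hw' => ?_⟩
    · have ha' : JoinedWithin P.starGraph A u' a :=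
        JoinedWithin.trans hb (.of_adj hab.symm hb.right_mem ha.right_mem)
      exact hn (hcD (JoinedWithin.trans ha ha'.symm))
    · exact hn (hD.subset_of_interlocked hc hc' hcD hi (.refl hu'))
    · exact hn (hcD (hw.trans hw'.symm))
  have hsub : ∀ u u', {y | JoinedWithin P.starGraph A u y} ∪ {y | JoinedWithin P.starGraph A u' y} ⊆
      A := fun u u' => Set.union_subset (fun _ h => h.right_mem) (fun _ h => h.right_mem)
  refine ⟨fun u hu w hw => hD.mem_of_adj hu hw, hD.subset, ?_, ?_⟩
  · intro v hv u hu u' hu' hvu hvu' a b hab hva hvb ha hb hall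
    by_contra hn
    obtain ⟨⟨h1, h2⟩, -⟩ := key u hu u' hu' hn
    refine h2 ⟨h1, .inl ⟨v, infComp_anti (hsub u u') (hinf hv), ?_,
      ⟨u, hvu, .refl (hD.subset hu)⟩, ⟨u', hvu', .refl hu'⟩⟩⟩
    rw [← Set.ncard_pair hab]
    congr 1
    ext w
    constructor
    · rintro ⟨hw, hn⟩
      rcases hall w hw with rfl | rfl | h | h
      · exact .inl rfl
      · exact .inr rfl
      · exact absurd (.inl h) hn
      · exact absurd (.inr h) hn
    · rintro (rfl | rfl)
      · exact ⟨hva, fun h => ha (hsub u u' h)⟩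
      · exact ⟨hvb, fun h => hb (hsub u u' h)⟩
  · intro v hv v' hv' hvv u hu u' hu' b b' hb hb' hvb hvb' hbA hbA' hall hall'
    by_contra hn
    obtain ⟨⟨h1, h2⟩, h3⟩ := key u hu u' hu' hn
    have hvA := hD.extStarBoundary_disjoint hv
    have hvA' := hD.extStarBoundary_disjoint hv'
    refine h2 ⟨h1, .inr ⟨v, infComp_anti (hsub u u') (hinf hv), v',
      infComp_anti (hsub u u') (hinf hv'), hvv, ⟨?_, ?_⟩, ?_, ?_⟩⟩
    · rw [← Set.ncard_pair hb]
      congr 1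
      ext w
      constructor
      · rintro ⟨hw, hn⟩
        rcases hall w hw with rfl | rfl | h
        · exact .inr rfl
        · exact .inl rfl
        · exact absurd h hn
      · rintro (rfl | rfl)
        · exact ⟨hvb, fun h => hbA h.right_mem⟩
        · exact ⟨hvv, fun h => hvA' h.right_mem⟩
    · rw [Set.eq_empty_iff_forall_notMem]
      rintro w ⟨hw, hw'⟩
      rcases hall w hw with rfl | rfl | h
      · exact hvA' hw'.right_mem
      · exact hbA hw'.right_mem
      · exact h3 w h hw'
    · rw [← Set.ncard_pair hb']
      congr 1
      ext w
      constructor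
      · rintro ⟨hw, hn⟩
        rcases hall' w hw with rfl | rfl | h
        · exact .inr rfl
        · exact .inl rfl
        · exact absurd h hn
      · rintro (rfl | rfl)
        · exact ⟨hvb', fun h => hbA' h.right_mem⟩
        · exact ⟨hvv.symm, fun h => hvA h.right_mem⟩
    · rw [Set.eq_empty_iff_forall_notMem]
      rintro w ⟨hw, hw'⟩
      rcases hall' w hw with rfl | rfl | h
      · exact hvA hw'.right_mem
      · exact hbA' hw'.right_mem
      · exact h3 w hw' h

theorem IsExposedCluster.notMem (h : P.IsExposedCluster A D) {v : V}
    (hv : v ∈ P.extStarBoundary D) : v ∉ A := by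
  obtain ⟨hv, u, hu, huv⟩ := hv
  exact fun hvA => infComp_notMem hv (h.mem_of_adj u hu v hvA huv)

theorem IsExposedCluster.notMem_of_adj (h : P.IsExposedCluster A D) {u w : V} (hu : u ∈ D)
    (huw : P.starGraph.Adj u w) (hw : w ∉ D) : w ∉ A :=
  fun hwA => hw (h.mem_of_adj u hu w hwA huw)

theorem isFree_of_three {v a b c : V} (hfin : (P.graph.neighborSet v).Finite) (hv : v ∉ A)
    (ha : P.graph.Adj v a) (hb : P.graph.Adj v b) (hc : P.graph.Adj v c) (haA : a ∉ A)
    (hbA : b ∉ A) (hcA : c ∉ A) (hab : a ≠ b) (hac : a ≠ c) (hbc : b ≠ c) : P.IsFree A v := by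
  refine ⟨hv, ?_⟩
  rw [← Set.ncard_eq_three.2 ⟨a, b, c, hab, hac, hbc, rfl⟩]
  refine Set.ncard_le_ncard ?_ (hfin.subset Set.sdiff_subset)
  rintro w (rfl | rfl | rfl)
  exacts [⟨ha, haA⟩, ⟨hb, hbA⟩, ⟨hc, hcA⟩]

/-- A vertex from which an infinite path avoids `D` lies in the infinite component. -/
theorem mem_infComp_of_ray (r : ℕ → V) (hr : Function.Injective r)
    (hadj : ∀ n, P.graph.Adj (r n) (r (n + 1))) (hD : ∀ n, r n ∉ D) : r 0 ∈ P.infComp D := by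
  refine (Set.infinite_range_of_injective hr).mono ?_
  rintro _ ⟨n, rfl⟩
  induction n with
  | zero => exact .refl (hD 0)
  | succ n ih => exact JoinedWithin.trans ih (.of_adj (hadj n) (hD n) (hD (n + 1)))

/-- An automorphism of a plane graph. -/
structure IsAutomorphism (P : PlaneGraph V) (φ : V ≃ V) : Prop where
  adj : ∀ u v, P.graph.Adj (φ u) (φ v) ↔ P.graph.Adj u v
  star : ∀ u v, P.starGraph.Adj (φ u) (φ v) ↔ P.starGraph.Adj u v

variable {φ : V ≃ V}

theorem joinedWithin_preimage {G : SimpleGraph V} (hφ : ∀ u v, G.Adj (φ u) (φ v) ↔ G.Adj u v)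
    {S : Set V} {u v : V} : JoinedWithin G (φ ⁻¹' S) u v ↔ JoinedWithin G S (φ u) (φ v) := by
  constructor
  · exact .map φ (fun a b h => (hφ a b).2 h) fun a ha => ha
  · intro h
    have := h.map (G' := G) (S' := φ ⁻¹' S) φ.symm
      (fun a b h => (hφ _ _).1 (by simpa using h)) (fun a ha => by simpa using ha)
    simpa using this

theorem IsAutomorphism.infComp (hφ : P.IsAutomorphism φ) (S : Set V) :
    P.infComp (φ ⁻¹' S) = φ ⁻¹' P.infComp S := by
  ext v
  have : {w | JoinedWithin P.graph (φ ⁻¹' S)ᶜ v w} =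
      φ ⁻¹' {w | JoinedWithin P.graph Sᶜ (φ v) w} := by
    ext w
    exact joinedWithin_preimage (S := Sᶜ) hφ.adj
  simp only [PlaneGraph.infComp, Set.mem_ofPred_eq, Set.mem_preimage, this]
  rw [← φ.image_symm_eq_preimage, Set.infinite_image_iff φ.symm.injective.injOn]

theorem IsAutomorphism.extStarBoundary (hφ : P.IsAutomorphism φ) (S : Set V) :
    P.extStarBoundary (φ ⁻¹' S) = φ ⁻¹' P.extStarBoundary S := by
  ext v
  simp only [PlaneGraph.extStarBoundary, hφ.infComp, Set.mem_preimage, Set.mem_ofPred_eq]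
  refine and_congr_right fun _ => ⟨?_, ?_⟩
  · rintro ⟨x, hx, hxv⟩
    exact ⟨φ x, hx, (hφ.star _ _).2 hxv⟩
  · rintro ⟨x, hx, hxv⟩
    exact ⟨φ.symm x, by simpa using hx, (hφ.star _ _).1 (by simpa using hxv)⟩

theorem IsAutomorphism.isFree (hφ : P.IsAutomorphism φ) {v : V} :
    P.IsFree (φ ⁻¹' A) v ↔ P.IsFree A (φ v) := by
  have : P.graph.neighborSet v \ φ ⁻¹' A = φ ⁻¹' (P.graph.neighborSet (φ v) \ A) := by
    ext w
    simp [SimpleGraph.mem_neighborSet, hφ.adj]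
  rw [IsFree, IsFree, this, ← φ.image_symm_eq_preimage (_ \ A),
    Set.ncard_image_of_injective _ φ.symm.injective]
  rfl

theorem IsExposedCluster.preimage (hφ : P.IsAutomorphism φ) (h : P.IsExposedCluster A D) :
    P.IsExposedCluster (φ ⁻¹' A) (φ ⁻¹' D) := by
  have hA : ∀ v w, P.graph.Adj (φ v) w → P.graph.Adj v (φ.symm w) := by
    intro v w h
    rw [← hφ.adj]
    simpa using h
  refine ⟨fun u hu w hw huw => h.mem_of_adj _ hu _ hw ((hφ.star _ _).2 huw),
    Set.preimage_mono h.subset, ?_, ?_⟩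
  · intro v hv u hu u' hu' hvu hvu' a b hab hva hvb ha hb hall
    rw [hφ.extStarBoundary] at hv
    refine h.one (φ v) hv (φ u) hu (φ u') hu' ((hφ.adj _ _).2 hvu) ((hφ.adj _ _).2 hvu') (φ a) (φ b)
      (φ.injective.ne hab) ((hφ.adj _ _).2 hva) ((hφ.adj _ _).2 hvb) ha hb fun w hw => ?_
    have := hall (φ.symm w) (hA _ _ hw)
    rw [joinedWithin_preimage hφ.star, joinedWithin_preimage hφ.star, φ.apply_symm_apply] at this
    simpa only [φ.symm_apply_eq] using this
  · intro v hv v' hv' hvv u hu u' hu' b b' hb hb' hvb hvb' hbA hbA' hall hall'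
    rw [hφ.extStarBoundary] at hv hv'
    refine h.two (φ v) hv (φ v') hv' ((hφ.adj _ _).2 hvv) (φ u) hu (φ u') hu' (φ b) (φ b')
      (φ.injective.ne hb) (φ.injective.ne hb') ((hφ.adj _ _).2 hvb) ((hφ.adj _ _).2 hvb') hbA hbA'
      (fun w hw => ?_) fun w hw => ?_
    · have := hall (φ.symm w) (hA _ _ hw)
      rw [joinedWithin_preimage hφ.star, φ.apply_symm_apply] at this
      simpa only [φ.symm_apply_eq] using this
    · have := hall' (φ.symm w) (hA _ _ hw)
      rw [joinedWithin_preimage hφ.star, φ.apply_symm_apply] at this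
      simpa only [φ.symm_apply_eq] using this

/-- If the leftmost point of an exposed cluster in some row is not to the right of the leftmost
point in the next row, then the row contains a free vertex of the exterior boundary. -/
def HasFreeRows (P : PlaneGraph V) (row X : V → ℤ) : Prop :=
  ∀ A D : Set V, P.IsExposedCluster A D → ∀ p ∈ D, (∀ q ∈ D, row q = row p → X p ≤ X q) →
    (∀ q ∈ D, row q = row p + 1 → X p ≤ X q) →
      ∃ v, P.IsFree A v ∧ v ∈ P.extStarBoundary D ∧ row v = row p

/-- A reflection turns the comparison with the next row into one with the previous row, and a swap
of coordinates turns rows into columns, so each lattice needs only one case analysis. -/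
theorem HasFreeRows.comp {row X : V → ℤ} (h : P.HasFreeRows row X) (hφ : P.IsAutomorphism φ) :
    P.HasFreeRows (row ∘ φ) (X ∘ φ) := by
  intro A D hAD p hp h1 h2
  have hψ : P.IsAutomorphism φ.symm :=
    ⟨fun u v => by rw [← hφ.adj]; simp, fun u v => by rw [← hφ.star]; simp⟩
  obtain ⟨v, hv1, hv2, hv3⟩ := h (φ.symm ⁻¹' A) (φ.symm ⁻¹' D) (hAD.preimage hψ) (φ p)
    (by simpa using hp) (fun q hq hr => by simpa using h1 _ hq (by simpa using hr))
    (fun q hq hr => by simpa using h2 _ hq (by simpa using hr))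
  rw [hψ.isFree] at hv1
  rw [hψ.extStarBoundary] at hv2
  exact ⟨φ.symm v, hv1, hv2, by simpa using hv3⟩

-- For an occupied row `b`, either its leftmost point is not to the right of that of row `b + 1`,
-- and row `b` is good; or row `b + 1` reaches further to the left, and it is good by the reflected
-- statement. So every occupied row is good or lies just below a good one, and at least half as many
-- rows are good as are occupied.
open scoped Classical in
theorem exists_free_of_rows {row X : V → ℤ} {r : ℤ} (h : P.HasFreeRows row X)
    (h' : P.HasFreeRows (fun v => r - row v) X) (hAD : P.IsExposedCluster A D) (hD : D.Finite) :
    ∃ B : Finset V, (∀ v ∈ B, P.IsFree A v ∧ v ∈ P.extStarBoundary D) ∧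
      (hD.toFinset.image row).card ≤ 2 * B.card := by
  set W := hD.toFinset.image row with hW
  set G := W.filter fun b => ∃ v, P.IsFree A v ∧ v ∈ P.extStarBoundary D ∧ row v = b with hG
  have hmin : ∀ b ∈ W, ∃ p ∈ D, row p = b ∧ ∀ q ∈ D, row q = b → X p ≤ X q := by
    intro b hb
    obtain ⟨p₀, hp₀, rfl⟩ := Finset.mem_image.1 hb
    obtain ⟨p, hp, hpm⟩ := (hD.toFinset.filter fun q => row q = row p₀).exists_min_image X
      ⟨p₀, by simpa using hp₀⟩
    simp only [Finset.mem_filter, hD.mem_toFinset, and_imp] at hp hpm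
    exact ⟨p, hp.1, hp.2, hpm⟩
  have hWG : W ⊆ G ∪ G.image fun b => b - 1 := by
    intro b hb
    obtain ⟨p, hp, hpb, hpm⟩ := hmin b hb
    by_cases hgood : ∀ q ∈ D, row q = b + 1 → X p ≤ X q
    · obtain ⟨v, h1, h2, h3⟩ := h A D hAD p hp (by rwa [hpb]) (by rwa [hpb])
      exact Finset.mem_union_left _ (Finset.mem_filter.2 ⟨hb, v, h1, h2, h3.trans hpb⟩)
    · push Not at hgood
      obtain ⟨q₀, hq₀, hq₀b, hlt⟩ := hgood
      have hb1 : b + 1 ∈ W := Finset.mem_image.2 ⟨q₀, by simpa using hq₀, hq₀b⟩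
      obtain ⟨q, hq, hqb, hqm⟩ := hmin (b + 1) hb1
      obtain ⟨v, h1, h2, h3⟩ := h' A D hAD q hq
        (fun z hz hzr => hqm z hz (by linarith))
        (fun z hz hzr => by
          have := hpm z hz (by linarith)
          have := hqm q₀ hq₀ hq₀b
          linarith)
      exact Finset.mem_union_right _ (Finset.mem_image.2 ⟨b + 1, Finset.mem_filter.2
        ⟨hb1, v, h1, h2, by linarith⟩, by ring⟩)
  have hch : ∀ b : G, ∃ v, P.IsFree A v ∧ v ∈ P.extStarBoundary D ∧ row v = b := fun b =>
    (Finset.mem_filter.1 b.2).2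
  choose f hf1 hf2 hf3 using hch
  have hinj : Function.Injective f := fun b b' hbb =>
    Subtype.ext (by rw [← hf3 b, ← hf3 b', hbb])
  refine ⟨Finset.univ.image f, ?_, ?_⟩
  · intro v hv
    obtain ⟨b, -, rfl⟩ := Finset.mem_image.1 hv
    exact ⟨hf1 b, hf2 b⟩
  · rw [Finset.card_image_of_injective _ hinj, Finset.card_univ, Fintype.card_coe]
    have h1 := Finset.card_le_card hWG
    have h2 := Finset.card_union_le G (G.image fun b => b - 1)
    have h3 : (G.image fun b => b - 1).card ≤ G.card := Finset.card_image_le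
    omega

/-- An exposed cluster has many free vertices on its exterior boundary, counted by the rows or by
the columns that it meets. -/
theorem exists_free_of_rows_columns {row X : V → ℤ} {r : ℤ} {τ : V ≃ V} {K : ℕ}
    (h : P.HasFreeRows row X) (h' : P.HasFreeRows (fun v => r - row v) X) (hτ : P.IsAutomorphism τ)
    (hK : ∀ E : Finset V, E.card ≤ K * ((E.image row).card * (E.image (row ∘ τ)).card))
    (hAD : P.IsExposedCluster A D) (hD : D.Finite) :
    ∃ B : Finset V, (∀ v ∈ B, P.IsFree A v ∧ v ∈ P.extStarBoundary D) ∧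
      D.ncard ≤ K * (2 * B.card) ^ 2 := by
  obtain ⟨B₁, hB₁, h1⟩ := exists_free_of_rows h h' hAD hD
  obtain ⟨B₂, hB₂, h2⟩ := exists_free_of_rows (h.comp hτ) (h'.comp hτ) hAD hD
  have h3 := hK hD.toFinset
  rw [Set.ncard_eq_toFinset_card D hD]
  -- The larger of the row and column families bounds both factors of the product.
  rcases le_total B₁.card B₂.card with hle | hle
  · refine ⟨B₂, hB₂, h3.trans (Nat.mul_le_mul_left _ ?_)⟩
    rw [pow_two]
    exact Nat.mul_le_mul (h1.trans (by omega)) h2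
  · refine ⟨B₁, hB₁, h3.trans (Nat.mul_le_mul_left _ ?_)⟩
    rw [pow_two]
    exact Nat.mul_le_mul h1 (h2.trans (by omega))

end PlaneGraph

/-! ### From local properties of a lattice to the estimates -/

/-- The estimates for interlocked clusters, from the local properties of the lattice. -/
theorem RotationSystem.main {V F : Type} [DecidableEq V] [DecidableEq F] {P : PlaneGraph V}
    {d g : ℕ} [NeZero d] (T : RotationSystem P d g F) {ν κ K : ℕ} (hP : P.OneEnded)
    (hν : T.GrowthBound ν) (hν1 : 1 ≤ ν) (hκ : g * d = 2 * ν + κ + 2 * d) (hκ6 : κ ≤ 6)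
    (hbr : T.HasBridges κ) {row X : V → ℤ} {r : ℤ} {τ : V ≃ V}
    (h : P.HasFreeRows row X) (h' : P.HasFreeRows (fun v => r - row v) X) (hτ : P.IsAutomorphism τ)
    (hK : ∀ E : Finset V, E.card ≤ K * ((E.image row).card * (E.image (row ∘ τ)).card))
    {c : ℝ} (hc0 : 0 < c) (hc1 : c ≤ 1) :
    ∃ c' : ℝ, 0 < c' ∧ ∀ A : Set V, A.Finite → ∀ D : Set V, P.IsInterlockedCluster A D →
      ∀ x ∈ P.extStarBoundary D, ∀ y ∈ P.extStarBoundary D,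
        ∃ η : P.graph.Walk x y, (∀ v ∈ η.support, v ∉ A) ∧
          ((P.edgeRange η).ncard : ℝ) - c * ({e ∈ P.edgeRange η | P.IsFree A e.fst}.ncard : ℝ) ≤
            ν * D.ncard + 4 ∧
          (P.IsExposed A D →
            ((P.edgeRange η).ncard : ℝ) - c * ({e ∈ P.edgeRange η | P.IsFree A e.fst}.ncard : ℝ) ≤
              ν * D.ncard - c' * √D.ncard + 4) := by
  have hd : 0 < d := Nat.pos_of_ne_zero (NeZero.ne d)
  have hdg : (0 : ℝ) < d * g + 2 := by positivity
  -- Chosen to satisfy both `2 * ε ≤ c` and `ε * (d * g) ≤ c ≤ 1 ≤ ν`.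
  set ε : ℝ := c / (d * g + 2) with hε
  have hε0 : 0 < ε := by positivity
  have hεm : ε * (d * g + 2) = c := div_mul_cancel₀ _ hdg.ne'
  have hεd : 0 ≤ ε * (d * g) := by positivity
  have hεc : 2 * ε ≤ c := by linarith
  have hν1' : (1 : ℝ) ≤ ν := by exact_mod_cast hν1
  have hεν : ε * (d * g) ≤ ν := by linarith
  have hκ6' : (κ : ℝ) ≤ 6 := by exact_mod_cast hκ6
  have base : ∀ A : Set V, A.Finite → ∀ D : Set V, P.IsInterlockedCluster A D →
      ∀ x ∈ P.extStarBoundary D, ∀ y ∈ P.extStarBoundary D,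
        ∃ η : P.graph.Walk x y, (∀ v ∈ η.support, v ∉ A) ∧
          ((P.edgeRange η).ncard : ℝ) - c * ({e ∈ P.edgeRange η | P.IsFree A e.fst}.ncard : ℝ) ≤
            ν * D.ncard + 4 := by
    intro A hA D hD x hx y hy
    obtain ⟨η, h1, h2⟩ := T.exists_walk_of_free hP hν hκ hbr hA hD hx hy hc0.le hc1 hε0.le hεc hεν
      (B := ∅) (by simp)
    refine ⟨η, h1, h2.trans ?_⟩
    rw [Finset.card_empty]
    push_cast
    linarith
  -- The constant comes from `√|D| ≤ (K + 1) * (2 * |B|)`, so that the gain `ε * |B|` dominates.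
  refine ⟨ε / (2 * (K + 1)), by positivity, fun A hA D hD x hx y hy => ?_⟩
  by_cases hex : P.IsExposed A D
  · obtain ⟨z, hz, hzA⟩ := hex
    -- One boundary vertex lies in the infinite component of the complement of `A`. The walks of the
    -- basic estimate avoid `A` and carry this over to the whole exterior boundary.
    have hinf : P.extStarBoundary D ⊆ P.infComp A := by
      intro v hv
      obtain ⟨η, hη, -⟩ := base A hA D hD z hz v hv
      exact PlaneGraph.infComp_of_joined ⟨η, hη⟩ hzA
    obtain ⟨B, hB, hBn⟩ := PlaneGraph.exists_free_of_rows_columns h h' hτ hK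
      (hD.isExposedCluster hinf) (hA.subset hD.subset)
    obtain ⟨η, h1, h2⟩ := T.exists_walk_of_free hP hν hκ hbr hA hD hx hy hc0.le hc1 hε0.le hεc hεν hB
    have hsq : √(D.ncard : ℝ) ≤ (K + 1) * (2 * B.card) := by
      apply Real.sqrt_le_iff.2
      refine ⟨by positivity, ?_⟩
      have : (D.ncard : ℝ) ≤ K * (2 * B.card) ^ 2 := by exact_mod_cast hBn
      refine this.trans ?_
      rw [mul_pow ((K : ℝ) + 1)]
      have hK1 : (K : ℝ) ≤ (K + 1) ^ 2 := by nlinarith [(Nat.cast_nonneg K : (0 : ℝ) ≤ K)]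
      exact mul_le_mul_of_nonneg_right hK1 (sq_nonneg _)
    have hsq' : ε / (2 * (K + 1)) * √(D.ncard : ℝ) ≤ ε * B.card := by
      refine (mul_le_mul_of_nonneg_left hsq (by positivity)).trans (le_of_eq ?_)
      field_simp
    have hB0 : 0 ≤ ε * B.card := by positivity
    exact ⟨η, h1, by linarith, fun _ => by linarith⟩
  · obtain ⟨η, h1, h2⟩ := base A hA D hD x hx y hy
    exact ⟨η, h1, h2, fun h => absurd h hex⟩

/-! ### Potentials and one-endedness over `ℤ × ℤ` -/

theorem exists_int_antiderivative (f : ℤ → ZMod 2) :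
    ∃ G : ℤ → ZMod 2, G 0 = 0 ∧ ∀ n, G (n + 1) = G n + f n := by
  refine ⟨fun n => (∑ i ∈ Finset.range n.toNat, f i) -
    ∑ i ∈ Finset.range (-n).toNat, f (-(i : ℤ) - 1), by simp, fun n => ?_⟩
  rcases lt_or_ge n 0 with hn | hn
  · obtain ⟨m, rfl⟩ : ∃ m : ℕ, n = -((m : ℤ) + 1) := ⟨(-n - 1).toNat, by omega⟩
    have h1 : (-((m : ℤ) + 1) + 1).toNat = 0 := by omega
    have h2 : (-(-((m : ℤ) + 1) + 1)).toNat = m := by omega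
    have h3 : (-((m : ℤ) + 1)).toNat = 0 := by omega
    have h4 : (-(-((m : ℤ) + 1))).toNat = m + 1 := by omega
    simp only [h1, h2, h3, h4, Finset.sum_range_succ, Finset.range_zero, Finset.sum_empty]
    have : -(m : ℤ) - 1 = -((m : ℤ) + 1) := by ring
    rw [this]
    ring
  · obtain ⟨m, rfl⟩ := Int.eq_ofNat_of_zero_le hn
    have h1 : ((m : ℤ) + 1).toNat = m + 1 := by omega
    have h2 : (-((m : ℤ) + 1)).toNat = 0 := by omega
    have h3 : (-(m : ℤ)).toNat = 0 := by omega
    simp only [h1, h2, h3, Int.toNat_natCast, Finset.sum_range_succ, Finset.range_zero,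
      Finset.sum_empty]
    ring

/-- A closed pair of difference functions on `ℤ × ℤ` has a potential. -/
theorem exists_potential (h k : ℤ → ℤ → ZMod 2)
    (hhk : ∀ a b, h a b + k (a + 1) b = k a b + h a (b + 1)) :
    ∃ G : ℤ → ℤ → ZMod 2, ∀ a b, G (a + 1) b = G a b + h a b ∧ G a (b + 1) = G a b + k a b := by
  obtain ⟨H, -, hH⟩ := exists_int_antiderivative fun a => h a 0
  choose K hK0 hK using fun a => exists_int_antiderivative (k a)
  refine ⟨fun a b => H a + K a b, fun a b => ⟨?_, by simp only [hK]; ring⟩⟩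
  beta_reduce
  induction b using Int.induction_on with
  | zero => rw [hK0, hK0, hH]; ring
  | succ b ih =>
    rw [hK, hK]
    linear_combination ih + hhk a b
  | pred b ih =>
    have e := hhk a (-(b : ℤ) - 1)
    have e1 := hK a (-(b : ℤ) - 1)
    have e2 := hK (a + 1) (-(b : ℤ) - 1)
    rw [sub_add_cancel] at e e1 e2
    linear_combination ih - e + e1 - e2

/-- Outside a box, the points of `ℤ × ℤ` are joined by horizontal and vertical steps. -/
theorem joined_outside_box {J : ℤ × ℤ → ℤ × ℤ → Prop} (hrefl : ∀ p, J p p)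
    (hsymm : ∀ p q, J p q → J q p) (htrans : ∀ p q r, J p q → J q r → J p r) {N : ℤ}
    (hN : 0 ≤ N) (hh : ∀ a b, N < |b| → J (a, b) (a + 1, b))
    (hv : ∀ a b, N < |a| → J (a, b) (a, b + 1)) {p q : ℤ × ℤ} (hp : N < |p.1| ∨ N < |p.2|)
    (hq : N < |q.1| ∨ N < |q.2|) : J p q := by
  have row : ∀ b, N < |b| → ∀ a, J (a, b) (0, b) := by
    intro b hb a
    induction a using Int.induction_on with
    | zero => exact hrefl _
    | succ a ih => exact htrans _ _ _ (hsymm _ _ (hh a b hb)) ih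
    | pred a ih =>
      have := hh (-(a : ℤ) - 1) b hb
      rw [sub_add_cancel] at this
      exact htrans _ _ _ this ih
  have col : ∀ a, N < |a| → ∀ b, J (a, b) (a, 0) := by
    intro a ha b
    induction b using Int.induction_on with
    | zero => exact hrefl _
    | succ b ih => exact htrans _ _ _ (hsymm _ _ (hv a b ha)) ih
    | pred b ih =>
      have := hv a (-(b : ℤ) - 1) ha
      rw [sub_add_cancel] at this
      exact htrans _ _ _ this ih
  have hN1 : N < |N + 1| := by rw [abs_of_nonneg (by omega)]; omega
  have key : ∀ p : ℤ × ℤ, N < |p.1| ∨ N < |p.2| → J p (N + 1, N + 1) := by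
    rintro ⟨a, b⟩ (h | h)
    · exact htrans _ _ _ (htrans _ _ _ (col a h b) (hsymm _ _ (col a h (N + 1))))
        (htrans _ _ _ (row _ hN1 a) (hsymm _ _ (row _ hN1 (N + 1))))
    · exact htrans _ _ _ (htrans _ _ _ (row b h a) (hsymm _ _ (row b h (N + 1))))
        (htrans _ _ _ (col _ hN1 b) (hsymm _ _ (col _ hN1 (N + 1))))
  exact htrans _ _ _ (key p hp) (hsymm _ _ (key q hq))

theorem exists_box {V : Type} (f : V → ℤ × ℤ) {E : Set V} (hE : E.Finite) :
    ∃ N : ℤ, 0 ≤ N ∧ ∀ v ∈ E, |(f v).1| ≤ N ∧ |(f v).2| ≤ N := by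
  obtain ⟨N, hN⟩ := (hE.image fun v => |(f v).1| + |(f v).2|).bddAbove
  refine ⟨max N 0, le_max_right _ _, fun v hv => ?_⟩
  have h1 := hN (Set.mem_image_of_mem _ hv)
  have h2 := abs_nonneg (f v).1
  have h3 := abs_nonneg (f v).2
  beta_reduce at h1
  have := le_max_left N 0
  constructor <;> omega

theorem finite_box (N : ℤ) : {p : ℤ × ℤ | |p.1| ≤ N ∧ |p.2| ≤ N}.Finite := by
  refine ((Set.finite_Icc (-N) N).prod (Set.finite_Icc (-N) N)).subset ?_
  rintro ⟨a, b⟩ ⟨h1, h2⟩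
  exact ⟨abs_le.1 h1, abs_le.1 h2⟩

/-- Each vertex belongs to a cell `f v` of `ℤ × ℤ`, and the cells have representatives `s`. Steps
between neighbouring cells stay in one row or one column of cells, so outside a box containing `E`
they reduce to `joined_outside_box`. -/
theorem oneEnded_of_steps {V : Type} {P : PlaneGraph V} (f : V → ℤ × ℤ) (s : ℤ × ℤ → V)
    (hf : ∀ B : Set (ℤ × ℤ), B.Finite → (f ⁻¹' B).Finite)
    (hs : ∀ v (S : Set V), (∀ w, f w = f v → w ∈ S) → JoinedWithin P.graph S v (s (f v)))
    (hh : ∀ a b (S : Set V), (∀ w, (f w).2 = b → w ∈ S) →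
      JoinedWithin P.graph S (s (a, b)) (s (a + 1, b)))
    (hv : ∀ a b (S : Set V), (∀ w, (f w).1 = a → w ∈ S) →
      JoinedWithin P.graph S (s (a, b)) (s (a, b + 1))) : P.OneEnded := by
  intro E hE
  obtain ⟨N, hN0, hN⟩ := exists_box f hE
  refine ⟨_, hf _ (finite_box N), fun u hu w hw => ?_⟩
  have hout : ∀ v, N < |(f v).1| ∨ N < |(f v).2| → v ∈ Eᶜ := by
    intro v hv hvE
    have := hN v hvE
    omega
  have hout' : ∀ v ∉ f ⁻¹' {p : ℤ × ℤ | |p.1| ≤ N ∧ |p.2| ≤ N},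
      N < |(f v).1| ∨ N < |(f v).2| := by
    intro v hv
    simp only [Set.mem_preimage, Set.mem_ofPred_eq] at hv
    omega
  have hj := joined_outside_box (J := fun p q => p = q ∨ JoinedWithin P.graph Eᶜ (s p) (s q))
    (fun p => .inl rfl) (fun p q h => h.imp Eq.symm JoinedWithin.symm)
    (by
      rintro p q r (rfl | h1) (rfl | h2)
      exacts [.inl rfl, .inr h2, .inr h1, .inr (h1.trans h2)]) hN0
    (fun a b hb => .inr (hh a b _ fun w hw => hout w (.inr (by rwa [hw]))))
    (fun a b ha => .inr (hv a b _ fun w hw => hout w (.inl (by rwa [hw]))))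
    (hout' u hu) (hout' w hw)
  have h1 := hs u Eᶜ fun v hv => hout v (by rw [hv]; exact hout' u hu)
  have h2 := hs w Eᶜ fun v hv => hout v (by rw [hv]; exact hout' w hw)
  rcases hj with h | h
  · rw [h] at h1
    exact h1.trans h2.symm
  · exact h1.trans (h.trans h2.symm)

/-! ### Criteria for growth bounds and bridges -/

namespace RotationSystem

variable {V F : Type} [DecidableEq V] [DecidableEq F] {P : PlaneGraph V} {d g : ℕ} [NeZero d]
  (T : RotationSystem P d g F)

/-- A neighbour in `E` makes two faces at `v` touched. So the number m of such neighbours is at most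
the number t of touched faces, and m = 0 if t = 1. As `g ≥ 2`, the quantity g(d - t) + 2m is largest
for t = 1 or for t = m = 2; these are the two numerical hypotheses. -/
theorem growthBound_of_le {ν : ℕ} (hd : 2 ≤ d) (h1 : g * d ≤ 2 * ν + 2 * d + g)
    (h2 : g * d + 4 ≤ 2 * ν + 2 * d + 2 * g) (hg : 2 ≤ g) : T.GrowthBound ν := by
  intro E v _ ⟨k₀, hk₀⟩
  set τ := (Finset.univ.filter fun k => T.left v k ∈ T.touched E) with hτ
  set m := (Finset.univ.filter fun k => T.nbr v k ∈ E) with hm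
  have hadd : τ.card + (Finset.univ.filter fun k => T.left v k ∉ T.touched E).card = d := by
    have := Finset.card_filter_add_card_filter_not (s := (Finset.univ : Finset (Fin d)))
      (fun k => T.left v k ∈ T.touched E)
    rwa [Finset.card_univ, Fintype.card_fin] at this
  set u := (Finset.univ.filter fun k => T.left v k ∉ T.touched E).card
  have hsub : m ⊆ τ := fun k hk => by
    simp only [hm, hτ, Finset.mem_filter, Finset.mem_univ, true_and] at hk ⊢
    exact T.left_mem_touched_of_nbr hk
  have hle := Finset.card_le_card hsub
  have hτ1 : 1 ≤ τ.card := Finset.card_pos.2 ⟨k₀, by simpa [hτ] using hk₀⟩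
  have e : g * u + g * τ.card = g * d := by rw [← Nat.mul_add, add_comm, hadd]
  rcases Nat.lt_or_ge τ.card 2 with hlt | hge
  · have hm0 : m.card = 0 := by
      rw [Finset.card_eq_zero, Finset.eq_empty_iff_forall_notMem]
      intro k hk
      have hk1 := hsub hk
      have hk2 : k - 1 ∈ τ := by
        simp only [hm, hτ, Finset.mem_filter, Finset.mem_univ, true_and] at hk ⊢
        exact T.left_mem_touched_of_nbr_succ (by rwa [sub_add_cancel])
      have := Finset.card_le_one.1 (by omega : τ.card ≤ 1) _ hk1 _ hk2
      have h10 : (1 : Fin d) = 0 := by simpa using this.symm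
      have : (1 : Fin d).val = (0 : Fin d).val := by rw [h10]
      rw [Fin.val_one', Nat.mod_eq_of_lt (by omega)] at this
      simp at this
    have hτ' : τ.card = 1 := by omega
    rw [hτ'] at e
    omega
  · obtain ⟨t, ht⟩ : ∃ t, τ.card = t + 2 := ⟨τ.card - 2, by omega⟩
    rw [ht] at e hle
    have : 2 * t ≤ g * t := Nat.mul_le_mul_right _ hg
    have e' : g * (t + 2) = g * t + 2 * g := by ring
    omega

theorem ncard_neighborSet_diff (S : Set V) [DecidablePred (· ∈ S)] (v : V) :
    (P.graph.neighborSet v \ S).ncard = (Finset.univ.filter fun k => T.nbr v k ∉ S).card := by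
  rw [← Finset.card_image_of_injective _ (T.nbr_injective v), ← Set.ncard_coe_finset]
  congr 1
  ext w
  simp only [Set.mem_sdiff, SimpleGraph.mem_neighborSet, T.adj_iff, Finset.coe_image,
    Finset.coe_filter, Finset.mem_univ, true_and, Set.mem_image, Set.mem_ofPred_eq]
  constructor
  · rintro ⟨⟨k, rfl⟩, h⟩
    exact ⟨k, h, rfl⟩
  · rintro ⟨k, h, rfl⟩
    exact ⟨⟨k, rfl⟩, h⟩

theorem star_of_cofacial {u w : V} {f : F} (hne : u ≠ w) (hu : ∃ k, T.left u k = f)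
    (hw : ∃ k, T.left w k = f) : P.starGraph.Adj u w := by
  obtain ⟨k, hk⟩ := hu
  obtain ⟨l, hl⟩ := hw
  exact (T.starAdj_iff _ _).2 ⟨hne, k, l, hk.trans hl.symm⟩

/-- If a cyclic sequence has the colours `1` and `2` never next to each other, and the colour `0`
just twice, then it consists of one block of each of the colours `1` and `2`. -/
def HasTwoBlocks (d : ℕ) [NeZero d] : Prop :=
  ∀ col : Fin d → Fin 3, (Finset.univ.filter fun k => col k = 0).card = 2 → (∃ k, col k = 1) →
    (∃ k, col k = 2) → (∀ k, ¬ (col k = 1 ∧ col (k + 1) = 2) ∧ ¬ (col k = 2 ∧ col (k + 1) = 1)) →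
    ∃ k₁ k₂, k₁ ≠ k₂ ∧ col k₁ = 0 ∧ col k₂ = 0 ∧ (∀ k, col k = 0 → k = k₁ ∨ k = k₂) ∧
      col (k₁ + 1) = 2 ∧ col (k₁ - 1) = 1 ∧ col (k₂ + 1) = 1 ∧ col (k₂ - 1) = 2

/-- The neighbours of `x` are coloured by membership in `C`, in `C'` or in neither. Consecutive
neighbours share a face, so the first two colours are never next to each other; the two uncoloured
neighbours then separate one block of each and are the outer ends of the bridge. -/
theorem exists_bridge_of_common {κ : ℕ} (hκ : κ = 4) (hd : HasTwoBlocks d) {C C' : Finset V}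
    (hdis : Disjoint C C') (hst : ∀ a ∈ C, ∀ b ∈ C', ¬ P.starGraph.Adj a b) {x : V}
    (hx : x ∈ P.infComp (C ∪ C')) (h2 : (P.graph.neighborSet x \ (C ∪ C')).ncard = 2)
    (hC : (P.graph.neighborSet x ∩ C).Nonempty) (hC' : (P.graph.neighborSet x ∩ C').Nonempty) :
    ∃ i₁ k₁ i₂ k₂, T.IsBridge κ C C' i₁ k₁ i₂ k₂ := by
  classical
  rw [Finset.disjoint_left] at hdis
  have hsep : ∀ a ∈ C, ∀ b ∈ C', ∀ f, (∃ k, T.left a k = f) → ¬ ∃ k, T.left b k = f :=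
    fun a ha b hb f hfa hfb => hst a ha b hb
      (T.star_of_cofacial (fun h => hdis ha (h ▸ hb)) hfa hfb)
  set col : Fin d → Fin 3 := fun k => if T.nbr x k ∈ C then 1 else if T.nbr x k ∈ C' then 2 else 0
    with hcol
  have c1 : ∀ k, col k = 1 ↔ T.nbr x k ∈ C := by
    intro k; simp only [hcol]; split_ifs <;> simp_all
  have c2 : ∀ k, col k = 2 ↔ T.nbr x k ∈ C' := by
    intro k
    have := @hdis (T.nbr x k)
    simp only [hcol]; split_ifs <;> simp_all
  have c0 : ∀ k, col k = 0 ↔ T.nbr x k ∉ C ∪ C' := by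
    intro k; simp only [hcol]; split_ifs <;> simp_all
  rw [T.ncard_neighborSet_diff] at h2
  obtain ⟨k₁, k₂, hne, z1, z2, hall, a1, a2, a3, a4⟩ := hd col (by
      rw [← h2]
      congr 1
      ext k
      simp [c0])
    (by
      obtain ⟨w, hw, hwC⟩ := hC
      obtain ⟨k, rfl⟩ := (T.adj_iff _ _).1 hw
      exact ⟨k, (c1 k).2 hwC⟩)
    (by
      obtain ⟨w, hw, hwC⟩ := hC'
      obtain ⟨k, rfl⟩ := (T.adj_iff _ _).1 hw
      exact ⟨k, (c2 k).2 hwC⟩)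
    (by
      intro k
      rw [c1, c2, c1, c2]
      exact ⟨fun ⟨h, h'⟩ => hsep _ h _ h' _ (T.left_nbr x k) (T.left_nbr_succ x k),
        fun ⟨h, h'⟩ => hsep _ h' _ h _ (T.left_nbr_succ x k) (T.left_nbr x k)⟩)
  rw [c2] at a1 a4
  rw [c1] at a2 a3
  have f1 := T.left_mem_touched_of_nbr a2
  have f2 := T.left_mem_touched_of_nbr_succ a1
  have f3 := T.left_mem_touched_of_nbr_succ a3
  have f4 := T.left_mem_touched_of_nbr a4
  have hleft : ∀ k, T.left x k ∈ T.touched (C ∪ C') := by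
    intro k
    by_cases hk : T.nbr x k ∈ C ∪ C'
    · exact T.left_mem_touched_of_nbr hk
    · rw [T.touched_union, Finset.mem_union]
      rcases hall k ((c0 k).2 hk) with rfl | rfl
      exacts [.inr f2, .inl f3]
  have hnb : ∀ k, T.nbr x k ∈ C ∪ C' ∨ k = k₁ ∨ k = k₂ := by
    intro k
    by_cases hk : T.nbr x k ∈ C ∪ C'
    exacts [.inl hk, .inr (hall k ((c0 k).2 hk))]
  exact ⟨x, k₁, x, k₂, hx, hx, .inl ⟨rfl, hne, hκ⟩, (c0 _).1 z1, (c0 _).1 z2, hleft, hleft,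
    fun k => (hnb k).imp_right (Or.imp_right fun h => .inr ⟨rfl, h⟩),
    fun k => (hnb k).imp_right fun h => h.symm.imp_right fun h => .inr ⟨rfl, h⟩, f1, f2, f3, f4⟩

end RotationSystem

set_option maxRecDepth 100000 in
theorem hasTwoBlocks_four : RotationSystem.HasTwoBlocks 4 := by
  unfold RotationSystem.HasTwoBlocks; decide +kernel
set_option maxRecDepth 100000 in
theorem hasTwoBlocks_six : RotationSystem.HasTwoBlocks 6 := by
  unfold RotationSystem.HasTwoBlocks; decide +kernel

/-! ### The square lattice -/

theorem squareLattice_adj (a b c e : ℤ) : squareLattice.graph.Adj (a, b) (c, e) ↔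
    (c = a + 1 ∧ e = b) ∨ (c = a - 1 ∧ e = b) ∨ (c = a ∧ e = b + 1) ∨ (c = a ∧ e = b - 1) := by
  simp only [squareLattice, Prod.mk_sub_mk, Set.mem_insert_iff, Set.mem_singleton_iff,
    Prod.mk.injEq]
  omega

/-- The square lattice as a rotation system; a face is named by its lower left corner. -/
def squareRotation : RotationSystem squareLattice 4 4 (ℤ × ℤ) where
  nbr v k := ![(v.1 + 1, v.2), (v.1, v.2 + 1), (v.1 - 1, v.2), (v.1, v.2 - 1)] k
  rev _ k := k + 2
  left v k := ![(v.1, v.2), (v.1 - 1, v.2), (v.1 - 1, v.2 - 1), (v.1, v.2 - 1)] k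
  faceDarts f := {((f.1, f.2), 0), ((f.1 + 1, f.2), 1), ((f.1 + 1, f.2 + 1), 2),
    ((f.1, f.2 + 1), 3)}
  adj_iff := by
    rintro ⟨a, b⟩ ⟨c, e⟩
    rw [squareLattice_adj]
    simp only [Fin.exists_fin_succ, Prod.ext_iff]
    simp
    omega
  nbr_injective := by
    rintro ⟨a, b⟩ k l h
    fin_cases k <;> fin_cases l <;> simp at h ⊢ <;> omega
  left_injective := by
    rintro ⟨a, b⟩ k l h
    fin_cases k <;> fin_cases l <;> simp at h ⊢ <;> omega
  nbr_rev := by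
    rintro ⟨a, b⟩ k
    fin_cases k <;> simp
  left_rev := by
    rintro ⟨a, b⟩ k
    fin_cases k <;> simp
  cofacial_iff := by
    rintro ⟨a, b⟩ ⟨c, e⟩
    simp only [squareLattice, Set.mem_ofPred_eq]
    constructor
    · rintro ⟨f, ⟨i, j, rfl⟩, h, h'⟩
      have key : ∀ x : ℤ × ℤ, x ∈ ({(i, j), (i + 1, j), (i + 1, j + 1), (i, j + 1)} : Set (ℤ × ℤ)) →
          ∃ k : Fin 4, ![(x.1, x.2), (x.1 - 1, x.2), (x.1 - 1, x.2 - 1), (x.1, x.2 - 1)] k =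
            (i, j) := by
        rintro x (rfl | rfl | rfl | rfl)
        exacts [⟨0, by simp⟩, ⟨1, by simp⟩, ⟨2, by simp⟩, ⟨3, by simp⟩]
      obtain ⟨k, hk⟩ := key _ h
      obtain ⟨l, hl⟩ := key _ h'
      exact ⟨k, l, hk.trans hl.symm⟩
    · rintro ⟨k, l, h⟩
      have key : ∀ (x : ℤ × ℤ) (k : Fin 4) (f : ℤ × ℤ),
          ![(x.1, x.2), (x.1 - 1, x.2), (x.1 - 1, x.2 - 1), (x.1, x.2 - 1)] k = f →
          x ∈ ({(f.1, f.2), (f.1 + 1, f.2), (f.1 + 1, f.2 + 1), (f.1, f.2 + 1)} :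
            Set (ℤ × ℤ)) := by
        rintro ⟨x, y⟩ k f rfl
        fin_cases k <;> simp
      exact ⟨_, ⟨_, _, rfl⟩, key _ k _ h, key _ l _ rfl⟩
  mem_faceDarts := by
    rintro ⟨i, j⟩ ⟨⟨a, b⟩, k⟩
    fin_cases k <;> simp [Prod.ext_iff] <;> omega
  card_faceDarts := by
    rintro ⟨i, j⟩
    rw [Finset.card_insert_of_notMem, Finset.card_insert_of_notMem, Finset.card_insert_of_notMem,
      Finset.card_singleton] <;> simp
  face_connected := by
    rintro ⟨i, j⟩ Q hQ
    have h0 := hQ (i, j) 0 (by simp)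
    have h1 := hQ (i + 1, j) 1 (by simp)
    have h2 := hQ (i + 1, j + 1) 2 (by simp)
    have key : ∀ v k, ![(v.1, v.2), (v.1 - 1, v.2), (v.1 - 1, v.2 - 1), (v.1, v.2 - 1)] k = (i, j) →
        (Q v ↔ Q (i, j)) := by
      rintro ⟨a, b⟩ k h
      fin_cases k <;> simp at h h0 h1 h2 <;> obtain ⟨rfl, rfl⟩ := h <;> simp_all
    intro v k w l hv hw h
    exact (key w l hw).2 ((key v k hv).1 h)
  exact := by
    intro o ho
    have two : ∀ x : ZMod 2, x + x = 0 := by decide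
    have e0 : ∀ a b : ℤ, o (a, b) (a, b) + o (a + 1, b) (a, b) =
        o (a, b) (a, b - 1) + o (a + 1, b) (a, b - 1) := fun a b => by simpa using ho (a, b) 3
    have e1 : ∀ a b : ℤ, o (a, b) (a - 1, b) + o (a, b + 1) (a - 1, b) =
        o (a, b) (a, b) + o (a, b + 1) (a, b) := fun a b => by simpa using ho (a, b) 0
    -- The horizontal and vertical differences are both read at the face `(a, b)`. They are closed
    -- because the cocycle relations `e0` and `e1` move them to the neighbouring faces.
    obtain ⟨G, hG⟩ := exists_potential
      (fun a b => o (a, b) (a, b) + o (a + 1, b) (a, b))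
      (fun a b => o (a, b) (a, b) + o (a, b + 1) (a, b)) (by
        intro a b
        have h1 := e1 (a + 1) b
        have h2 := e0 a (b + 1)
        rw [add_sub_cancel_right] at h1 h2
        linear_combination two (o (a + 1, b) (a, b)) - h1 - h2 - two (o (a, b + 1) (a, b)))
    have g0 : ∀ a b, G a b + G (a + 1) b = o (a, b) (a, b) + o (a + 1, b) (a, b) := fun a b => by
      linear_combination (hG a b).1 + two (G a b)
    have g1 : ∀ a b, G a b + G a (b + 1) = o (a, b) (a, b) + o (a, b + 1) (a, b) := fun a b => by
      linear_combination (hG a b).2 + two (G a b)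
    refine ⟨fun v => G v.1 v.2, ?_⟩
    rintro ⟨a, b⟩ k
    have h2 := g0 (a - 1) b
    have h2' := e0 (a - 1) b
    have h3 := g1 a (b - 1)
    have h3' := e1 a (b - 1)
    rw [sub_add_cancel] at h2 h2' h3 h3'
    fin_cases k
    · simpa using g0 a b
    · have := g1 a b
      simp
      linear_combination this - e1 a b
    · simp
      linear_combination h2 + h2'
    · simp
      linear_combination h3

theorem squareLattice_star (a b c e : ℤ) : squareLattice.starGraph.Adj (a, b) (c, e) ↔
    (a ≠ c ∨ b ≠ e) ∧ a - 1 ≤ c ∧ c ≤ a + 1 ∧ b - 1 ≤ e ∧ e ≤ b + 1 := by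
  rw [squareRotation.starAdj_iff]
  simp only [squareRotation, Fin.exists_fin_succ, Prod.ext_iff]
  simp
  omega

theorem squareLattice_oneEnded : squareLattice.OneEnded := by
  refine oneEnded_of_steps id id (fun B hB => hB) (fun v S h => .refl (h v rfl)) ?_ ?_
  · intro a b S h
    exact .of_adj ((squareLattice_adj _ _ _ _).2 (.inl ⟨rfl, rfl⟩)) (h _ rfl) (h _ rfl)
  · intro a b S h
    exact .of_adj ((squareLattice_adj _ _ _ _).2 (.inr (.inr (.inl ⟨rfl, rfl⟩)))) (h _ rfl) (h _ rfl)

theorem squareRotation_growthBound : squareRotation.GrowthBound 2 :=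
  squareRotation.growthBound_of_le (by norm_num) (by norm_num) (by norm_num) (by norm_num)

theorem eq_of_two_of_four : ∀ (p : Fin 4 → Bool) (j : Fin 4),
    (Finset.univ.filter fun k => p k).card = 2 → p j →
      (¬ p (j + 1) ∧ ¬ p (j + 2) ∧ p (j + 3)) ∨ (p (j + 1) ∧ ¬ p (j + 2) ∧ ¬ p (j + 3)) ∨
        (¬ p (j + 1) ∧ p (j + 2) ∧ ¬ p (j + 3)) := by
  decide

/-- In the second kind of interlocking the vertex `x` alone is already a bridge: its outer
neighbours are `y` and a vertex next to it in cyclic order, and the face between these two also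
carries a neighbour of `y` in `C'`. -/
theorem RotationSystem.hasBridges_four {V F : Type} [DecidableEq V] [DecidableEq F]
    {P : PlaneGraph V} {g : ℕ} (T : RotationSystem P 4 g F)
    (hL : ∀ x j, T.left (T.nbr x j) (j + 1) = T.left x j)
    (hL' : ∀ x j, T.left (T.nbr x j) (j + 2) = T.left x (j + 3))
    (hback : ∀ x j, T.nbr (T.nbr x j) (j + 2) = x) : T.HasBridges 4 := by
  classical
  rintro C C' hdis ⟨hst, ⟨x, hx, h2, hC, hC'⟩ | ⟨x, hx, y, hy, hxy, ⟨h1, h1'⟩, h2, h2'⟩⟩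
  · exact T.exists_bridge_of_common rfl hasTwoBlocks_four hdis hst hx h2 hC hC'
  obtain ⟨j, rfl⟩ := (T.adj_iff _ _).1 hxy
  have hx' := infComp_notMem hx
  have hy' := infComp_notMem hy
  rw [T.ncard_neighborSet_diff] at h1 h2
  simp only [Finset.mem_coe] at h1 h2
  have hC' : ∀ k, T.nbr x k ∉ C' := fun k hk =>
    Set.notMem_empty _ (h1'.subset ⟨T.adj_nbr x k, hk⟩)
  have hsep : ∀ a ∈ C, ∀ b ∈ C', ∀ f, (∃ k, T.left a k = f) → ¬ ∃ k, T.left b k = f :=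
    fun a ha b hb f hfa hfb => hst a ha b hb
      (T.star_of_cofacial (fun h => Finset.disjoint_left.1 hdis ha (h ▸ hb)) hfa hfb)
  have e1 := eq_of_two_of_four (fun k => decide (T.nbr x k ∉ C)) j (by simpa using h1)
    (by simpa using fun h => hy' (.inl h))
  have e2 := eq_of_two_of_four (fun k => decide (T.nbr (T.nbr x j) k ∉ C')) (j + 2)
    (by simpa using h2) (by rw [hback]; simpa using fun h => hx' (.inr h))
  have a1 : ∀ j : Fin 4, j + 2 + 1 = j + 3 := by decide
  have a2 : ∀ j : Fin 4, j + 2 + 2 = j := by decide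
  have a3 : ∀ j : Fin 4, j + 2 + 3 = j + 1 := by decide
  have a4 : ∀ j : Fin 4, j + 3 - 1 = j + 2 := by decide
  have a5 : ∀ j : Fin 4, j - 1 = j + 3 := by decide
  have a6 : ∀ j k : Fin 4, k = j ∨ k = j + 1 ∨ k = j + 2 ∨ k = j + 3 := by decide
  have a7 : ∀ j : Fin 4, j ≠ j + 3 ∧ j ≠ j + 1 := by decide
  rw [a1, a2, a3] at e2
  simp only [decide_eq_true_eq, not_not] at e1 e2
  have s1 : T.nbr x (j + 1) ∈ C → T.nbr (T.nbr x j) (j + 1) ∉ C' := fun h h' =>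
    hsep _ h _ h' _ (T.left_nbr_succ x j) (by rw [← hL]; exact T.left_nbr _ _)
  have s3 : T.nbr x (j + 3) ∈ C → T.nbr (T.nbr x j) (j + 3) ∉ C' := fun h h' =>
    hsep _ h _ h' _ (T.left_nbr x (j + 3)) (by
      rw [← hL', ← a1]; exact T.left_nbr_succ _ _)
  have hj : T.nbr x j ∉ C ∪ C' := fun h => hy' (by simpa using h)
  have hm : ∀ {f}, f ∈ T.touched C → f ∈ T.touched (C ∪ C') := fun h => by
    rw [T.touched_union]; exact Finset.mem_union_left _ h
  have hm' : ∀ {f}, f ∈ T.touched C' → f ∈ T.touched (C ∪ C') := fun h => by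
    rw [T.touched_union]; exact Finset.mem_union_right _ h
  rcases e1 with ⟨p1, p2, p3⟩ | ⟨p1, p2, p3⟩ | ⟨p1, p2, p3⟩
  · have q : T.nbr (T.nbr x j) (j + 3) ∈ C' := by
      rcases e2 with e | e | e
      exacts [e.1, absurd e.2.2 (s1 p1), e.1]
    have t0 : T.left x j ∈ T.touched C := T.left_mem_touched_of_nbr_succ p1
    have t1 : T.left x (j + 1) ∈ T.touched C := T.left_mem_touched_of_nbr p1
    have t2 : T.left x (j + 2) ∈ T.touched C := T.left_mem_touched_of_nbr p2
    have t3 : T.left x (j + 3) ∈ T.touched C' := by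
      rw [← hL']; exact T.left_mem_touched_of_nbr_succ (by rwa [a1])
    have hl : ∀ k, T.left x k ∈ T.touched (C ∪ C') := fun k => by
      rcases a6 j k with rfl | rfl | rfl | rfl
      exacts [hm t0, hm t1, hm t2, hm' t3]
    have hn : ∀ k, T.nbr x k ∈ C ∪ C' ∨ k = j + 3 ∨ k = j := fun k => by
      rcases a6 j k with rfl | rfl | rfl | rfl
      exacts [.inr (.inr rfl), .inl (Finset.mem_union_left _ p1),
        .inl (Finset.mem_union_left _ p2), .inr (.inl rfl)]
    refine ⟨x, j + 3, x, j, hx, hx, .inl ⟨rfl, (a7 j).1.symm, rfl⟩, by simp [p3, hC'], hj, hl, hl,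
      fun k => (hn k).imp_right (Or.imp_right fun h => .inr ⟨rfl, h⟩),
      fun k => (hn k).imp_right fun h => h.symm.imp_right fun h => .inr ⟨rfl, h⟩,
      by rwa [a4], t3, t0, by rwa [a5]⟩
  · have q : T.nbr (T.nbr x j) (j + 1) ∈ C' := by
      rcases e2 with e | e | e
      exacts [absurd e.1 (s3 p3), e.2.2, e.2.2]
    have t0 : T.left x j ∈ T.touched C' := by
      rw [← hL]; exact T.left_mem_touched_of_nbr q
    have t1 : T.left x (j + 1) ∈ T.touched C := T.left_mem_touched_of_nbr_succ (by
      rwa [add_assoc])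
    have t2 : T.left x (j + 2) ∈ T.touched C := T.left_mem_touched_of_nbr p2
    have t3 : T.left x (j + 3) ∈ T.touched C := T.left_mem_touched_of_nbr p3
    have hl : ∀ k, T.left x k ∈ T.touched (C ∪ C') := fun k => by
      rcases a6 j k with rfl | rfl | rfl | rfl
      exacts [hm' t0, hm t1, hm t2, hm t3]
    have hn : ∀ k, T.nbr x k ∈ C ∪ C' ∨ k = j ∨ k = j + 1 := fun k => by
      rcases a6 j k with rfl | rfl | rfl | rfl
      exacts [.inr (.inl rfl), .inr (.inr rfl), .inl (Finset.mem_union_left _ p2),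
        .inl (Finset.mem_union_left _ p3)]
    refine ⟨x, j, x, j + 1, hx, hx, .inl ⟨rfl, (a7 j).2, rfl⟩, hj, by simp [p1, hC'], hl, hl,
      fun k => (hn k).imp_right (Or.imp_right fun h => .inr ⟨rfl, h⟩),
      fun k => (hn k).imp_right fun h => h.symm.imp_right fun h => .inr ⟨rfl, h⟩,
      by rwa [a5], t0, t1, by rwa [add_sub_cancel_right]⟩
  -- Here the outer neighbours of `x` are opposite, so `x` has neighbours in `C` on both sides of
  -- the edge to `y`. Any neighbour of `y` in `C'` beside that edge would share a face with one of
  -- them.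
  · rcases e2 with e | e | e
    exacts [absurd e.1 (s3 p3), absurd e.2.2 (s1 p1), absurd e.1 (s3 p3)]

theorem squareRotation_hasBridges : squareRotation.HasBridges 4 := by
  refine squareRotation.hasBridges_four ?_ ?_ ?_
  · rintro ⟨a, b⟩ j
    fin_cases j <;> simp [squareRotation]
  · rintro ⟨a, b⟩ j
    fin_cases j <;> simp [squareRotation]
  · rintro ⟨a, b⟩ j
    exact squareRotation.nbr_rev _ _

theorem squareRotation_finite (v : ℤ × ℤ) : (squareLattice.graph.neighborSet v).Finite :=
  squareRotation.finite_neighborSet v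

/-- The free vertex is one of the two vertices to the left of the leftmost point `(a, b)`.
Everything in `D` in rows `b` and `b + 1` lies weakly to the right of `a`, so in these rows a vertex
further left that *-adjacency or interlocking would put into `D` gives a contradiction. -/
theorem squareLattice_hasFreeRows : squareLattice.HasFreeRows Prod.snd Prod.fst := by
  rintro A D hAD ⟨a, b⟩ hp hrow hnext
  dsimp only at hrow hnext
  have n0 : ∀ c, c < a → (c, b) ∉ D := fun c hc h => by have := hrow _ h rfl; dsimp at this; omega
  have n1 : ∀ c, c < a → (c, b + 1) ∉ D := fun c hc h => by
    have := hnext _ h rfl; dsimp at this; omega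
  have bd : ∀ c e, c < a → (∃ q ∈ D, squareLattice.starGraph.Adj q (c, b)) →
      e = b → (c, e) ∈ squareLattice.extStarBoundary D := by
    rintro c e hc hq rfl
    refine ⟨?_, hq⟩
    have := mem_infComp_of_ray (P := squareLattice) (D := D) (fun n => (c - n, e))
      (fun m n h => by simpa using h)
      (fun n => (squareLattice_adj _ _ _ _).2 (.inr (.inl ⟨by push_cast; ring, rfl⟩)))
      (fun n => n0 _ (by omega))
    simpa using this
  have star : ∀ c e c' e', ((c ≠ c' ∨ e ≠ e') ∧ c - 1 ≤ c' ∧ c' ≤ c + 1 ∧ e - 1 ≤ e' ∧ e' ≤ e + 1) →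
      squareLattice.starGraph.Adj (c, e) (c', e') := fun c e c' e' => (squareLattice_star _ _ _ _).2
  have adj : ∀ c e c' e', ((c' = c + 1 ∧ e' = e) ∨ (c' = c - 1 ∧ e' = e) ∨ (c' = c ∧ e' = e + 1) ∨
      (c' = c ∧ e' = e - 1)) → squareLattice.graph.Adj (c, e) (c', e') :=
    fun c e c' e' => (squareLattice_adj _ _ _ _).2
  have nbrs : ∀ c e (Q : ℤ × ℤ → Prop), Q (c + 1, e) → Q (c - 1, e) → Q (c, e + 1) → Q (c, e - 1) →
      ∀ w, squareLattice.graph.Adj (c, e) w → Q w := by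
    rintro c e Q h1 h2 h3 h4 ⟨c', e'⟩ h
    rcases (squareLattice_adj _ _ _ _).1 h with ⟨rfl, rfl⟩ | ⟨rfl, rfl⟩ | ⟨rfl, rfl⟩ | ⟨rfl, rfl⟩
    exacts [h1, h2, h3, h4]
  have join : ∀ c e c' e', (c, e) ∈ A → (c', e') ∈ A → ((c ≠ c' ∨ e ≠ e') ∧ c - 1 ≤ c' ∧ c' ≤ c + 1 ∧
      e - 1 ≤ e' ∧ e' ≤ e + 1) → JoinedWithin squareLattice.starGraph A (c, e) (c', e') :=
    fun c e c' e' h h' hs => .of_adj (star _ _ _ _ hs) h h'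
  have hpA := hAD.subset hp
  have n2 : ∀ c e, ((c, e) : ℤ × ℤ) ∈ A → ∀ c' e', (c', e') ∈ D →
      ((c' ≠ c ∨ e' ≠ e) ∧ c' - 1 ≤ c ∧ c ≤ c' + 1 ∧ e' - 1 ≤ e ∧ e ≤ e' + 1) → (c, e) ∈ D :=
    fun c e h c' e' h' hs => hAD.mem_of_adj _ h' _ h (star _ _ _ _ hs)
  have r1 : a - 1 + 1 = a := by ring
  have r2 : a - 1 - 1 = a - 2 := by ring
  have r3 : a - 2 + 1 = a - 1 := by ring
  have r4 : a - 2 - 1 = a - 3 := by ring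
  have hv : (a - 1, b) ∈ squareLattice.extStarBoundary D :=
    bd _ _ (by omega) ⟨_, hp, star _ _ _ _ (by omega)⟩ rfl
  have hvA := hAD.notMem hv
  have hup : (a - 1, b + 1) ∉ A := fun h => n1 (a - 1) (by omega) (n2 _ _ h _ _ hp (by omega))
  -- Otherwise `(a - 1, b)` would be squeezed between `(a, b)` and `(a - 2, b)`, with exactly the
  -- vertices above and below it outside `A`: the first kind of interlocking.
  have hleft : (a - 2, b) ∉ A := by
    intro h
    have hleftD := n0 (a - 2) (by omega)
    have hdn : (a - 1, b - 1) ∉ A := fun h' =>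
      hleftD (n2 _ _ h _ _ (n2 _ _ h' _ _ hp (by omega)) (by omega))
    refine hleftD (hAD.one _ hv _ hp _ h (adj _ _ _ _ (by omega)) (adj _ _ _ _ (by omega))
      (a - 1, b + 1) (a - 1, b - 1) (fun h => by simp only [Prod.mk.injEq] at h; omega)
      (adj _ _ _ _ (by omega)) (adj _ _ _ _ (by omega)) hup hdn (nbrs _ _ _ ?_ ?_ ?_ ?_))
    · rw [r1]; exact .inr (.inr (.inl (.refl hpA)))
    · rw [r2]; exact .inr (.inr (.inr (.refl h)))
    · exact .inl rfl
    · exact .inr (.inl rfl)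
  have free : ∀ c e c₁ e₁ c₂ e₂ c₃ e₃, (c, e) ∉ A → (c₁, e₁) ∉ A → (c₂, e₂) ∉ A → (c₃, e₃) ∉ A →
      squareLattice.graph.Adj (c, e) (c₁, e₁) → squareLattice.graph.Adj (c, e) (c₂, e₂) →
      squareLattice.graph.Adj (c, e) (c₃, e₃) → (c₁ ≠ c₂ ∨ e₁ ≠ e₂) → (c₁ ≠ c₃ ∨ e₁ ≠ e₃) →
      (c₂ ≠ c₃ ∨ e₂ ≠ e₃) → squareLattice.IsFree A (c, e) := by
    intro c e c₁ e₁ c₂ e₂ c₃ e₃ h h1 h2 h3 k1 k2 k3 d1 d2 d3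
    refine isFree_of_three (squareRotation_finite _) h k1 k2 k3 h1 h2 h3 ?_ ?_ ?_ <;>
      · intro h; simp only [Prod.mk.injEq] at h; omega
  by_cases hdn : (a - 1, b - 1) ∈ A
  swap
  · exact ⟨_, free _ _ _ _ _ _ _ _ hvA hup hleft hdn (adj _ _ _ _ (by omega))
      (adj _ _ _ _ (by omega)) (adj _ _ _ _ (by omega)) (by omega) (by omega) (by omega), hv, rfl⟩
  -- The vertex `(a - 1, b)` now has only two neighbours outside `A`; but `(a - 2, b)` is a boundary
  -- vertex as well and is tried next.
  have hdnD := n2 _ _ hdn _ _ hp (by omega)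
  have hw : (a - 2, b) ∈ squareLattice.extStarBoundary D :=
    bd _ _ (by omega) ⟨_, hdnD, star _ _ _ _ (by omega)⟩ rfl
  have hwfree : ∀ c₂ e₂ c₃ e₃, (c₂, e₂) ∉ A → (c₃, e₃) ∉ A →
      squareLattice.graph.Adj (a - 2, b) (c₂, e₂) → squareLattice.graph.Adj (a - 2, b) (c₃, e₃) →
      (a - 1 ≠ c₂ ∨ b ≠ e₂) → (a - 1 ≠ c₃ ∨ b ≠ e₃) → (c₂ ≠ c₃ ∨ e₂ ≠ e₃) →
      ∃ v, squareLattice.IsFree A v ∧ v ∈ squareLattice.extStarBoundary D ∧ v.2 = b :=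
    fun c₂ e₂ c₃ e₃ h2 h3 k2 k3 d1 d2 d3 =>
      ⟨_, free _ _ _ _ _ _ _ _ hleft hvA h2 h3 (adj _ _ _ _ (by omega)) k2 k3 d1 d2 d3, hw, rfl⟩
  by_cases hdl : (a - 2, b - 1) ∈ A
  · have hdlD := n2 _ _ hdl _ _ hdnD (by omega)
    have hll : (a - 3, b) ∉ A := fun h => n0 (a - 3) (by omega) (n2 _ _ h _ _ hdlD (by omega))
    have hup2 : (a - 2, b + 1) ∉ A := by
      intro h
      refine n1 (a - 2) (by omega) (hAD.one _ hw _ hdlD _ h (adj _ _ _ _ (by omega))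
        (adj _ _ _ _ (by omega)) (a - 1, b) (a - 3, b)
        (fun h => by simp only [Prod.mk.injEq] at h; omega)
        (adj _ _ _ _ (by omega)) (adj _ _ _ _ (by omega)) hvA hll (nbrs _ _ _ ?_ ?_ ?_ ?_))
      · rw [r3]; exact .inl rfl
      · rw [r4]; exact .inr (.inl rfl)
      · exact .inr (.inr (.inr (.refl h)))
      · exact .inr (.inr (.inl (.refl hdl)))
    exact hwfree _ _ _ _ hll hup2 (adj _ _ _ _ (by omega)) (adj _ _ _ _ (by omega)) (by omega)
      (by omega) (by omega)
  by_cases hup2 : (a - 2, b + 1) ∈ A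
  swap
  · exact hwfree _ _ _ _ hdl hup2 (adj _ _ _ _ (by omega)) (adj _ _ _ _ (by omega)) (by omega)
      (by omega) (by omega)
  by_cases hll : (a - 3, b) ∈ A
  swap
  · exact hwfree _ _ _ _ hdl hll (adj _ _ _ _ (by omega)) (adj _ _ _ _ (by omega)) (by omega)
      (by omega) (by omega)
  -- What is left is the second kind of interlocking: `(a - 1, b)` leans on the cluster of `(a, b)`,
  -- and `(a - 2, b)` on that of `(a - 3, b)`.
  refine absurd (hAD.two _ hv _ hw (adj _ _ _ _ (by omega)) _ hp _ hll (a - 1, b + 1) (a - 2, b - 1)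
    (fun h => by simp only [Prod.mk.injEq] at h; omega)
    (fun h => by simp only [Prod.mk.injEq] at h; omega) (adj _ _ _ _ (by omega))
    (adj _ _ _ _ (by omega)) hup hdl (nbrs _ _ _ ?_ ?_ ?_ ?_) (nbrs _ _ _ ?_ ?_ ?_ ?_))
    (n0 _ (by omega))
  · rw [r1]; exact .inr (.inr (.refl hpA))
  · rw [r2]; exact .inl rfl
  · exact .inr (.inl rfl)
  · exact .inr (.inr (join _ _ _ _ hpA hdn (by omega)))
  · rw [r3]; exact .inl rfl
  · rw [r4]; exact .inr (.inr (.refl hll))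
  · exact .inr (.inr (join _ _ _ _ hll hup2 (by omega)))
  · exact .inr (.inl rfl)

theorem squareLattice_reflection :
    squareLattice.IsAutomorphism ((Equiv.refl ℤ).prodCongr (Equiv.neg ℤ)) := by
  constructor
  · rintro ⟨a, b⟩ ⟨c, e⟩
    simp only [Equiv.prodCongr_apply, Prod.map_apply, Equiv.refl_apply, Equiv.neg_apply,
      squareLattice_adj]
    omega
  · rintro ⟨a, b⟩ ⟨c, e⟩
    simp only [Equiv.prodCongr_apply, Prod.map_apply, Equiv.refl_apply, Equiv.neg_apply,
      squareLattice_star]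
    omega

theorem squareLattice_swap : squareLattice.IsAutomorphism (Equiv.prodComm ℤ ℤ) := by
  constructor
  · rintro ⟨a, b⟩ ⟨c, e⟩
    simp only [Equiv.prodComm_apply, Prod.swap, squareLattice_adj]
    omega
  · rintro ⟨a, b⟩ ⟨c, e⟩
    simp only [Equiv.prodComm_apply, Prod.swap, squareLattice_star]
    omega

theorem card_le_card_image_mul (E : Finset (ℤ × ℤ)) :
    E.card ≤ (E.image Prod.snd).card * (E.image Prod.fst).card := by
  rw [mul_comm, ← Finset.card_product]
  refine Finset.card_le_card fun p hp => ?_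
  exact Finset.mem_product.2 ⟨Finset.mem_image_of_mem _ hp, Finset.mem_image_of_mem _ hp⟩

/-- Points of the exterior boundary of an interlocked cluster are joined by short paths, for every
discount `c` of the edges that start at free vertices. -/
def HasClusterPaths {V : Type} (P : PlaneGraph V) (ν : ℕ) : Prop :=
  ∀ c : ℝ, 0 < c → c ≤ 1 →
    ∃ c' : ℝ, 0 < c' ∧ ∀ A : Set V, A.Finite → ∀ D : Set V, P.IsInterlockedCluster A D →
      ∀ x ∈ P.extStarBoundary D, ∀ y ∈ P.extStarBoundary D,
        ∃ η : P.graph.Walk x y, (∀ v ∈ η.support, v ∉ A) ∧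
          ((P.edgeRange η).ncard : ℝ) - c * ({e ∈ P.edgeRange η | P.IsFree A e.fst}.ncard : ℝ) ≤
            ν * D.ncard + 4 ∧
          (P.IsExposed A D →
            ((P.edgeRange η).ncard : ℝ) - c * ({e ∈ P.edgeRange η | P.IsFree A e.fst}.ncard : ℝ) ≤
              ν * D.ncard - c' * √D.ncard + 4)

theorem squareLattice_hasClusterPaths : HasClusterPaths squareLattice 2 := fun _ hc0 hc1 =>
  squareRotation.main (K := 1) (r := 0) squareLattice_oneEnded squareRotation_growthBound
    (by norm_num) (by norm_num) (by norm_num) squareRotation_hasBridges squareLattice_hasFreeRows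
    (by
      have := squareLattice_hasFreeRows.comp squareLattice_reflection
      have e : (fun v : ℤ × ℤ => 0 - v.2) =
          Prod.snd ∘ ((Equiv.refl ℤ).prodCongr (Equiv.neg ℤ)) := by
        ext v; simp
      rwa [e])
    squareLattice_swap (fun E => by rw [one_mul]; exact card_le_card_image_mul E) hc0 hc1

/-! ### The triangular lattice -/

theorem triangularLattice_adj (a b c e : ℤ) : triangularLattice.graph.Adj (a, b) (c, e) ↔
    (c = a + 1 ∧ e = b) ∨ (c = a ∧ e = b + 1) ∨ (c = a - 1 ∧ e = b + 1) ∨ (c = a - 1 ∧ e = b) ∨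
      (c = a ∧ e = b - 1) ∨ (c = a + 1 ∧ e = b - 1) := by
  simp only [triangularLattice, Prod.mk_sub_mk, Set.mem_insert_iff, Set.mem_singleton_iff,
    Prod.mk.injEq]
  omega

/-- The triangular lattice as a rotation system; `(a, b, false)` is the upward triangle and
`(a, b, true)` the downward triangle with index `(a, b)`. -/
def triangularRotation : RotationSystem triangularLattice 6 3 (ℤ × ℤ × Bool) where
  nbr v k := ![(v.1 + 1, v.2), (v.1, v.2 + 1), (v.1 - 1, v.2 + 1), (v.1 - 1, v.2), (v.1, v.2 - 1),
    (v.1 + 1, v.2 - 1)] k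
  rev _ k := k + 3
  left v k := ![(v.1, v.2, false), (v.1 - 1, v.2, true), (v.1 - 1, v.2, false),
    (v.1 - 1, v.2 - 1, true), (v.1, v.2 - 1, false), (v.1, v.2 - 1, true)] k
  faceDarts f := bif f.2.2 then {((f.1 + 1, f.2.1), 1), ((f.1 + 1, f.2.1 + 1), 3),
    ((f.1, f.2.1 + 1), 5)} else {((f.1, f.2.1), 0), ((f.1 + 1, f.2.1), 2), ((f.1, f.2.1 + 1), 4)}
  adj_iff := by
    rintro ⟨a, b⟩ ⟨c, e⟩
    rw [triangularLattice_adj]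
    simp only [Fin.exists_fin_succ, Prod.ext_iff]
    simp
    omega
  nbr_injective := by
    rintro ⟨a, b⟩ k l h
    fin_cases k <;> fin_cases l <;> simp at h ⊢ <;> omega
  left_injective := by
    rintro ⟨a, b⟩ k l h
    fin_cases k <;> fin_cases l <;> simp at h ⊢ <;> omega
  nbr_rev := by
    rintro ⟨a, b⟩ k
    fin_cases k <;> simp
  left_rev := by
    rintro ⟨a, b⟩ k
    fin_cases k <;> simp
  cofacial_iff := by
    rintro ⟨a, b⟩ ⟨c, e⟩
    simp only [triangularLattice, Set.mem_ofPred_eq]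
    constructor
    · rintro ⟨f, ⟨i, j, rfl | rfl⟩, h, h'⟩
      · have key : ∀ x : ℤ × ℤ, x ∈ ({(i, j), (i + 1, j), (i, j + 1)} : Set (ℤ × ℤ)) →
            ∃ k : Fin 6, ![(x.1, x.2, false), (x.1 - 1, x.2, true), (x.1 - 1, x.2, false),
              (x.1 - 1, x.2 - 1, true), (x.1, x.2 - 1, false), (x.1, x.2 - 1, true)] k =
              (i, j, false) := by
          rintro x (rfl | rfl | rfl)
          exacts [⟨0, by simp⟩, ⟨2, by simp⟩, ⟨4, by simp⟩]
        obtain ⟨k, hk⟩ := key _ h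
        obtain ⟨l, hl⟩ := key _ h'
        exact ⟨k, l, hk.trans hl.symm⟩
      · have key : ∀ x : ℤ × ℤ, x ∈ ({(i + 1, j), (i + 1, j + 1), (i, j + 1)} : Set (ℤ × ℤ)) →
            ∃ k : Fin 6, ![(x.1, x.2, false), (x.1 - 1, x.2, true), (x.1 - 1, x.2, false),
              (x.1 - 1, x.2 - 1, true), (x.1, x.2 - 1, false), (x.1, x.2 - 1, true)] k =
              (i, j, true) := by
          rintro x (rfl | rfl | rfl)
          exacts [⟨1, by simp⟩, ⟨3, by simp⟩, ⟨5, by simp⟩]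
        obtain ⟨k, hk⟩ := key _ h
        obtain ⟨l, hl⟩ := key _ h'
        exact ⟨k, l, hk.trans hl.symm⟩
    · rintro ⟨k, l, h⟩
      have key : ∀ (x : ℤ × ℤ) (k : Fin 6) (f : ℤ × ℤ × Bool),
          ![(x.1, x.2, false), (x.1 - 1, x.2, true), (x.1 - 1, x.2, false),
            (x.1 - 1, x.2 - 1, true), (x.1, x.2 - 1, false), (x.1, x.2 - 1, true)] k = f →
          (f.2.2 = false ∧ x ∈ ({(f.1, f.2.1), (f.1 + 1, f.2.1), (f.1, f.2.1 + 1)} :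
            Set (ℤ × ℤ))) ∨ (f.2.2 = true ∧
            x ∈ ({(f.1 + 1, f.2.1), (f.1 + 1, f.2.1 + 1), (f.1, f.2.1 + 1)} : Set (ℤ × ℤ))) := by
        rintro ⟨x, y⟩ k f rfl
        fin_cases k <;> simp
      rcases key (a, b) k _ h with ⟨h1, h2⟩ | ⟨h1, h2⟩ <;> rcases key (c, e) l _ rfl with ⟨h3, h4⟩ | ⟨h3, h4⟩
      · exact ⟨_, ⟨_, _, .inl rfl⟩, h2, h4⟩
      · rw [h1] at h3; cases h3
      · rw [h1] at h3; cases h3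
      · exact ⟨_, ⟨_, _, .inr rfl⟩, h2, h4⟩
  mem_faceDarts := by
    rintro ⟨i, j, s⟩ ⟨⟨a, b⟩, k⟩
    cases s <;> fin_cases k <;> simp [Prod.ext_iff] <;> omega
  card_faceDarts := by
    rintro ⟨i, j, s⟩
    cases s <;> simp only [cond_true, cond_false] <;>
    rw [Finset.card_insert_of_notMem, Finset.card_insert_of_notMem, Finset.card_singleton] <;> simp
  face_connected := by
    rintro ⟨i, j, s⟩ Q hQ
    cases s
    · have h0 := hQ (i, j) 0 (by simp)
      have h1 := hQ (i + 1, j) 2 (by simp)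
      have key : ∀ v k, ![(v.1, v.2, false), (v.1 - 1, v.2, true), (v.1 - 1, v.2, false),
          (v.1 - 1, v.2 - 1, true), (v.1, v.2 - 1, false), (v.1, v.2 - 1, true)] k =
            (i, j, false) → (Q v ↔ Q (i, j)) := by
        rintro ⟨a, b⟩ k h
        fin_cases k <;> simp at h h0 h1 <;> obtain ⟨rfl, rfl⟩ := h <;> simp_all
      intro v k w l hv hw h
      exact (key w l hw).2 ((key v k hv).1 h)
    · have h0 := hQ (i + 1, j) 1 (by simp)
      have h1 := hQ (i + 1, j + 1) 3 (by simp)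
      have key : ∀ v k, ![(v.1, v.2, false), (v.1 - 1, v.2, true), (v.1 - 1, v.2, false),
          (v.1 - 1, v.2 - 1, true), (v.1, v.2 - 1, false), (v.1, v.2 - 1, true)] k =
            (i, j, true) → (Q v ↔ Q (i + 1, j)) := by
        rintro ⟨a, b⟩ k h
        fin_cases k <;> simp at h h0 h1 <;> obtain ⟨rfl, rfl⟩ := h <;> simp_all
      intro v k w l hv hw h
      exact (key w l hw).2 ((key v k hv).1 h)
  exact := by
    intro o ho
    have two : ∀ x : ZMod 2, x + x = 0 := by decide
    have e0 : ∀ a b : ℤ, o (a, b) (a, b, false) + o (a + 1, b) (a, b, false) =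
        o (a, b) (a, b - 1, true) + o (a + 1, b) (a, b - 1, true) := fun a b => by
      simpa using ho (a, b) 5
    have e1 : ∀ a b : ℤ, o (a, b) (a - 1, b, true) + o (a, b + 1) (a - 1, b, true) =
        o (a, b) (a, b, false) + o (a, b + 1) (a, b, false) := fun a b => by
      simpa using ho (a, b) 0
    have e2 : ∀ a b : ℤ, o (a, b) (a - 1, b, false) + o (a - 1, b + 1) (a - 1, b, false) =
        o (a, b) (a - 1, b, true) + o (a - 1, b + 1) (a - 1, b, true) := fun a b => by
      simpa using ho (a, b) 1
    obtain ⟨G, hG⟩ := exists_potential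
      (fun a b => o (a, b) (a, b, false) + o (a + 1, b) (a, b, false))
      (fun a b => o (a, b) (a, b, false) + o (a, b + 1) (a, b, false)) (by
        intro a b
        have h0 := e0 a (b + 1)
        have h1 := e1 (a + 1) b
        have h2 := e2 (a + 1) b
        rw [add_sub_cancel_right] at h0 h1 h2
        linear_combination two (o (a + 1, b) (a, b, false)) - h1 - h0 - h2 -
          two (o (a, b + 1) (a, b, true)))
    have g0 : ∀ a b, G a b + G (a + 1) b = o (a, b) (a, b, false) + o (a + 1, b) (a, b, false) :=
      fun a b => by linear_combination (hG a b).1 + two (G a b)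
    have g1 : ∀ a b, G a b + G a (b + 1) = o (a, b) (a, b, false) + o (a, b + 1) (a, b, false) :=
      fun a b => by linear_combination (hG a b).2 + two (G a b)
    have g2 : ∀ a b, G (a + 1) b + G a (b + 1) =
        o (a + 1, b) (a, b, false) + o (a, b + 1) (a, b, false) := fun a b => by
      linear_combination g0 a b + g1 a b - two (G a b) + two (o (a, b) (a, b, false))
    refine ⟨fun v => G v.1 v.2, ?_⟩
    rintro ⟨a, b⟩ k
    have h3 := g0 (a - 1) b
    have h3' := e0 (a - 1) b
    have h4 := g1 a (b - 1)
    have h4' := e1 a (b - 1)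
    have h5 := g2 a (b - 1)
    have h5' := e2 (a + 1) (b - 1)
    have h2 := g2 (a - 1) b
    have h2' := e2 a b
    rw [sub_add_cancel] at h2 h3 h3' h4 h4' h5 h5'
    rw [add_sub_cancel_right] at h5'
    fin_cases k
    · simpa using g0 a b
    · have := g1 a b
      simp
      linear_combination this - e1 a b
    · simp
      linear_combination h2
    · simp
      linear_combination h3 + h3'
    · simp
      linear_combination h4
    · simp
      linear_combination h5 + h5'

theorem triangularLattice_star (a b c e : ℤ) : triangularLattice.starGraph.Adj (a, b) (c, e) ↔
    triangularLattice.graph.Adj (a, b) (c, e) := by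
  rw [triangularRotation.starAdj_iff, triangularLattice_adj]
  simp only [triangularRotation, Fin.exists_fin_succ, Prod.ext_iff]
  simp
  omega

theorem triangularLattice_oneEnded : triangularLattice.OneEnded := by
  refine oneEnded_of_steps id id (fun B hB => hB) (fun v S h => .refl (h v rfl)) ?_ ?_
  · intro a b S h
    exact .of_adj ((triangularLattice_adj _ _ _ _).2 (.inl ⟨rfl, rfl⟩)) (h _ rfl) (h _ rfl)
  · intro a b S h
    exact .of_adj ((triangularLattice_adj _ _ _ _).2 (.inr (.inl ⟨rfl, rfl⟩))) (h _ rfl) (h _ rfl)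

theorem card_le_of_six : ∀ e : Fin 6 → Bool, (∃ k, e k) →
    3 * (Finset.univ.filter fun k => ¬ (e k ∨ e (k + 1))).card +
      2 * (Finset.univ.filter fun k => e k).card ≤ 14 := by
  decide

/-- The general criterion is too weak here. In a triangle at `v` the other two corners are
consecutive neighbours of `v`, so the touched faces are determined by the neighbours in `E`, and the
bound 14 = 2ν + 2d is a finite check on six bits. -/
theorem triangularRotation_growthBound : triangularRotation.GrowthBound 1 := by
  intro E v hv ⟨k, hk⟩
  have key : ∀ x k u l, triangularRotation.left u l = triangularRotation.left x k →
      u = x ∨ u = triangularRotation.nbr x k ∨ u = triangularRotation.nbr x (k + 1) := by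
    rintro ⟨a, b⟩ k ⟨c, e⟩ l h
    have := (triangularRotation.mem_faceDarts _ (_, _)).2 h
    fin_cases k <;> simp [triangularRotation] at this ⊢ <;> omega
  have iff : ∀ k, triangularRotation.left v k ∈ triangularRotation.touched E ↔
      triangularRotation.nbr v k ∈ E ∨ triangularRotation.nbr v (k + 1) ∈ E := by
    intro k
    constructor
    · intro h
      obtain ⟨u, hu, l, hl⟩ := triangularRotation.mem_touched.1 h
      rcases key _ _ _ _ hl with rfl | rfl | rfl
      exacts [absurd hu hv, .inl hu, .inr hu]
    · rintro (h | h)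
      exacts [triangularRotation.left_mem_touched_of_nbr h,
        triangularRotation.left_mem_touched_of_nbr_succ h]
  have := card_le_of_six (fun k => decide (triangularRotation.nbr v k ∈ E)) (by
    rcases (iff k).1 hk with h | h
    exacts [⟨k, by simpa using h⟩, ⟨k + 1, by simpa using h⟩])
  simp only [iff]
  simpa using this

theorem triangularRotation_adj_nbr (x : ℤ × ℤ) (j : Fin 6) : triangularLattice.graph.Adj
    (triangularRotation.nbr x j) (triangularRotation.nbr x (j + 1)) := by
  obtain ⟨a, b⟩ := x
  fin_cases j <;> simp [triangularRotation, triangularLattice_adj]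

/-- The second kind of interlocking cannot occur. Adjacent vertices have two common neighbours,
which lie outside `C` because they are neighbours of `y`; together with `y` itself they are three
neighbours of `x` outside `C`. -/
theorem triangularRotation_hasBridges : triangularRotation.HasBridges 4 := by
  classical
  rintro C C' hdis ⟨hst, ⟨x, hx, h2, hC, hC'⟩ | ⟨x, hx, y, hy, hxy, ⟨h1, h1'⟩, h2, h2'⟩⟩
  · exact triangularRotation.exists_bridge_of_common rfl hasTwoBlocks_six hdis hst hx h2 hC hC'
  exfalso
  obtain ⟨j, rfl⟩ := (triangularRotation.adj_iff _ _).1 hxy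
  have hy' := infComp_notMem hy
  rw [triangularRotation.ncard_neighborSet_diff] at h1
  have hnC : ∀ w, triangularLattice.graph.Adj (triangularRotation.nbr x j) w → w ∉ C :=
    fun w hw hC => Set.notMem_empty _ (h2'.subset ⟨hw, hC⟩)
  have h3 : ∀ j : Fin 6, ({j - 1, j, j + 1} : Finset (Fin 6)).card = 3 := by decide
  have hadj := (triangularRotation_adj_nbr x (j - 1)).symm
  rw [sub_add_cancel] at hadj
  have hsub : ({j - 1, j, j + 1} : Finset (Fin 6)) ⊆
      Finset.univ.filter fun k => triangularRotation.nbr x k ∉ (C : Set (ℤ × ℤ)) := by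
    intro k hk
    simp only [Finset.mem_insert, Finset.mem_singleton] at hk
    simp only [Finset.mem_filter, Finset.mem_univ, true_and]
    rcases hk with rfl | rfl | rfl
    exacts [hnC _ hadj, fun h => hy' (.inl h), hnC _ (triangularRotation_adj_nbr x j)]
  have := Finset.card_le_card hsub
  rw [h1, h3] at this
  omega

/-- The second coordinate function is twice the horizontal position. The vertex `(a - 1, b)` is
itself free: with `(a - 1, b + 1)` outside `A` and at most one further neighbour outside, the other
neighbours would either be linked to `(a, b)` or form a second block interlocked with it, and so put
a point too far left into `D`. -/
theorem triangularLattice_hasFreeRows :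
    triangularLattice.HasFreeRows Prod.snd fun v => 2 * v.1 + v.2 := by
  rintro A D hAD ⟨a, b⟩ hp hrow hnext
  dsimp only at hrow hnext
  have n0 : ∀ c, c < a → (c, b) ∉ D := fun c hc h => by have := hrow _ h rfl; dsimp at this; omega
  have n1 : ∀ c, c < a → (c, b + 1) ∉ D := fun c hc h => by
    have := hnext _ h rfl; dsimp at this; omega
  have adj : ∀ c e c' e', ((c' = c + 1 ∧ e' = e) ∨ (c' = c ∧ e' = e + 1) ∨
      (c' = c - 1 ∧ e' = e + 1) ∨ (c' = c - 1 ∧ e' = e) ∨ (c' = c ∧ e' = e - 1) ∨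
      (c' = c + 1 ∧ e' = e - 1)) → triangularLattice.graph.Adj (c, e) (c', e') :=
    fun c e c' e' => (triangularLattice_adj _ _ _ _).2
  have hv : (a - 1, b) ∈ triangularLattice.extStarBoundary D := by
    refine ⟨?_, _, hp, (triangularLattice_star _ _ _ _).2 (adj _ _ _ _ (by omega))⟩
    have := mem_infComp_of_ray (P := triangularLattice) (D := D) (fun n => (a - 1 - n, b))
      (fun m n h => by simpa using h) (fun n => adj _ _ _ _ (by push_cast; omega))
      (fun n => n0 _ (by omega))
    simpa using this
  have nbrs : ∀ c e (Q : ℤ × ℤ → Prop), Q (c + 1, e) → Q (c, e + 1) → Q (c - 1, e + 1) →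
      Q (c - 1, e) → Q (c, e - 1) → Q (c + 1, e - 1) →
      ∀ w, triangularLattice.graph.Adj (c, e) w → Q w := by
    rintro c e Q h1 h2 h3 h4 h5 h6 ⟨c', e'⟩ h
    rcases (triangularLattice_adj _ _ _ _).1 h with ⟨rfl, rfl⟩ | ⟨rfl, rfl⟩ | ⟨rfl, rfl⟩ |
      ⟨rfl, rfl⟩ | ⟨rfl, rfl⟩ | ⟨rfl, rfl⟩
    exacts [h1, h2, h3, h4, h5, h6]
  have join : ∀ c e c' e', (c, e) ∈ A → (c', e') ∈ A → triangularLattice.graph.Adj (c, e) (c', e') →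
      JoinedWithin triangularLattice.starGraph A (c, e) (c', e') :=
    fun c e c' e' h h' hs => .of_adj ((triangularLattice_star _ _ _ _).2 hs) h h'
  have hpA := hAD.subset hp
  have n2 : ∀ c e, ((c, e) : ℤ × ℤ) ∈ A → ∀ c' e', (c', e') ∈ D →
      triangularLattice.graph.Adj (c', e') (c, e) → (c, e) ∈ D :=
    fun c e h c' e' h' hs => hAD.mem_of_adj _ h' _ h ((triangularLattice_star _ _ _ _).2 hs)
  have r1 : a - 1 + 1 = a := by ring
  have r2 : a - 1 - 1 = a - 2 := by ring
  have hvA := hAD.notMem hv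
  have hup : (a - 1, b + 1) ∉ A := fun h =>
    n1 (a - 1) (by omega) (n2 _ _ h _ _ hp (adj _ _ _ _ (by omega)))
  have free : ∀ c₂ e₂ c₃ e₃, (c₂, e₂) ∉ A → (c₃, e₃) ∉ A →
      triangularLattice.graph.Adj (a - 1, b) (c₂, e₂) →
      triangularLattice.graph.Adj (a - 1, b) (c₃, e₃) →
      (a - 1 ≠ c₂ ∨ b + 1 ≠ e₂) → (a - 1 ≠ c₃ ∨ b + 1 ≠ e₃) → (c₂ ≠ c₃ ∨ e₂ ≠ e₃) →
      ∃ v, triangularLattice.IsFree A v ∧ v ∈ triangularLattice.extStarBoundary D ∧ v.2 = b := by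
    intro c₂ e₂ c₃ e₃ h2 h3 k2 k3 d1 d2 d3
    refine ⟨_, isFree_of_three (triangularRotation.finite_neighborSet _) hvA
      (adj _ _ (a - 1) (b + 1) (by omega)) k2 k3 hup h2 h3 ?_ ?_ ?_, hv, rfl⟩ <;>
      · intro h; simp only [Prod.mk.injEq] at h; omega
  by_cases hleft : (a - 2, b) ∈ A
  · by_cases hup2 : (a - 2, b + 1) ∈ A
    · by_cases hdn : (a, b - 1) ∈ A
      · by_cases hdn2 : (a - 1, b - 1) ∈ A
        · exact absurd (n2 _ _ hleft _ _ (n2 _ _ hdn2 _ _ (n2 _ _ hdn _ _ hp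
            (adj _ _ _ _ (by omega))) (adj _ _ _ _ (by omega))) (adj _ _ _ _ (by omega)))
            (n0 _ (by omega))
        · refine absurd (hAD.one _ hv _ hp _ hleft (adj _ _ _ _ (by omega)) (adj _ _ _ _ (by omega))
            (a - 1, b + 1) (a - 1, b - 1) (fun h => by simp only [Prod.mk.injEq] at h; omega)
            (adj _ _ _ _ (by omega)) (adj _ _ _ _ (by omega)) hup hdn2 (nbrs _ _ _ ?_ ?_ ?_ ?_ ?_ ?_))
            (n0 _ (by omega))
          · rw [r1]; exact .inr (.inr (.inl (.refl hpA)))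
          · exact .inl rfl
          · rw [r2]; exact .inr (.inr (.inr (join _ _ _ _ hleft hup2 (adj _ _ _ _ (by omega)))))
          · rw [r2]; exact .inr (.inr (.inr (.refl hleft)))
          · exact .inr (.inl rfl)
          · rw [r1]; exact .inr (.inr (.inl (join _ _ _ _ hpA hdn (adj _ _ _ _ (by omega)))))
      · by_cases hdn2 : (a - 1, b - 1) ∈ A
        · refine absurd (hAD.one _ hv _ hp _ hleft (adj _ _ _ _ (by omega)) (adj _ _ _ _ (by omega))
            (a - 1, b + 1) (a, b - 1) (fun h => by simp only [Prod.mk.injEq] at h; omega)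
            (adj _ _ _ _ (by omega)) (adj _ _ _ _ (by omega)) hup hdn (nbrs _ _ _ ?_ ?_ ?_ ?_ ?_ ?_))
            (n0 _ (by omega))
          · rw [r1]; exact .inr (.inr (.inl (.refl hpA)))
          · exact .inl rfl
          · rw [r2]; exact .inr (.inr (.inr (join _ _ _ _ hleft hup2 (adj _ _ _ _ (by omega)))))
          · rw [r2]; exact .inr (.inr (.inr (.refl hleft)))
          · exact .inr (.inr (.inr (join _ _ _ _ hleft hdn2 (adj _ _ _ _ (by omega)))))
          · rw [r1]; exact .inr (.inl rfl)
        · exact free _ _ _ _ hdn hdn2 (adj _ _ _ _ (by omega)) (adj _ _ _ _ (by omega)) (by omega)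
            (by omega) (by omega)
    · by_cases hdn : (a, b - 1) ∈ A
      · by_cases hdn2 : (a - 1, b - 1) ∈ A
        · exact absurd (n2 _ _ hleft _ _ (n2 _ _ hdn2 _ _ (n2 _ _ hdn _ _ hp
            (adj _ _ _ _ (by omega))) (adj _ _ _ _ (by omega))) (adj _ _ _ _ (by omega)))
            (n0 _ (by omega))
        · exact free _ _ _ _ hup2 hdn2 (adj _ _ _ _ (by omega)) (adj _ _ _ _ (by omega)) (by omega)
            (by omega) (by omega)
      · exact free _ _ _ _ hup2 hdn (adj _ _ _ _ (by omega)) (adj _ _ _ _ (by omega)) (by omega)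
            (by omega) (by omega)
  · have free' : ∀ c₃ e₃, (c₃, e₃) ∉ A → ((c₃ = a - 2 ∧ e₃ = b + 1) ∨ (c₃ = a ∧ e₃ = b - 1) ∨
        (c₃ = a - 1 ∧ e₃ = b - 1)) →
        ∃ v, triangularLattice.IsFree A v ∧ v ∈ triangularLattice.extStarBoundary D ∧ v.2 = b :=
      fun c₃ e₃ h3 h => free _ _ _ _ hleft h3 (adj _ _ _ _ (by omega)) (adj _ _ _ _ (by omega))
        (by omega) (by omega) (by omega)
    by_cases hup2 : (a - 2, b + 1) ∈ A
    swap
    · exact free' _ _ hup2 (by omega)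
    by_cases hdn : (a, b - 1) ∈ A
    swap
    · exact free' _ _ hdn (by omega)
    by_cases hdn2 : (a - 1, b - 1) ∈ A
    swap
    · exact free' _ _ hdn2 (by omega)
    have hj := join _ _ _ _ hpA hdn (adj _ _ _ _ (by omega))
    refine absurd (hAD.one _ hv _ hp _ hup2 (adj _ _ _ _ (by omega)) (adj _ _ _ _ (by omega))
      (a - 1, b + 1) (a - 2, b) (fun h => by simp only [Prod.mk.injEq] at h; omega)
      (adj _ _ _ _ (by omega)) (adj _ _ _ _ (by omega)) hup hleft (nbrs _ _ _ ?_ ?_ ?_ ?_ ?_ ?_))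
      (n1 _ (by omega))
    · rw [r1]; exact .inr (.inr (.inl (.refl hpA)))
    · exact .inl rfl
    · rw [r2]; exact .inr (.inr (.inr (.refl hup2)))
    · rw [r2]; exact .inr (.inl rfl)
    · exact .inr (.inr (.inl (hj.trans (join _ _ _ _ hdn hdn2 (adj _ _ _ _ (by omega))))))
    · rw [r1]; exact .inr (.inr (.inl hj))

/-- The reflection of the triangular lattice in a horizontal line. -/
def triangularReflection : ℤ × ℤ ≃ ℤ × ℤ where
  toFun v := (v.1 + v.2, -v.2)
  invFun v := (v.1 + v.2, -v.2)
  left_inv v := by simp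
  right_inv v := by simp

theorem triangularLattice_reflection : triangularLattice.IsAutomorphism triangularReflection := by
  have h : ∀ u v, triangularLattice.graph.Adj (triangularReflection u) (triangularReflection v) ↔
      triangularLattice.graph.Adj u v := by
    rintro ⟨a, b⟩ ⟨c, e⟩
    simp only [triangularReflection, Equiv.coe_fn_mk, triangularLattice_adj]
    omega
  refine ⟨h, fun u v => ?_⟩
  rw [triangularLattice_star, triangularLattice_star]
  exact h u v

theorem triangularLattice_swap : triangularLattice.IsAutomorphism (Equiv.prodComm ℤ ℤ) := by
  have h : ∀ u v, triangularLattice.graph.Adj (Equiv.prodComm ℤ ℤ u) (Equiv.prodComm ℤ ℤ v) ↔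
      triangularLattice.graph.Adj u v := by
    rintro ⟨a, b⟩ ⟨c, e⟩
    simp only [Equiv.prodComm_apply, Prod.swap, triangularLattice_adj]
    omega
  refine ⟨h, fun u v => ?_⟩
  rw [triangularLattice_star, triangularLattice_star]
  exact h u v

theorem triangularLattice_hasClusterPaths : HasClusterPaths triangularLattice 1 := fun _ hc0 hc1 =>
  triangularRotation.main (K := 1) (r := 0) triangularLattice_oneEnded
    triangularRotation_growthBound (by norm_num) (by norm_num) (by norm_num)
    triangularRotation_hasBridges triangularLattice_hasFreeRows
    (by
      have := triangularLattice_hasFreeRows.comp triangularLattice_reflection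
      have e1 : (fun v : ℤ × ℤ => 0 - v.2) = Prod.snd ∘ triangularReflection := by
        ext v; simp [triangularReflection]
      have e2 : (fun v : ℤ × ℤ => 2 * v.1 + v.2) =
          (fun v : ℤ × ℤ => 2 * v.1 + v.2) ∘ triangularReflection := by
        ext v; simp [triangularReflection]; ring
      rw [e1, e2]
      exact this)
    triangularLattice_swap (fun E => by rw [one_mul]; exact card_le_card_image_mul E) hc0 hc1

/-! ### The hexagonal lattice -/

theorem hexagonalLattice_adj (a b c e : ℤ) (s t : Bool) :
    hexagonalLattice.graph.Adj (a, b, s) (c, e, t) ↔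
      (s = false ∧ t = true ∧ ((c = a ∧ e = b) ∨ (c = a - 1 ∧ e = b) ∨ (c = a ∧ e = b - 1))) ∨
      (s = true ∧ t = false ∧ ((c = a ∧ e = b) ∨ (c = a + 1 ∧ e = b) ∨ (c = a ∧ e = b + 1))) := by
  simp only [hexagonalLattice, HexStep, Set.mem_insert_iff, Set.mem_singleton_iff, Prod.mk.injEq]
  cases s <;> cases t <;> simp <;> omega

/-- The hexagonal lattice as a rotation system. -/
def hexagonalRotation : RotationSystem hexagonalLattice 3 6 (ℤ × ℤ) where
  nbr v k := bif v.2.2 then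
    ![(v.1, v.2.1, false), (v.1 + 1, v.2.1, false), (v.1, v.2.1 + 1, false)] k else
    ![(v.1, v.2.1, true), (v.1 - 1, v.2.1, true), (v.1, v.2.1 - 1, true)] k
  rev _ k := k
  left v k := bif v.2.2 then ![(v.1 + 1, v.2.1), (v.1 + 1, v.2.1 + 1), (v.1, v.2.1 + 1)] k else
    ![(v.1, v.2.1 + 1), (v.1, v.2.1), (v.1 + 1, v.2.1)] k
  faceDarts f := {((f.1, f.2 - 1, false), 0), ((f.1, f.2, false), 1), ((f.1 - 1, f.2, false), 2),
    ((f.1 - 1, f.2, true), 0), ((f.1 - 1, f.2 - 1, true), 1), ((f.1, f.2 - 1, true), 2)}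
  adj_iff := by
    rintro ⟨a, b, s⟩ ⟨c, e, t⟩
    rw [hexagonalLattice_adj]
    simp only [Fin.exists_fin_succ, Prod.ext_iff]
    cases s <;> cases t <;> simp <;> omega
  nbr_injective := by
    rintro ⟨a, b, s⟩ k l h
    cases s <;> fin_cases k <;> fin_cases l <;> simp at h ⊢ <;> omega
  left_injective := by
    rintro ⟨a, b, s⟩ k l h
    cases s <;> fin_cases k <;> fin_cases l <;> simp at h ⊢
  nbr_rev := by
    rintro ⟨a, b, s⟩ k
    cases s <;> fin_cases k <;> simp
  left_rev := by
    rintro ⟨a, b, s⟩ k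
    cases s <;> fin_cases k <;> simp
  cofacial_iff := by
    rintro ⟨a, b, s⟩ ⟨c, e, t⟩
    simp only [hexagonalLattice, Set.mem_ofPred_eq]
    constructor
    · rintro ⟨f, ⟨i, j, rfl⟩, h, h'⟩
      have key : ∀ x : ℤ × ℤ × Bool, x ∈ ({(i, j, false), (i - 1, j, true), (i - 1, j, false),
          (i - 1, j - 1, true), (i, j - 1, false), (i, j - 1, true)} : Set (ℤ × ℤ × Bool)) →
          ∃ k : Fin 3, (bif x.2.2 then ![(x.1 + 1, x.2.1), (x.1 + 1, x.2.1 + 1), (x.1, x.2.1 + 1)] k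
            else ![(x.1, x.2.1 + 1), (x.1, x.2.1), (x.1 + 1, x.2.1)] k) = (i, j) := by
        rintro x (rfl | rfl | rfl | rfl | rfl | rfl)
        exacts [⟨1, by simp⟩, ⟨0, by simp⟩, ⟨2, by simp⟩, ⟨1, by simp⟩, ⟨0, by simp⟩, ⟨2, by simp⟩]
      obtain ⟨k, hk⟩ := key _ h
      obtain ⟨l, hl⟩ := key _ h'
      exact ⟨k, l, hk.trans hl.symm⟩
    · rintro ⟨k, l, h⟩
      have key : ∀ (x : ℤ × ℤ × Bool) (k : Fin 3) (f : ℤ × ℤ),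
          (bif x.2.2 then ![(x.1 + 1, x.2.1), (x.1 + 1, x.2.1 + 1), (x.1, x.2.1 + 1)] k
            else ![(x.1, x.2.1 + 1), (x.1, x.2.1), (x.1 + 1, x.2.1)] k) = f →
          x ∈ ({(f.1, f.2, false), (f.1 - 1, f.2, true), (f.1 - 1, f.2, false),
            (f.1 - 1, f.2 - 1, true), (f.1, f.2 - 1, false), (f.1, f.2 - 1, true)} :
              Set (ℤ × ℤ × Bool)) := by
        rintro ⟨x, y, s⟩ k f rfl
        cases s <;> fin_cases k <;> simp
      exact ⟨_, ⟨_, _, rfl⟩, key (a, b, s) k _ h, key (c, e, t) l _ rfl⟩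
  mem_faceDarts := by
    rintro ⟨i, j⟩ ⟨⟨a, b, s⟩, k⟩
    cases s <;> fin_cases k <;> simp [Prod.ext_iff] <;> omega
  card_faceDarts := by
    rintro ⟨i, j⟩
    rw [Finset.card_insert_of_notMem, Finset.card_insert_of_notMem, Finset.card_insert_of_notMem,
      Finset.card_insert_of_notMem, Finset.card_insert_of_notMem, Finset.card_singleton] <;> simp
  face_connected := by
    rintro ⟨i, j⟩ Q hQ
    have h0 := hQ (i, j - 1, false) 0 (by simp)
    have h1 := hQ (i, j, false) 1 (by simp)
    have h2 := hQ (i - 1, j, false) 2 (by simp)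
    have h3 := hQ (i - 1, j, true) 0 (by simp)
    have h4 := hQ (i - 1, j - 1, true) 1 (by simp)
    simp only [cond_false, cond_true, Matrix.cons_val, sub_add_cancel] at h0 h1 h2 h3 h4
    have key : ∀ v : ℤ × ℤ × Bool, ∀ k, (bif v.2.2 then
        ![(v.1 + 1, v.2.1), (v.1 + 1, v.2.1 + 1), (v.1, v.2.1 + 1)] k
        else ![(v.1, v.2.1 + 1), (v.1, v.2.1), (v.1 + 1, v.2.1)] k) = (i, j) →
        (Q v ↔ Q (i, j, false)) := by
      rintro ⟨a, b, s⟩ k h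
      have : ((a, b, s), k) ∈ ({((i, j - 1, false), 0), ((i, j, false), 1), ((i - 1, j, false), 2),
          ((i - 1, j, true), 0), ((i - 1, j - 1, true), 1), ((i, j - 1, true), 2)} :
          Set ((ℤ × ℤ × Bool) × Fin 3)) := by
        cases s <;> fin_cases k <;> simp at h ⊢ <;> omega
      simp only [Set.mem_insert_iff, Set.mem_singleton_iff, Prod.mk.injEq] at this
      rcases this with ⟨⟨rfl, rfl, rfl⟩, rfl⟩ | ⟨⟨rfl, rfl, rfl⟩, rfl⟩ | ⟨⟨rfl, rfl, rfl⟩, rfl⟩ |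
        ⟨⟨rfl, rfl, rfl⟩, rfl⟩ | ⟨⟨rfl, rfl, rfl⟩, rfl⟩ | ⟨⟨rfl, rfl, rfl⟩, rfl⟩
      · rw [← h4, ← h2, ← h3, ← h1]
      · rfl
      · rw [← h3, ← h1]
      · exact h1.symm
      · rw [← h2, ← h3, ← h1]
      · rw [← h0, ← h4, ← h2, ← h3, ← h1]
    intro v k w l hv hw h
    exact (key w l hw).2 ((key v k hv).1 h)
  exact := by
    intro o ho
    have two : ∀ x : ZMod 2, x + x = 0 := by decide
    have e0 : ∀ a b : ℤ, o (a, b, false) (a, b + 1) + o (a, b, true) (a, b + 1) =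
        o (a, b, false) (a + 1, b) + o (a, b, true) (a + 1, b) := fun a b => by
      simpa using ho (a, b, false) 2
    have e1 : ∀ a b : ℤ, o (a, b, false) (a, b) + o (a - 1, b, true) (a, b) =
        o (a, b, false) (a, b + 1) + o (a - 1, b, true) (a, b + 1) := fun a b => by
      simpa using ho (a, b, false) 0
    have e2 : ∀ a b : ℤ, o (a, b, false) (a + 1, b) + o (a, b - 1, true) (a + 1, b) =
        o (a, b, false) (a, b) + o (a, b - 1, true) (a, b) := fun a b => by
      simpa using ho (a, b, false) 1
    -- The potential is first found on the vertices `(a, b, false)`, neighbouring ones being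
    -- compared through a hexagon that contains both. It is then extended to `(a, b, true)` along
    -- the edge between the two vertices of index `(a, b)`.
    obtain ⟨G, hG⟩ := exists_potential
      (fun a b => o (a, b, false) (a + 1, b) + o (a + 1, b, false) (a + 1, b))
      (fun a b => o (a, b, false) (a, b + 1) + o (a, b + 1, false) (a, b + 1)) (by
        intro a b
        have h0 := e0 a b
        have h1 := e1 (a + 1) b
        have h2 := e2 a (b + 1)
        rw [add_sub_cancel_right] at h1 h2
        linear_combination h1 - h0 - h2 + two (o (a + 1, b, false) (a + 1, b + 1)) +
          two (o (a, b, true) (a + 1, b + 1)) - two (o (a, b + 1, false) (a, b + 1)) -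
          two (o (a, b, true) (a + 1, b)))
    have c0 : ∀ a b, G a b + (G a b + o (a, b, false) (a + 1, b) + o (a, b, true) (a + 1, b)) =
        o (a, b, false) (a + 1, b) + o (a, b, true) (a + 1, b) := fun a b => by
      linear_combination two (G a b)
    have c1 : ∀ a b, G (a + 1) b + (G a b + o (a, b, false) (a + 1, b) +
        o (a, b, true) (a + 1, b)) =
        o (a + 1, b, false) (a + 1, b) + o (a, b, true) (a + 1, b) := fun a b => by
      linear_combination two (G a b) + (hG a b).1 + two (o (a, b, false) (a + 1, b))
    have c2 : ∀ a b, G a (b + 1) + (G a b + o (a, b, false) (a + 1, b) +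
        o (a, b, true) (a + 1, b)) =
        o (a, b + 1, false) (a, b + 1) + o (a, b, true) (a, b + 1) := fun a b => by
      linear_combination two (G a b) + (hG a b).2 - e0 a b + two (o (a, b, false) (a, b + 1))
    refine ⟨fun v => bif v.2.2 then G v.1 v.2.1 + o (v.1, v.2.1, false) (v.1 + 1, v.2.1) +
      o (v.1, v.2.1, true) (v.1 + 1, v.2.1) else G v.1 v.2.1, ?_⟩
    rintro ⟨a, b, s⟩ k
    have h1 := c1 (a - 1) b
    have h2 := c2 a (b - 1)
    have h1' := e1 (a + 1) b
    have h2' := e2 a b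
    rw [sub_add_cancel] at h1 h2
    rw [add_sub_cancel_right] at h1'
    cases s <;> fin_cases k
    · simp
      linear_combination c0 a b - e0 a b
    · simp
      linear_combination h1
    · simp
      linear_combination h2 - h2'
    · simp
      linear_combination c0 a b
    · simp
      linear_combination c1 a b + h1'
    · simp
      linear_combination c2 a b

theorem hexagonalLattice_star (a b c e : ℤ) (s t : Bool) :
    hexagonalLattice.starGraph.Adj (a, b, s) (c, e, t) ↔
      (s = t ∧ ((c = a + 1 ∧ e = b) ∨ (c = a - 1 ∧ e = b) ∨ (c = a ∧ e = b + 1) ∨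
        (c = a ∧ e = b - 1) ∨ (c = a + 1 ∧ e = b - 1) ∨ (c = a - 1 ∧ e = b + 1))) ∨
      (s = false ∧ t = true ∧ ((c = a ∧ e = b) ∨ (c = a - 1 ∧ e = b) ∨ (c = a ∧ e = b - 1) ∨
        (c = a - 1 ∧ e = b - 1) ∨ (c = a + 1 ∧ e = b - 1) ∨ (c = a - 1 ∧ e = b + 1))) ∨
      (s = true ∧ t = false ∧ ((c = a ∧ e = b) ∨ (c = a + 1 ∧ e = b) ∨ (c = a ∧ e = b + 1) ∨
        (c = a + 1 ∧ e = b + 1) ∨ (c = a + 1 ∧ e = b - 1) ∨ (c = a - 1 ∧ e = b + 1))) := by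
  rw [hexagonalRotation.starAdj_iff]
  simp only [hexagonalRotation, Fin.exists_fin_succ, Prod.ext_iff]
  cases s <;> cases t <;> simp <;> omega

theorem hexagonalLattice_oneEnded : hexagonalLattice.OneEnded := by
  have up : ∀ a b, hexagonalLattice.graph.Adj (a, b, false) (a, b, true) := fun a b =>
    (hexagonalLattice_adj _ _ _ _ _ _).2 (by simp)
  have right : ∀ a b, hexagonalLattice.graph.Adj (a, b, true) (a + 1, b, false) := fun a b =>
    (hexagonalLattice_adj _ _ _ _ _ _).2 (by simp)
  have top : ∀ a b, hexagonalLattice.graph.Adj (a, b, true) (a, b + 1, false) := fun a b =>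
    (hexagonalLattice_adj _ _ _ _ _ _).2 (by simp)
  refine oneEnded_of_steps (fun v => (v.1, v.2.1)) (fun p => (p.1, p.2, false)) ?_ ?_ ?_ ?_
  · intro B hB
    refine ((hB.prod (Set.finite_univ (α := Bool))).image fun q => (q.1.1, q.1.2, q.2)).subset ?_
    rintro ⟨a, b, s⟩ h
    exact ⟨((a, b), s), ⟨h, trivial⟩, rfl⟩
  · rintro ⟨a, b, s⟩ S h
    cases s
    · exact .refl (h _ rfl)
    · exact .of_adj (up a b).symm (h _ rfl) (h _ rfl)
  · intro a b S h
    exact (JoinedWithin.of_adj (up a b) (h _ rfl) (h _ rfl)).trans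
      (.of_adj (right a b) (h _ rfl) (h _ rfl))
  · intro a b S h
    exact (JoinedWithin.of_adj (up a b) (h _ rfl) (h _ rfl)).trans
      (.of_adj (top a b) (h _ rfl) (h _ rfl))

theorem hexagonalRotation_growthBound : hexagonalRotation.GrowthBound 3 :=
  hexagonalRotation.growthBound_of_le (by norm_num) (by norm_num) (by norm_num) (by norm_num)

theorem eq_of_two_of_three : ∀ p : Fin 3 → Bool, (Finset.univ.filter fun k => p k).card = 2 →
    ∀ k l, ¬ p k → ¬ p l → k = l := by
  decide

theorem eq_of_two_of_three' : ∀ (p : Fin 3 → Bool) (j : Fin 3),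
    (Finset.univ.filter fun k => p k).card = 2 → p j →
      (¬ p (j + 1) ∧ p (j + 2)) ∨ (p (j + 1) ∧ ¬ p (j + 2)) := by
  decide

/-- A vertex of degree three with two neighbours outside cannot meet both sets, so only the second
kind of interlocking occurs, and both of its vertices are needed for the bridge. The neighbours in
`C` and `C'` must lie on opposite sides of the edge, since on the same side they share a face. -/
theorem RotationSystem.hasBridges_three {V F : Type} [DecidableEq V] [DecidableEq F]
    {P : PlaneGraph V} {g : ℕ} (T : RotationSystem P 3 g F)
    (hL : ∀ x j, T.left (T.nbr x j) j = T.left x (j + 2))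
    (hback : ∀ x j, T.nbr (T.nbr x j) j = x) : T.HasBridges 6 := by
  classical
  rintro C C' hdis ⟨hst, ⟨x, hx, h2, ⟨u, hu, huC⟩, ⟨w, hw, hwC⟩⟩ |
    ⟨x, hx, y, hy, hxy, ⟨h1, h1'⟩, h2, h2'⟩⟩
  · rw [T.ncard_neighborSet_diff] at h2
    obtain ⟨k, rfl⟩ := (T.adj_iff _ _).1 hu
    obtain ⟨l, rfl⟩ := (T.adj_iff _ _).1 hw
    have := eq_of_two_of_three (fun k => decide (T.nbr x k ∉ (C ∪ C' : Set V))) (by simpa using h2)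
      k l (by simpa using fun h => absurd (Finset.mem_coe.1 huC) h) (by simpa using fun _ => hwC)
    subst this
    exact absurd hwC (Finset.disjoint_left.1 hdis huC)
  obtain ⟨j, rfl⟩ := (T.adj_iff _ _).1 hxy
  have hx' := infComp_notMem hx
  have hy' := infComp_notMem hy
  rw [T.ncard_neighborSet_diff] at h1 h2
  simp only [Finset.mem_coe] at h1 h2
  have a1 : ∀ j : Fin 3, j + 2 + 2 = j + 1 := by decide
  have a2 : ∀ j : Fin 3, j + 2 + 1 = j := by decide
  have a3 : ∀ j : Fin 3, j + 1 + 1 = j + 2 := by decide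
  have a4 : ∀ j : Fin 3, j + 2 - 1 = j + 1 := by decide
  have a5 : ∀ j : Fin 3, j + 1 - 1 = j := by decide
  have a6 : ∀ j k : Fin 3, k = j ∨ k = j + 1 ∨ k = j + 2 := by decide
  have a7 : ∀ j : Fin 3, j + 1 ≠ j ∧ j + 2 ≠ j := by decide
  have hL' : T.left (T.nbr x j) (j + 2) = T.left x j := by
    have := hL (T.nbr x j) j
    rw [hback] at this
    exact this.symm
  have hC' : ∀ k, T.nbr x k ∉ C' := fun k hk =>
    Set.notMem_empty _ (h1'.subset ⟨T.adj_nbr x k, hk⟩)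
  have hC : ∀ k, T.nbr (T.nbr x j) k ∉ C := fun k hk =>
    Set.notMem_empty _ (h2'.subset ⟨T.adj_nbr _ k, hk⟩)
  have hsep : ∀ a ∈ C, ∀ b ∈ C', ∀ f, (∃ k, T.left a k = f) → ¬ ∃ k, T.left b k = f :=
    fun a ha b hb f hfa hfb => hst a ha b hb
      (T.star_of_cofacial (fun h => Finset.disjoint_left.1 hdis ha (h ▸ hb)) hfa hfb)
  have e1 := eq_of_two_of_three' (fun k => decide (T.nbr x k ∉ C)) j (by simpa using h1)
    (by simpa using fun h => hy' (.inl h))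
  have e2 := eq_of_two_of_three' (fun k => decide (T.nbr (T.nbr x j) k ∉ C')) j
    (by simpa using h2) (by rw [hback]; simpa using fun h => hx' (.inr h))
  simp only [decide_eq_true_eq, not_not] at e1 e2
  have hm : ∀ {f}, f ∈ T.touched C → f ∈ T.touched (C ∪ C') := fun h => by
    rw [T.touched_union]; exact Finset.mem_union_left _ h
  have hm' : ∀ {f}, f ∈ T.touched C' → f ∈ T.touched (C ∪ C') := fun h => by
    rw [T.touched_union]; exact Finset.mem_union_right _ h
  rcases e1 with ⟨p1, p2⟩ | ⟨p1, p2⟩ <;> rcases e2 with ⟨q1, q2⟩ | ⟨q1, q2⟩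
  · have t0 : T.left x j ∈ T.touched C := T.left_mem_touched_of_nbr_succ p1
    have t1 : T.left x (j + 1) ∈ T.touched C := T.left_mem_touched_of_nbr p1
    have t2 : T.left x (j + 2) ∈ T.touched C' := by
      rw [← hL]; exact T.left_mem_touched_of_nbr_succ q1
    have s0 : T.left (T.nbr x j) j ∈ T.touched C' := by rwa [hL]
    have s1 : T.left (T.nbr x j) (j + 1) ∈ T.touched C' := T.left_mem_touched_of_nbr q1
    have s2 : T.left (T.nbr x j) (j + 2) ∈ T.touched C := by rwa [hL']
    refine ⟨x, j + 2, T.nbr x j, j + 2, hx, hy,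
      .inr ⟨hxy, (T.nbr_injective x).ne (a7 j).2, ?_, rfl⟩, by simp [p2, hC'], by simp [q2, hC],
      fun k => ?_, fun k => ?_, fun k => ?_, fun k => ?_, by rwa [a4], t2, s2, by rwa [a4]⟩
    · exact fun h => (a7 j).2 (T.nbr_injective _ (h.trans (hback x j).symm))
    · rcases a6 j k with rfl | rfl | rfl
      exacts [hm t0, hm t1, hm' t2]
    · rcases a6 j k with rfl | rfl | rfl
      exacts [hm' s0, hm' s1, hm s2]
    · rcases a6 j k with rfl | rfl | rfl
      exacts [.inr (.inr (.inl rfl)), .inl (Finset.mem_union_left _ p1), .inr (.inl rfl)]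
    · rcases a6 j k with rfl | rfl | rfl
      exacts [.inr (.inr (.inl (hback _ _))), .inl (Finset.mem_union_right _ q1), .inr (.inl rfl)]
  · refine absurd (T.left_nbr (T.nbr x j) (j + 2)) (hsep _ p1 _ q2 _ ?_)
    rw [hL']
    exact T.left_nbr_succ x j
  · refine absurd (T.left_nbr_succ (T.nbr x j) j) (hsep _ p2 _ q1 _ ?_)
    rw [hL]
    exact T.left_nbr x (j + 2)
  · have t0 : T.left x j ∈ T.touched C' := by
      rw [← hL']; exact T.left_mem_touched_of_nbr q2
    have t1 : T.left x (j + 1) ∈ T.touched C := T.left_mem_touched_of_nbr_succ (by rwa [a3])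
    have t2 : T.left x (j + 2) ∈ T.touched C := T.left_mem_touched_of_nbr p2
    have s0 : T.left (T.nbr x j) j ∈ T.touched C := by rwa [hL]
    have s1 : T.left (T.nbr x j) (j + 1) ∈ T.touched C' :=
      T.left_mem_touched_of_nbr_succ (by rwa [a3])
    have s2 : T.left (T.nbr x j) (j + 2) ∈ T.touched C' := by rwa [hL']
    refine ⟨T.nbr x j, j + 1, x, j + 1, hy, hx,
      .inr ⟨hxy.symm, ?_, (T.nbr_injective x).ne (a7 j).1, rfl⟩, by simp [q1, hC], by simp [p1, hC'],
      fun k => ?_, fun k => ?_, fun k => ?_, fun k => ?_, by rwa [a5], s1, t1, by rwa [a5]⟩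
    · exact fun h => (a7 j).1 (T.nbr_injective _ (h.trans (hback x j).symm))
    · rcases a6 j k with rfl | rfl | rfl
      exacts [hm s0, hm' s1, hm' s2]
    · rcases a6 j k with rfl | rfl | rfl
      exacts [hm' t0, hm t1, hm t2]
    · rcases a6 j k with rfl | rfl | rfl
      exacts [.inr (.inr (.inl (hback _ _))), .inr (.inl rfl), .inl (Finset.mem_union_right _ q2)]
    · rcases a6 j k with rfl | rfl | rfl
      exacts [.inr (.inr (.inl rfl)), .inr (.inl rfl), .inl (Finset.mem_union_left _ p2)]

theorem hexagonalRotation_hasBridges : hexagonalRotation.HasBridges 6 := by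
  refine hexagonalRotation.hasBridges_three ?_ ?_
  · rintro ⟨a, b, s⟩ j
    cases s <;> fin_cases j <;> simp [hexagonalRotation]
  · rintro ⟨a, b, s⟩ j
    exact hexagonalRotation.nbr_rev _ _

/-- A horizontal zigzag path of the hexagonal lattice going to the left. -/
def hexagonalRay (a b : ℤ) (n : ℕ) : ℤ × ℤ × Bool := (a - ((n + 1) / 2 : ℕ), b, decide (n % 2 = 1))

theorem hexagonalRay_injective (a b : ℤ) : Function.Injective (hexagonalRay a b) := by
  intro m n h
  simp only [hexagonalRay, Prod.mk.injEq, decide_eq_decide, true_and] at h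
  omega

theorem hexagonalRay_adj (a b : ℤ) (n : ℕ) :
    hexagonalLattice.graph.Adj (hexagonalRay a b n) (hexagonalRay a b (n + 1)) := by
  rw [hexagonalRay, hexagonalRay, hexagonalLattice_adj]
  obtain ⟨m, rfl | rfl⟩ := Nat.even_or_odd' n
  · have h1 : (2 * m + 1) / 2 = m := by omega
    have h2 : (2 * m + 1 + 1) / 2 = m + 1 := by omega
    simp [h1, h2]
    omega
  · have h1 : (2 * m + 1 + 1) / 2 = m + 1 := by omega
    have h2 : (2 * m + 1 + 1 + 1) / 2 = m + 1 := by omega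
    have h3 : (2 * m + 1 + 1) % 2 = 0 := by omega
    simp [h1, h2, h3]

theorem hexagonalLattice_mem_infComp {D : Set (ℤ × ℤ × Bool)} {a b : ℤ}
    (hF : ∀ c ≤ a, (c, b, false) ∉ D) (hT : ∀ c < a, (c, b, true) ∉ D) :
    (a, b, false) ∈ hexagonalLattice.infComp D := by
  have := mem_infComp_of_ray (P := hexagonalLattice) (D := D) (hexagonalRay a b)
    (hexagonalRay_injective a b) (hexagonalRay_adj a b) (by
      intro n
      rcases Nat.mod_two_eq_zero_or_one n with h | h
      · simp only [hexagonalRay, h]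
        exact hF _ (by omega)
      · simp only [hexagonalRay, h]
        exact hT _ (by omega))
  simpa [hexagonalRay] using this

theorem hexagonalLattice_mem_infComp' {D : Set (ℤ × ℤ × Bool)} {a b : ℤ}
    (hF : ∀ c ≤ a, (c, b, false) ∉ D) (hT : ∀ c ≤ a, (c, b, true) ∉ D) :
    (a, b, true) ∈ hexagonalLattice.infComp D :=
  infComp_of_joined (.of_adj ((hexagonalLattice_adj _ _ _ _ _ _).2 (by simp)) (hF a le_rfl)
    (hT a le_rfl)) (hexagonalLattice_mem_infComp hF fun c hc => hT c hc.le)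

theorem hexagonalLattice_nbrs (c e : ℤ) (Q : ℤ × ℤ × Bool → Prop) (h1 : Q (c, e, true))
    (h2 : Q (c - 1, e, true)) (h3 : Q (c, e - 1, true)) :
    ∀ w, hexagonalLattice.graph.Adj (c, e, false) w → Q w := by
  rintro ⟨c', e', t⟩ h
  rcases (hexagonalLattice_adj _ _ _ _ _ _).1 h with ⟨-, rfl, ⟨rfl, rfl⟩ | ⟨rfl, rfl⟩ | ⟨rfl, rfl⟩⟩ |
    ⟨h, -⟩
  exacts [h1, h2, h3, absurd h (by decide)]

theorem hexagonalLattice_nbrs' (c e : ℤ) (Q : ℤ × ℤ × Bool → Prop) (h1 : Q (c, e, false))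
    (h2 : Q (c + 1, e, false)) (h3 : Q (c, e + 1, false)) :
    ∀ w, hexagonalLattice.graph.Adj (c, e, true) w → Q w := by
  rintro ⟨c', e', t⟩ h
  rcases (hexagonalLattice_adj _ _ _ _ _ _).1 h with ⟨h, -⟩ |
    ⟨-, rfl, ⟨rfl, rfl⟩ | ⟨rfl, rfl⟩ | ⟨rfl, rfl⟩⟩
  exacts [absurd h (by decide), h1, h2, h3]

/-- The second coordinate function is, up to a shift, twice the horizontal position. The search
follows the zigzag to the left of the leftmost point; a vertex that fails to be free forms with its
predecessor the second kind of interlocking, the only one possible in degree three. -/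
theorem hexagonalLattice_hasFreeRows : hexagonalLattice.HasFreeRows (fun v => v.2.1)
    fun v => 2 * v.1 + v.2.1 + bif v.2.2 then 1 else 0 := by
  rintro A D hAD ⟨a, b, s⟩ hp hrow hnext
  dsimp only at hrow hnext
  have star : ∀ c e s c' e' t,
      ((s = t ∧ ((c' = c + 1 ∧ e' = e) ∨ (c' = c - 1 ∧ e' = e) ∨ (c' = c ∧ e' = e + 1) ∨
        (c' = c ∧ e' = e - 1) ∨ (c' = c + 1 ∧ e' = e - 1) ∨ (c' = c - 1 ∧ e' = e + 1))) ∨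
      (s = false ∧ t = true ∧ ((c' = c ∧ e' = e) ∨ (c' = c - 1 ∧ e' = e) ∨ (c' = c ∧ e' = e - 1) ∨
        (c' = c - 1 ∧ e' = e - 1) ∨ (c' = c + 1 ∧ e' = e - 1) ∨ (c' = c - 1 ∧ e' = e + 1))) ∨
      (s = true ∧ t = false ∧ ((c' = c ∧ e' = e) ∨ (c' = c + 1 ∧ e' = e) ∨ (c' = c ∧ e' = e + 1) ∨
        (c' = c + 1 ∧ e' = e + 1) ∨ (c' = c + 1 ∧ e' = e - 1) ∨ (c' = c - 1 ∧ e' = e + 1)))) →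
      hexagonalLattice.starGraph.Adj (c, e, s) (c', e', t) := fun c e s c' e' t =>
    (hexagonalLattice_star _ _ _ _ _ _).2
  have adj : ∀ c e s c' e' t,
      ((s = false ∧ t = true ∧ ((c' = c ∧ e' = e) ∨ (c' = c - 1 ∧ e' = e) ∨ (c' = c ∧ e' = e - 1))) ∨
      (s = true ∧ t = false ∧ ((c' = c ∧ e' = e) ∨ (c' = c + 1 ∧ e' = e) ∨
        (c' = c ∧ e' = e + 1)))) → hexagonalLattice.graph.Adj (c, e, s) (c', e', t) :=
    fun c e s c' e' t => (hexagonalLattice_adj _ _ _ _ _ _).2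
  have hpA := hAD.subset hp
  have free : ∀ v x y z, v ∈ hexagonalLattice.extStarBoundary D → v.2.1 = b →
      hexagonalLattice.graph.Adj v x → hexagonalLattice.graph.Adj v y →
      hexagonalLattice.graph.Adj v z → x ∉ A → y ∉ A → z ∉ A → x ≠ y → x ≠ z → y ≠ z →
      ∃ v, hexagonalLattice.IsFree A v ∧ v ∈ hexagonalLattice.extStarBoundary D ∧ v.2.1 = b :=
    fun v x y z hv hb h1 h2 h3 k1 k2 k3 d1 d2 d3 =>
      ⟨v, isFree_of_three (hexagonalRotation.finite_neighborSet _) (hAD.notMem hv) h1 h2 h3 k1 k2 k3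
        d1 d2 d3, hv, hb⟩
  have r1 : a - 1 + 1 = a := by ring
  have r2 : a - 1 - 1 = a - 2 := by ring
  have r3 : a - 2 + 1 = a - 1 := by ring
  have n1 : ∀ c, c < a → (c, b + 1, false) ∉ D := fun c hc h => by
    have := hnext _ h rfl
    cases s <;> dsimp at this <;> omega
  cases s
  · have n0 : ∀ c, c < a → (c, b, false) ∉ D := fun c hc h => by
      have := hrow _ h rfl; dsimp at this; omega
    have n0' : ∀ c, c < a → (c, b, true) ∉ D := fun c hc h => by
      have := hrow _ h rfl; dsimp at this; omega
    have hv : (a - 1, b, true) ∈ hexagonalLattice.extStarBoundary D :=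
      ⟨hexagonalLattice_mem_infComp' (fun c hc => n0 c (by omega)) (fun c hc => n0' c (by omega)),
        _, hp, star _ _ _ _ _ _ (by simp)⟩
    have hw : (a - 1, b, false) ∈ hexagonalLattice.extStarBoundary D :=
      ⟨hexagonalLattice_mem_infComp (fun c hc => n0 c (by omega)) (fun c hc => n0' c (by omega)),
        _, hp, star _ _ _ _ _ _ (by simp)⟩
    have hupv : (a - 1, b + 1, false) ∉ A :=
      hAD.notMem_of_adj hp (star _ _ _ _ _ _ (by simp)) (n1 _ (by omega))
    -- If the vertex below `(a - 1, b, false)` belongs to `A`, it belongs to `D`, and the next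
    -- vertex `(a - 2, b, true)` of the zigzag is free; otherwise `(a - 1, b, false)` is.
    by_cases hdw : (a - 1, b - 1, true) ∈ A
    · have hdwD := hAD.mem_of_adj _ hp _ hdw (star _ _ _ _ _ _ (by simp))
      have hu : (a - 2, b, true) ∈ hexagonalLattice.extStarBoundary D :=
        ⟨hexagonalLattice_mem_infComp' (fun c hc => n0 c (by omega)) (fun c hc => n0' c (by omega)),
          _, hdwD, star _ _ _ _ _ _ (by simp; omega)⟩
      have hf : (a - 2, b, false) ∉ A :=
        hAD.notMem_of_adj hdwD (star _ _ _ _ _ _ (by simp; omega)) (n0 _ (by omega))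
      by_cases hupu : (a - 2, b + 1, false) ∈ A
      · refine absurd (hAD.two _ hw _ hu (adj _ _ _ _ _ _ (by simp; omega)) _ hdwD _ hupu
          (a - 1, b, true) (a - 2, b, false) (by simp) (by simp) (adj _ _ _ _ _ _ (by simp))
          (adj _ _ _ _ _ _ (by simp)) (hAD.notMem hv) hf
          (hexagonalLattice_nbrs _ _ _ ?_ ?_ ?_) (hexagonalLattice_nbrs' _ _ _ ?_ ?_ ?_))
          (n1 _ (by omega))
        · exact .inr (.inl rfl)
        · rw [r2]; exact .inl rfl
        · exact .inr (.inr (.refl hdw))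
        · exact .inr (.inl rfl)
        · rw [r3]; exact .inl rfl
        · exact .inr (.inr (.refl hupu))
      · exact free _ (a - 2, b, false) (a - 1, b, false) (a - 2, b + 1, false) hu rfl
          (adj _ _ _ _ _ _ (by simp)) (adj _ _ _ _ _ _ (by simp; omega)) (adj _ _ _ _ _ _ (by simp)) hf
          (hAD.notMem hw) hupu (by simp) (by simp) (by simp)
    · by_cases hu : (a - 2, b, true) ∈ A
      · refine absurd (hAD.two _ hv _ hw (adj _ _ _ _ _ _ (by simp)) _ hp _ hu
          (a - 1, b + 1, false) (a - 1, b - 1, true) (by simp) (by simp)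
          (adj _ _ _ _ _ _ (by simp)) (adj _ _ _ _ _ _ (by simp)) hupv hdw
          (hexagonalLattice_nbrs' _ _ _ ?_ ?_ ?_) (hexagonalLattice_nbrs _ _ _ ?_ ?_ ?_))
          (n0' _ (by omega))
        · exact .inl rfl
        · rw [r1]; exact .inr (.inr (.refl hpA))
        · exact .inr (.inl rfl)
        · exact .inl rfl
        · rw [r2]; exact .inr (.inr (.refl hu))
        · exact .inr (.inl rfl)
      · exact free _ (a - 1, b, true) (a - 2, b, true) (a - 1, b - 1, true) hw rfl
          (adj _ _ _ _ _ _ (by simp)) (adj _ _ _ _ _ _ (by simp; omega)) (adj _ _ _ _ _ _ (by simp))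
          (hAD.notMem hv) hu hdw (by simp) (by simp; omega) (by simp)
  · have n0 : ∀ c, c ≤ a → (c, b, false) ∉ D := fun c hc h => by
      have := hrow _ h rfl; dsimp at this; omega
    have n0' : ∀ c, c < a → (c, b, true) ∉ D := fun c hc h => by
      have := hrow _ h rfl; dsimp at this; omega
    have hv : (a, b, false) ∈ hexagonalLattice.extStarBoundary D :=
      ⟨hexagonalLattice_mem_infComp (fun c hc => n0 c (by omega)) (fun c hc => n0' c (by omega)),
        _, hp, star _ _ _ _ _ _ (by simp)⟩
    have hw : (a - 1, b, true) ∈ hexagonalLattice.extStarBoundary D :=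
      ⟨hexagonalLattice_mem_infComp' (fun c hc => n0 c (by omega)) (fun c hc => n0' c (by omega)),
        _, hp, star _ _ _ _ _ _ (by simp)⟩
    have hupw : (a - 1, b + 1, false) ∉ A :=
      hAD.notMem_of_adj hp (star _ _ _ _ _ _ (by simp)) (n1 _ (by omega))
    -- For this orientation of the leftmost point, `(a - 1, b, true)` is always free.
    by_cases hu : (a - 1, b, false) ∈ A
    · have hdnv : (a, b - 1, true) ∉ A := fun h => n0 (a - 1) (by omega) (hAD.mem_of_adj _
        (hAD.mem_of_adj _ hp _ h (star _ _ _ _ _ _ (by simp))) _ hu (star _ _ _ _ _ _ (by simp)))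
      refine absurd (hAD.two _ hv _ hw (adj _ _ _ _ _ _ (by simp)) _ hp _ hu
        (a, b - 1, true) (a - 1, b + 1, false) (by simp) (by simp) (adj _ _ _ _ _ _ (by simp))
        (adj _ _ _ _ _ _ (by simp)) hdnv hupw
        (hexagonalLattice_nbrs _ _ _ ?_ ?_ ?_) (hexagonalLattice_nbrs' _ _ _ ?_ ?_ ?_))
        (n0 _ (by omega))
      · exact .inr (.inr (.refl hpA))
      · exact .inl rfl
      · exact .inr (.inl rfl)
      · exact .inr (.inr (.refl hu))
      · rw [r1]; exact .inl rfl
      · exact .inr (.inl rfl)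
    · exact free _ (a - 1, b, false) (a, b, false) (a - 1, b + 1, false) hw rfl
        (adj _ _ _ _ _ _ (by simp)) (adj _ _ _ _ _ _ (by simp)) (adj _ _ _ _ _ _ (by simp)) hu
        (hAD.notMem hv) hupw (by simp) (by simp) (by simp)

/-- The reflection of the hexagonal lattice in a horizontal line. -/
def hexagonalReflection : ℤ × ℤ × Bool ≃ ℤ × ℤ × Bool where
  toFun v := (v.1 + v.2.1 - bif v.2.2 then 0 else 1, 1 - v.2.1, !v.2.2)
  invFun v := (v.1 + v.2.1 - bif v.2.2 then 0 else 1, 1 - v.2.1, !v.2.2)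
  left_inv := by rintro ⟨a, b, s⟩; cases s <;> simp
  right_inv := by rintro ⟨a, b, s⟩; cases s <;> simp

theorem hexagonalLattice_reflection : hexagonalLattice.IsAutomorphism hexagonalReflection := by
  constructor
  · rintro ⟨a, b, s⟩ ⟨c, e, t⟩
    simp only [hexagonalReflection, Equiv.coe_fn_mk, hexagonalLattice_adj]
    cases s <;> cases t <;> simp <;> omega
  · rintro ⟨a, b, s⟩ ⟨c, e, t⟩
    simp only [hexagonalReflection, Equiv.coe_fn_mk, hexagonalLattice_star]
    cases s <;> cases t <;> simp <;> omega

/-- The reflection of the hexagonal lattice that interchanges the two coordinates. -/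
def hexagonalSwap : ℤ × ℤ × Bool ≃ ℤ × ℤ × Bool where
  toFun v := (v.2.1, v.1, v.2.2)
  invFun v := (v.2.1, v.1, v.2.2)
  left_inv _ := rfl
  right_inv _ := rfl

theorem hexagonalLattice_swap : hexagonalLattice.IsAutomorphism hexagonalSwap := by
  constructor
  · rintro ⟨a, b, s⟩ ⟨c, e, t⟩
    simp only [hexagonalSwap, Equiv.coe_fn_mk, hexagonalLattice_adj]
    cases s <;> cases t <;> simp <;> omega
  · rintro ⟨a, b, s⟩ ⟨c, e, t⟩
    simp only [hexagonalSwap, Equiv.coe_fn_mk, hexagonalLattice_star]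
    cases s <;> cases t <;> simp <;> omega

/-- The factor 2 accounts for the two vertices that share each index `(a, b)`. -/
theorem card_le_two_mul_card_image_mul (E : Finset (ℤ × ℤ × Bool)) :
    E.card ≤ 2 * ((E.image fun v => v.2.1).card * (E.image fun v => v.1).card) := by
  rw [mul_comm 2, mul_comm (E.image fun v => v.2.1).card, mul_assoc, ← Fintype.card_bool,
    ← Finset.card_univ, ← Finset.card_product, ← Finset.card_product]
  refine Finset.card_le_card fun p hp => ?_
  exact Finset.mem_product.2 ⟨Finset.mem_image_of_mem _ hp, Finset.mem_product.2
    ⟨Finset.mem_image_of_mem (fun v : ℤ × ℤ × Bool => v.2.1) hp, Finset.mem_univ _⟩⟩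

theorem hexagonalLattice_hasClusterPaths : HasClusterPaths hexagonalLattice 3 := fun _ hc0 hc1 =>
  hexagonalRotation.main (K := 2) (r := 1) hexagonalLattice_oneEnded
    hexagonalRotation_growthBound (by norm_num) (by norm_num) (by norm_num)
    hexagonalRotation_hasBridges hexagonalLattice_hasFreeRows
    (by
      have := hexagonalLattice_hasFreeRows.comp hexagonalLattice_reflection
      have e2 : (fun v : ℤ × ℤ × Bool => 2 * v.1 + v.2.1 + bif v.2.2 then 1 else 0) =
          (fun v : ℤ × ℤ × Bool => 2 * v.1 + v.2.1 + bif v.2.2 then 1 else 0) ∘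
            hexagonalReflection := by
        ext ⟨a, b, s⟩; cases s <;> simp [hexagonalReflection] <;> ring
      rw [e2]
      exact this)
    hexagonalLattice_swap card_le_two_mul_card_image_mul hc0 hc1

/-! ### The constant `c‡` and the three lattices together -/

/-- No more than this is used about the discount: it is positive, for the gain, and at most 1, so
that weights stay nonnegative and κ/2 + c ≤ 4. -/
theorem PlanarLattice.cDagger_mem (L : PlanarLattice) : 0 < L.cDagger ∧ L.cDagger ≤ 1 := by
  have h3 : 0 ≤ √3 := Real.sqrt_nonneg 3
  have h2 : 0 ≤ √2 := Real.sqrt_nonneg 2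
  have h5 : 0 ≤ √5 := Real.sqrt_nonneg 5
  have key : ∀ b x : ℝ, 1 < b → 1 < x → x ≤ b → 0 < Real.logb b x ∧ Real.logb b x ≤ 1 := by
    intro b x hb hx hxb
    refine ⟨Real.logb_pos hb hx, ?_⟩
    rw [Real.logb_le_iff_le_rpow hb (by linarith), Real.rpow_one]
    exact hxb
  cases L
  · exact key _ _ (by simp only [lambdaHat]; linarith) (by simp only [deg]; norm_num)
      (by simp only [deg, lambdaHat]; norm_num; linarith)
  · exact key _ _ (by simp only [lambdaHat]; linarith) (by simp only [deg]; norm_num)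
      (by simp only [deg, lambdaHat]; norm_num; linarith)
  · exact key _ _ (by simp only [lambdaHat]; linarith) (by simp only [deg]; norm_num)
      (by simp only [deg, lambdaHat]; norm_num; linarith)

theorem mainTheorem2 (L : PlanarLattice) :
    ∃ c : ℝ, 0 < c ∧
      ∀ A : Set L.Vertex, A.Finite →
      ∀ D : Set L.Vertex, L.plane.IsInterlockedCluster A D →
      ∀ x ∈ L.plane.extStarBoundary D, ∀ y ∈ L.plane.extStarBoundary D,
        ∃ η : L.plane.graph.Walk x y,
          (∀ v ∈ η.support, v ∉ A) ∧
          L.weight A (L.plane.edgeRange η) ≤ L.nu * D.ncard + 4 ∧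
          (L.plane.IsExposed A D →
            L.weight A (L.plane.edgeRange η) ≤
              L.nu * D.ncard - c * Real.sqrt D.ncard + 4) := by
  obtain ⟨h0, h1⟩ := L.cDagger_mem
  cases L
  · have := squareLattice_hasClusterPaths _ h0 h1
    rw [Nat.cast_ofNat] at this
    exact this
  · have := triangularLattice_hasClusterPaths _ h0 h1
    rw [Nat.cast_one] at this
    exact this
  · have := hexagonalLattice_hasClusterPaths _ h0 h1
    rw [Nat.cast_ofNat] at this
    exact this
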